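/- Let $n\ge 4$, and let $Q$ be a Dynkin quiver of type $D_n$, that is, an arbitrary orientation of the Dynkin diagram of type $D_n$ with vertex set $I$. Let $\alpha_i$ $(i\in I)$ be the simple roots, $s_i$ the simple reflections and $\Phi^+$ the set of positive roots. Fix a height function $\xi:I\to\mathbb Z$ (so $\xi_j=\xi_i-1$ for every arrow $i\to j$ of $Q$), and let $\tau=s_{i_1}\cdots s_{i_n}$ be the Coxeter element adapted to $Q$: each vertex occurs exactly once among $i_1,\dots,i_n$, and $i_k$ is a source of the quiver $s_{i_{k-1}}\cdots s_{i_1}Q$ for every $k$, where $s_iQ$ is obtained from $Q$ by reversing all arrows at $i$. Let $\eta_i$ be the sum of the $\alpha_j$ over all $j$ from which there is a (possibly trivial) path to $i$ in $Q$. The repetition quiver $\mathbb ZQ$ has vertices $(i,p)\in I\times\mathbb Z$ with $p-\xi_i$ even and arrows $(i,p)\to(j,p+1)$ for $i,j$ adjacent. Let $\widehat\phi:\mathbb ZQ\to\Phi^+\times\mathbb Z$ be the bijection with $\widehat\phi(i,\xi_i)=(\eta_i,0)$ such that, if $\widehat\phi(i,p)=(\beta,m)$, then $\widehat\phi(i,p\mp2)$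 is $(\tau^{\pm1}\beta,m)$ if $\tau^{\pm1}\beta\in\Phi^+$ and $(-\tau^{\pm1}\beta,m\mp1)$ otherwise. The Auslander–Reiten quiver $\Gamma_Q$ is the full subquiver of $\mathbb ZQ$ on $\widehat\phi^{-1}(\Phi^+\times\{0\})$; its vertex set is identified with $\Phi^+$. Write $\alpha\prec_Q\beta$ if there is a nontrivial path from $\beta$ to $\alpha$ in $\Gamma_Q$. A total order $<$ on $\Phi^+$ is *convex* if, whenever $\alpha,\beta,\alpha+\beta\in\Phi^+$, either $\alpha<\alpha+\beta<\beta$ or $\beta<\alpha+\beta<\alpha$; it is *compatible with $\prec_Q$* if $\alpha\prec_Q\beta$ implies $\alpha<\beta$. For $\alpha,\beta\in\Phi^+$ with $\alpha<\beta$ and $\gamma=\alpha+\beta\in\Phi^+$, the pair $(\alpha,\beta)$ is a *minimal pair of $\gamma$ with respect to $<$* if there are no $\alpha',\beta'\in\Phi^+$ with $\alpha'+\beta'=\gamma$ and $\alpha<\alpha'<\gamma<\beta'<\beta$. A positive root $\gamma=\sum_i n_i\alpha_i$ is *multiplicity free* if $n_i\le1$ for all $i\in I$. **Theorem.** Let $\gamma\in\Phi^+$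 be non-simple. The following are equivalent: 1. for every unordered pair $\{\alpha,\beta\}$ of positive roots with $\alpha+\beta=\gamma$ there is a convex total order $<$ on $\Phi^+$, compatible with $\prec_Q$, such that $\{\alpha,\beta\}$, listed in increasing order, is a minimal pair of $\gamma$ with respect to $<$ (the order may depend on the pair); 2. $\gamma$ is multiplicity free. -/

import Mathlib

namespace TypeD

/-! ### Roots of type `D_n`

Vertices of the Dynkin diagram are `Fin n` (vertex `i : Fin n` is the usual vertex `i + 1`), and
the edges and pairings come from Mathlib's Cartan matrix `CartanMatrix.D n`.  -/

/-- The root lattice: `v : RootLattice n` is `∑ i, v i • α_i`. -/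
abbrev RootLattice (n : ℕ) : Type := Fin n → ℤ

/-- The simple root `α_i`. -/
def simpleRoot {n : ℕ} (i : Fin n) : RootLattice n := Pi.single i 1

/-- The pairing `v ↦ ⟨α_i^∨, v⟩ = ∑ j, C_{ij} v_j` with the simple coroot `α_i^∨`. -/
def simpleCoroot {n : ℕ} (i : Fin n) : Module.Dual ℤ (RootLattice n) :=
  (LinearMap.proj i).comp (CartanMatrix.D n).mulVecLin

theorem simpleCoroot_simpleRoot {n : ℕ} (i : Fin n) : simpleCoroot i (simpleRoot i) = 2 := by
  simp [simpleCoroot, simpleRoot]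

/-- The simple reflection `s_i : v ↦ v - ⟨α_i^∨, v⟩ α_i`. -/
def simpleReflection {n : ℕ} (i : Fin n) : RootLattice n ≃ₗ[ℤ] RootLattice n :=
  Module.reflection (simpleCoroot_simpleRoot i)

/-- The Weyl group, generated by the simple reflections. -/
def weylGroup (n : ℕ) : Subgroup (RootLattice n ≃ₗ[ℤ] RootLattice n) :=
  Subgroup.closure (Set.range simpleReflection)

/-- The roots are the images of the simple roots under the Weyl group. -/
def IsRoot {n : ℕ} (v : RootLattice n) : Prop :=
  ∃ w ∈ weylGroup n, ∃ i : Fin n, v = w (simpleRoot i)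

/-- A positive root is a root with nonnegative coefficients in the simple roots. -/
def IsPosRoot {n : ℕ} (v : RootLattice n) : Prop :=
  IsRoot v ∧ ∀ i, 0 ≤ v i

/-- The set `Φ⁺` of positive roots. -/
def PosRoot (n : ℕ) : Type := {v : RootLattice n // IsPosRoot v}

/-- A positive root is simple if it is some `α_i`. -/
def IsSimple {n : ℕ} (γ : PosRoot n) : Prop := ∃ i : Fin n, γ.1 = simpleRoot i

/-- `γ = ∑ n_i α_i` is multiplicity free if every `n_i ≤ 1`. -/
def IsMultiplicityFree {n : ℕ} (γ : PosRoot n) : Prop := ∀ i : Fin n, γ.1 i ≤ 1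

/-! ### Dynkin quivers -/

/-- Adjacency of two vertices in the Dynkin diagram. -/
def Adjacent {n : ℕ} (i j : Fin n) : Prop := i ≠ j ∧ CartanMatrix.D n i j ≠ 0

/-- A Dynkin quiver of type `D_n`: an orientation of the edges of the Dynkin diagram. -/
structure DynkinQuiver (n : ℕ) where
  /-- `arrow i j` means that there is an arrow `i → j`. -/
  arrow : Fin n → Fin n → Prop
  adjacent_iff : ∀ i j, Adjacent i j ↔ arrow i j ∨ arrow j i
  asymm : ∀ i j, arrow i j → ¬ arrow j i

namespace DynkinQuiver

variable {n : ℕ}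

/-- The vertex `i` is a source of `Q`: no arrow ends at `i`. -/
def IsSource (Q : DynkinQuiver n) (i : Fin n) : Prop := ∀ j, ¬ Q.arrow j i

/-- The quiver `s_i Q`: all arrows that start or end at `i` are reversed. -/
def reflectAt (Q : DynkinQuiver n) (i : Fin n) : DynkinQuiver n where
  arrow a b := ((a = i ∨ b = i) ∧ Q.arrow b a) ∨ (¬ (a = i ∨ b = i) ∧ Q.arrow a b)
  adjacent_iff a b := by
    rw [Q.adjacent_iff a b]
    tauto
  asymm a b := by
    have h1 := Q.asymm a b
    have h2 := Q.asymm b a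
    tauto

/-- The word `i_1, i_2, …, i_r` is adapted to `Q`: for every `k`, the vertex `i_k` is a source of
`s_{i_{k-1}} ⋯ s_{i_1} Q`. -/
def IsAdapted : DynkinQuiver n → List (Fin n) → Prop
  | _, [] => True
  | Q, i :: l => Q.IsSource i ∧ IsAdapted (Q.reflectAt i) l

/-- `τ` is the Coxeter element adapted to `Q`: the product `s_{i_1} ⋯ s_{i_n}` over a word adapted
to `Q` in which each vertex occurs exactly once. -/
def IsCoxeterElement (Q : DynkinQuiver n) (τ : RootLattice n ≃ₗ[ℤ] RootLattice n) : Prop :=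
  ∃ l : List (Fin n), l.Nodup ∧ (∀ i, i ∈ l) ∧ Q.IsAdapted l ∧ τ = (l.map simpleReflection).prod

/-- `ξ` is a height function on `Q`: `ξ_j = ξ_i - 1` for every arrow `i → j`. -/
def IsHeightFunction (Q : DynkinQuiver n) (ξ : Fin n → ℤ) : Prop :=
  ∀ i j, Q.arrow i j → ξ j = ξ i - 1

open Classical in
/-- The root `η_i`, the sum of the `α_j` over all `j` with a (possibly trivial) path from `j` to `i`
in `Q`. -/
noncomputable def eta (Q : DynkinQuiver n) (i : Fin n) : RootLattice n :=
  ∑ j : Fin n, if Relation.ReflTransGen Q.arrow j i then simpleRoot j else 0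

/-! ### The Auslander-Reiten quiver and its order -/

/-- `Q.Coord ξ τ i p β m` means that the bijection `φ̂` from the repetition quiver `ℤQ` to `Φ⁺ × ℤ`
sends the vertex `(i, p)` to `(β, m)`.  The rules are: `φ̂ (i, ξ_i) = (η_i, 0)`, and if
`φ̂ (i, p) = (β, m)`, then `φ̂ (i, p - 2)` is `(τ β, m)` or `(-τ β, m - 1)`, and `φ̂ (i, p + 2)` is
`(τ⁻¹ β, m)` or `(-τ⁻¹ β, m + 1)`, whichever has a positive root as its first component. -/
inductive Coord (Q : DynkinQuiver n) (ξ : Fin n → ℤ) (τ : RootLattice n ≃ₗ[ℤ] RootLattice n) :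
    Fin n → ℤ → RootLattice n → ℤ → Prop
  | base (i : Fin n) : Coord Q ξ τ i (ξ i) (Q.eta i) 0
  | down_pos {i : Fin n} {p : ℤ} {β : RootLattice n} {m : ℤ} :
      Coord Q ξ τ i p β m → IsPosRoot (τ β) → Coord Q ξ τ i (p - 2) (τ β) m
  | down_neg {i : Fin n} {p : ℤ} {β : RootLattice n} {m : ℤ} :
      Coord Q ξ τ i p β m → IsPosRoot (-τ β) → Coord Q ξ τ i (p - 2) (-τ β) (m - 1)
  | up_pos {i : Fin n} {p : ℤ} {β : RootLattice n} {m : ℤ} :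
      Coord Q ξ τ i p β m → IsPosRoot (τ⁻¹ β) → Coord Q ξ τ i (p + 2) (τ⁻¹ β) m
  | up_neg {i : Fin n} {p : ℤ} {β : RootLattice n} {m : ℤ} :
      Coord Q ξ τ i p β m → IsPosRoot (-τ⁻¹ β) → Coord Q ξ τ i (p + 2) (-τ⁻¹ β) (m + 1)

/-- The arrows of the Auslander-Reiten quiver `Γ_Q`, the full subquiver of the repetition quiver on
the vertices `(i, p)` with `φ̂ (i, p) ∈ Φ⁺ × {0}`.  Each vertex is identified with the corresponding
positive root.  The arrows of the repetition quiver are `(i, p) → (j, p + 1)` for `i`, `j` adjacent. -/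
def ARArrow (Q : DynkinQuiver n) (ξ : Fin n → ℤ) (τ : RootLattice n ≃ₗ[ℤ] RootLattice n)
    (β β' : PosRoot n) : Prop :=
  ∃ (i j : Fin n) (p : ℤ), Q.Coord ξ τ i p β.1 0 ∧ Q.Coord ξ τ j (p + 1) β'.1 0 ∧ Adjacent i j

/-- The strict partial order `α ≺_Q β`: there is a nontrivial path from `β` to `α` in `Γ_Q`. -/
def ARLt (Q : DynkinQuiver n) (ξ : Fin n → ℤ) (τ : RootLattice n ≃ₗ[ℤ] RootLattice n)
    (α β : PosRoot n) : Prop :=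
  Relation.TransGen (Q.ARArrow ξ τ) β α

end DynkinQuiver

/-! ### Convex orders and minimal pairs -/

/-- The order `lt` on `Φ⁺` is convex: if `γ = α + β` for `α, β, γ ∈ Φ⁺`, then `γ` lies strictly
between `α` and `β`. -/
def IsConvexOrder {n : ℕ} (lt : PosRoot n → PosRoot n → Prop) : Prop :=
  ∀ α β γ : PosRoot n, α.1 + β.1 = γ.1 → (lt α γ ∧ lt γ β) ∨ (lt β γ ∧ lt γ α)

/-- `(α, β)` is a minimal pair of `γ` with respect to the total order `lt`: `α < β`, `γ = α + β`,
and there is no pair `(α', β')` with `γ = α' + β'` and `α < α' < γ < β' < β`. -/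
def IsMinimalPair {n : ℕ} (lt : PosRoot n → PosRoot n → Prop) (α β γ : PosRoot n) : Prop :=
  lt α β ∧ α.1 + β.1 = γ.1 ∧
    ¬ ∃ α' β' : PosRoot n, α'.1 + β'.1 = γ.1 ∧ lt α α' ∧ lt α' γ ∧ lt γ β' ∧ lt β' β

/-- `lt` is a convex total order on `Φ⁺` compatible with `≺_Q`. -/
structure IsCompatibleOrder {n : ℕ} (Q : DynkinQuiver n) (ξ : Fin n → ℤ)
    (τ : RootLattice n ≃ₗ[ℤ] RootLattice n) (lt : PosRoot n → PosRoot n → Prop) : Prop where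
  total : IsStrictTotalOrder (PosRoot n) lt
  convex : IsConvexOrder lt
  compatible : ∀ α β : PosRoot n, Q.ARLt ξ τ α β → lt α β

end TypeD

/-!
Twice a root of type `D_n` is a sum of two vectors of the form `±2ε_k`. The adapted Coxeter
element permutes `2n - 2` of these vectors cyclically and negates the remaining two, so the former
can be placed on the integers: the vector at the position `x` is `epsVec ξ x`, a translation by
two is the inverse Coxeter element, and a translation by `M = 2n - 2` is a change of sign. The
vertex `(i, p)` of the repetition quiver carries half of `epsVec (p + r) - epsVec (p - r)` if `i`
is the `r`-th vertex of the long arm, and half of the sum of `epsVec (p + n - 1)` and one of the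
two negated vectors if `i` is one of the two end vertices of the fork (`doubleRoot`). Everything
is expressed by the height function, so all orientations are treated alike. The vertices of the
Auslander-Reiten quiver are those between the height function and its translate under the Nakayama
permutation (`InBand`, `IsCoxeterElement.coord_zero_iff`), and each of them stands for an interval
`[p - r, p + r]` of positions, which has length `M` for the tips of the fork.

In these terms there is a nontrivial path between two vertices if and only if the second one has a
larger `p` and its interval lies weakly to the right of that of the first (`arLt_iff_ahead`). If
`γ = α + β` and `γ` has the interval `[a, b]`, translating the equation by powers of the Coxeter
element and reading it at the far end of the long arm leaves only a handful of relative positions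
for the intervals of `α` and `β` (`At.split`). In each of them `γ` lies strictly between `α` and
`β` in the order `≺` given by the paths (`arLt_or_of_add_eq`), so that every total order
compatible with `≺` is convex. Moreover, two decompositions of `γ` are nested in this order only
if the outer one is `[b - M, d] + [d, a + M]` for some `d` (`At.straddle_of_nested`). By the
bounds on the ends of the intervals, `[a, b]` then has in its interior the one position `c`, up to
multiples of `M`, at which `epsVec` vanishes at the branch vertex, and the branch vertex has
multiplicity two in `γ` (`not_nested_of_isMultiplicityFree`). Conversely, every root with a
multiplicity above one has such an interval, and then it has the nested decompositions `[a, c] +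
[c, b]` and `[b - M, c] + [c, a + M]` (`exists_nested_of_two_le`).

If `γ` is not multiplicity free, the outer pair of two nested decompositions is thus not minimal
for any compatible order. If `γ` is multiplicity free, then for a pair `α ≺ γ ≺ β` there is a
linear extension of `≺` in which only the roots between `α` and `β` for `≺` lie between `α` and
`β` (`exists_linear_extension_between`), and for this order the pair is minimal.
-/

namespace TypeD

variable {n : ℕ}

/-! ### The Dynkin diagram -/

theorem adjacent_iff_val (hn : 4 ≤ n) (i j : Fin n) :
    Adjacent i j ↔ (i.val + 1 = j.val ∧ j.val + 2 < n) ∨ (j.val + 1 = i.val ∧ i.val + 2 < n) ∨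
      (i.val + 3 = n ∧ (j.val + 2 = n ∨ j.val + 1 = n)) ∨
      (j.val + 3 = n ∧ (i.val + 2 = n ∨ i.val + 1 = n)) := by
  simp only [Adjacent, CartanMatrix.D, Matrix.of_apply, Ne, Fin.ext_iff]
  split_ifs <;> simp <;> omega

theorem Adjacent.symm {i j : Fin n} (h : Adjacent i j) : Adjacent j i := by
  refine ⟨h.1.symm, ?_⟩
  have h2 := h.2
  rwa [← CartanMatrix.D_transpose, Matrix.transpose_apply] at h2

/-- A vertex is a tip if it is one of the two end vertices of the fork. -/
def IsTip (i : Fin n) : Prop := n ≤ i.val + 2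

instance (i : Fin n) : Decidable (IsTip i) := inferInstanceAs (Decidable (n ≤ i.val + 2))

/-- The row of a vertex, counted from `1` at the far end of the long arm; both tips are in
row `n - 1`. -/
def row (i : Fin n) : ℤ := if IsTip i then (n : ℤ) - 1 else i.val + 1

/-- The distance of two vertices in the diagram. -/
def diagDist (i j : Fin n) : ℤ :=
  if IsTip i ∧ IsTip j ∧ i ≠ j then 2 else |row i - row j|

theorem diagDist_self (i : Fin n) : diagDist i i = 0 := by simp [diagDist]

theorem diagDist_comm (i j : Fin n) : diagDist i j = diagDist j i := by
  unfold diagDist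
  rw [abs_sub_comm]
  exact if_congr (by tauto) rfl rfl

/-- The diagram distance in a form suited to linear arithmetic. -/
theorem diagDist_spec (i j : Fin n) :
    (i.val = j.val ∧ diagDist i j = 0) ∨
    (i.val < j.val ∧ i.val + 2 < n ∧ j.val + 1 < n ∧ diagDist i j = j.val - i.val) ∨
    (i.val < j.val ∧ i.val + 2 < n ∧ j.val + 1 = n ∧ diagDist i j = j.val - i.val - 1) ∨
    (j.val < i.val ∧ j.val + 2 < n ∧ i.val + 1 < n ∧ diagDist i j = i.val - j.val) ∨
    (j.val < i.val ∧ j.val + 2 < n ∧ i.val + 1 = n ∧ diagDist i j = i.val - j.val - 1) ∨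
    (i.val ≠ j.val ∧ n ≤ i.val + 2 ∧ n ≤ j.val + 2 ∧ diagDist i j = 2) := by
  have hi := i.2
  have hj := j.2
  unfold diagDist
  by_cases h : IsTip i ∧ IsTip j ∧ i ≠ j
  · have h' : i.val ≠ j.val := fun e => h.2.2 (Fin.ext e)
    have h1 : n ≤ i.val + 2 := h.1
    have h2 : n ≤ j.val + 2 := h.2.1
    rw [if_pos h]
    omega
  · rw [if_neg h]
    simp only [IsTip, Ne, Fin.ext_iff] at h
    simp only [row, IsTip]
    split_ifs <;> simp only [abs_eq_max_neg] <;> omega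

theorem row_spec (i : Fin n) :
    (i.val + 2 < n ∧ row i = i.val + 1) ∨ (n ≤ i.val + 2 ∧ row i = n - 1) := by
  simp only [row, IsTip]
  split_ifs <;> omega

theorem row_le (i : Fin n) : row i ≤ n - 1 := by
  have := row_spec i
  omega

theorem abs_row_sub_le_diagDist (i j : Fin n) :
    row i - row j ≤ diagDist i j ∧ row j - row i ≤ diagDist i j ∧ 0 ≤ diagDist i j := by
  have h1 := row_spec i
  have h2 := row_spec j
  have h3 := diagDist_spec i j
  omega

theorem exists_adjacent_closer (hn : 4 ≤ n) {i j : Fin n} (h : i ≠ j) :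
    ∃ k, Adjacent j k ∧ diagDist k i = diagDist j i - 1 := by
  have hi := i.2
  have hj := j.2
  have h' : i.val ≠ j.val := fun e => h (Fin.ext e)
  have key : ∀ k : Fin n,
      ((j.val < i.val ∧ j.val + 3 < n ∧ k.val = j.val + 1) ∨
       (j.val < i.val ∧ j.val + 3 = n ∧ k.val = i.val) ∨
       (i.val < j.val ∧ j.val + 2 < n ∧ k.val = j.val - 1) ∨
       (n ≤ j.val + 2 ∧ k.val = n - 3)) →
      Adjacent j k ∧ diagDist k i = diagDist j i - 1 := by
    intro k hk
    rw [adjacent_iff_val hn]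
    have h1 := diagDist_spec k i
    have h2 := diagDist_spec j i
    omega
  by_cases h1 : n ≤ j.val + 2
  · exact ⟨⟨n - 3, by omega⟩, key _ (by simp; omega)⟩
  · rcases lt_or_gt_of_ne h' with h2 | h2
    · exact ⟨⟨j.val - 1, by omega⟩, key _ (by simp; omega)⟩
    · by_cases h3 : j.val + 3 = n
      · exact ⟨i, key _ (by omega)⟩
      · exact ⟨⟨j.val + 1, by omega⟩, key _ (by simp; omega)⟩

theorem exists_adjacent (hn : 4 ≤ n) (j : Fin n) : ∃ k, Adjacent j k := by
  by_cases h : j = ⟨0, by omega⟩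
  · obtain ⟨k, hk, -⟩ := exists_adjacent_closer hn (i := ⟨1, by omega⟩) (j := j)
      (by rw [h]; simp)
    exact ⟨k, hk⟩
  · obtain ⟨k, hk, -⟩ := exists_adjacent_closer hn (Ne.symm h)
    exact ⟨k, hk⟩

theorem diagDist_le_of_adjacent (hn : 4 ≤ n) {j k : Fin n} (h : Adjacent j k) (i : Fin n) :
    diagDist k i ≤ diagDist j i + 1 ∧ diagDist j i ≤ diagDist k i + 1 := by
  rw [adjacent_iff_val hn] at h
  have h1 := diagDist_spec k i
  have h2 := diagDist_spec j i
  have := i.2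
  have := j.2
  have := k.2
  omega

open Classical in
/-- The sum of `g` over the neighbours of `k`. -/
noncomputable def neighborSum (g : Fin n → ℤ) (k : Fin n) : ℤ :=
  ∑ j, if Adjacent k j then g j else 0

theorem neighborSum_of_iff_or {g : Fin n → ℤ} {k a b : Fin n} (hab : a ≠ b)
    (h : ∀ j, Adjacent k j ↔ j = a ∨ j = b) : neighborSum g k = g a + g b := by
  classical
  have : ∀ j, (if Adjacent k j then g j else 0) =
      (if j = a then g j else 0) + (if j = b then g j else 0) := by
    intro j
    rw [if_congr (h j) rfl rfl]
    by_cases h1 : j = a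
    · subst h1; simp [hab]
    · simp [h1]
  unfold neighborSum
  rw [Finset.sum_congr rfl fun j _ => this j, Finset.sum_add_distrib]
  simp

theorem neighborSum_zero (hn : 4 ≤ n) (g : Fin n → ℤ) :
    neighborSum g ⟨0, by omega⟩ = g ⟨1, by omega⟩ := by
  classical
  unfold neighborSum
  rw [Finset.sum_eq_single ⟨1, by omega⟩]
  · rw [if_pos]; rw [adjacent_iff_val hn]; simp; omega
  · intro b _ hb
    rw [if_neg]; rw [adjacent_iff_val hn]
    have : b.val ≠ 1 := fun e => hb (Fin.ext e)
    simp; omega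
  · simp

theorem neighborSum_middle (hn : 4 ≤ n) (g : Fin n → ℤ) (k : ℕ) (hk : k + 4 < n) :
    neighborSum g ⟨k + 1, by omega⟩ = g ⟨k, by omega⟩ + g ⟨k + 2, by omega⟩ := by
  apply neighborSum_of_iff_or
  · simp
  · intro j
    rw [adjacent_iff_val hn]
    simp only [Fin.ext_iff]
    omega

theorem neighborSum_fork (hn : 4 ≤ n) (g : Fin n → ℤ) :
    neighborSum g ⟨n - 3, by omega⟩ =
      g ⟨n - 4, by omega⟩ + g ⟨n - 2, by omega⟩ + g ⟨n - 1, by omega⟩ := by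
  classical
  have : ∀ j, (if Adjacent ⟨n - 3, by omega⟩ j then g j else 0) =
      (if j = ⟨n - 4, by omega⟩ then g j else 0) + (if j = ⟨n - 2, by omega⟩ then g j else 0)
        + (if j = ⟨n - 1, by omega⟩ then g j else 0) := by
    intro j
    rw [if_congr (adjacent_iff_val hn _ j) rfl rfl]
    simp only [Fin.ext_iff]
    split_ifs <;> omega
  unfold neighborSum
  rw [Finset.sum_congr rfl fun j _ => this j, Finset.sum_add_distrib, Finset.sum_add_distrib]
  simp

theorem neighborSum_tip (hn : 4 ≤ n) (g : Fin n → ℤ) (k : Fin n) (hk : IsTip k) :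
    neighborSum g k = g ⟨n - 3, by omega⟩ := by
  classical
  have hk' : n ≤ k.val + 2 := hk
  have := k.2
  unfold neighborSum
  rw [Finset.sum_eq_single ⟨n - 3, by omega⟩]
  · rw [if_pos]; rw [adjacent_iff_val hn]; simp; omega
  · intro b _ hb
    rw [if_neg]; rw [adjacent_iff_val hn]
    have : b.val ≠ n - 3 := fun e => hb (Fin.ext e)
    omega
  · simp

theorem vertex_cases (hn : 4 ≤ n) (k : Fin n) :
    k = ⟨0, by omega⟩ ∨ (∃ (l : ℕ) (hl : l + 4 < n), k = ⟨l + 1, by omega⟩) ∨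
      k = ⟨n - 3, by omega⟩ ∨ IsTip k := by
  simp only [Fin.ext_iff, IsTip]
  by_cases h : k.val = 0 ∨ k.val = n - 3 ∨ n ≤ k.val + 2
  · tauto
  · exact Or.inr (Or.inl ⟨k.val - 1, by omega, by omega⟩)

/-- The pairing with a simple coroot, expressed through the neighbours of the vertex. -/
theorem simpleCoroot_apply (k : Fin n) (v : RootLattice n) :
    simpleCoroot k v = 2 * v k - neighborSum v k := by
  classical
  simp only [simpleCoroot, LinearMap.comp_apply, LinearMap.proj_apply, Matrix.mulVecLin_apply,
    Matrix.mulVec, dotProduct, neighborSum]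
  have : ∀ j, CartanMatrix.D n k j * v j =
      (if j = k then 2 * v j else 0) - (if Adjacent k j then v j else 0) := by
    intro j
    by_cases h : k = j
    · subst h; simp [Adjacent]
    · have h2 : CartanMatrix.D n k j = 0 ∨ CartanMatrix.D n k j = -1 := by
        simp only [CartanMatrix.D, Matrix.of_apply]
        split_ifs <;> simp
      rcases h2 with h2 | h2 <;> simp [Adjacent, h, Ne.symm h, h2]
  rw [Finset.sum_congr rfl fun j _ => this j, Finset.sum_sub_distrib]
  simp

theorem simpleReflection_apply (k : Fin n) (v : RootLattice n) :
    simpleReflection k v = v - simpleCoroot k v • simpleRoot k :=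
  Module.reflection_apply _ _

theorem simpleReflection_apply_of_ne {k j : Fin n} (h : j ≠ k) (v : RootLattice n) :
    simpleReflection k v j = v j := by
  simp [simpleReflection_apply, simpleRoot, h]

theorem simpleReflection_apply_self (k : Fin n) (v : RootLattice n) :
    simpleReflection k v k = neighborSum v k - v k := by
  simp [simpleReflection_apply, simpleRoot, simpleCoroot_apply k v]
  ring

/-! ### The Coxeter transformation -/

namespace DynkinQuiver

theorem IsSource.arrow {Q : DynkinQuiver n} {i j : Fin n} (h : Q.IsSource i) (hij : Adjacent i j) :
    Q.arrow i j :=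
  ((Q.adjacent_iff i j).1 hij).resolve_right (h j)

theorem arrow.adjacent {Q : DynkinQuiver n} {i j : Fin n} (h : Q.arrow i j) : Adjacent i j :=
  (Q.adjacent_iff i j).2 (Or.inl h)

end DynkinQuiver

theorem prod_simpleReflection_apply_of_notMem (l : List (Fin n)) {k : Fin n} (hk : k ∉ l)
    (v : RootLattice n) : (l.map simpleReflection).prod v k = v k := by
  induction l with
  | nil => simp
  | cons i l ih =>
    simp only [List.mem_cons, not_or] at hk
    rw [List.map_cons, List.prod_cons, LinearEquiv.mul_apply,
      simpleReflection_apply_of_ne hk.1, ih hk.2]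

open Classical in
/-- The coordinates of `w v`, for `w` the product of an adapted word, are determined by those
of `v` along the arrows of `Q`: a coordinate changes only once, and at that moment exactly the
targets of the arrows starting there still have to be updated. -/
theorem adapted_prod_apply (l : List (Fin n)) (Q : DynkinQuiver n) (hnd : l.Nodup)
    (hl : Q.IsAdapted l) (v : RootLattice n) (k : Fin n) (hk : k ∈ l) :
    (l.map simpleReflection).prod v k + v k =
      (∑ j, if Q.arrow j k then v j else 0) +
        ∑ j, if Q.arrow k j then (l.map simpleReflection).prod v j else 0 := by
  induction l generalizing Q k with
  | nil => simp at hk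
  | cons i l ih =>
    obtain ⟨hs, hl⟩ := hl
    obtain ⟨hil, hnd⟩ := List.nodup_cons.1 hnd
    have hi := prod_simpleReflection_apply_of_notMem l hil v
    rw [List.map_cons, List.prod_cons, LinearEquiv.mul_apply]
    set w := (l.map simpleReflection).prod v with hw
    by_cases hki : k = i
    · subst hki
      rw [simpleReflection_apply_self, hi, sub_add_cancel, Finset.sum_eq_zero, zero_add,
        neighborSum]
      · refine Finset.sum_congr rfl fun j _ => ?_
        by_cases h : Q.arrow k j
        · rw [if_pos h, if_pos h.adjacent, simpleReflection_apply_of_ne h.adjacent.1.symm]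
        · rw [if_neg h, if_neg fun h' => h (hs.arrow h')]
      · intro j _
        rw [if_neg (hs j)]
    · have hkl : k ∈ l := (List.mem_cons.1 hk).resolve_left hki
      rw [simpleReflection_apply_of_ne hki, ih (Q.reflectAt i) hnd hl k hkl,
        ← Finset.sum_add_distrib, ← Finset.sum_add_distrib]
      refine Finset.sum_congr rfl fun j _ => ?_
      by_cases hji : j = i
      · subst hji
        have h1 := hs k
        simp [DynkinQuiver.reflectAt, h1, hi]
      · rw [simpleReflection_apply_of_ne hji]
        simp [DynkinQuiver.reflectAt, hji, hki]

namespace DynkinQuiver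

variable {Q : DynkinQuiver n} {ξ : Fin n → ℤ} {τ : RootLattice n ≃ₗ[ℤ] RootLattice n}

open Classical in
theorem IsCoxeterElement.apply_add (hτ : Q.IsCoxeterElement τ) (v : RootLattice n) (k : Fin n) :
    τ v k + v k = (∑ j, if Q.arrow j k then v j else 0) + ∑ j, if Q.arrow k j then τ v j else 0 := by
  obtain ⟨l, hnd, hmem, hl, rfl⟩ := hτ
  exact adapted_prod_apply l Q hnd hl v k (hmem k)

theorem IsCoxeterElement.mem_weylGroup (hτ : Q.IsCoxeterElement τ) : τ ∈ weylGroup n := by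
  obtain ⟨l, -, -, -, rfl⟩ := hτ
  apply Subgroup.list_prod_mem
  intro s hs
  obtain ⟨i, -, rfl⟩ := List.mem_map.1 hs
  exact Subgroup.subset_closure ⟨i, rfl⟩

open Classical in
/-- The equations of `IsCoxeterElement.apply_add` determine `τ v`: they can be solved from the
sinks upwards. -/
theorem IsCoxeterElement.eq_of_apply_add (hτ : Q.IsCoxeterElement τ) (hξ : Q.IsHeightFunction ξ)
    {v w : RootLattice n}
    (h : ∀ k, w k + v k =
      (∑ j, if Q.arrow j k then v j else 0) + ∑ j, if Q.arrow k j then w j else 0) :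
    τ v = w := by
  have hne : ∀ (m : ℕ) (k : Fin n), ξ k - (⨅ i, ξ i) < m → τ v k = w k := by
    have hb : ∀ k, (⨅ i, ξ i) ≤ ξ k := fun k => ciInf_le (Set.finite_range ξ).bddBelow k
    intro m
    induction m with
    | zero => intro k hk; have := hb k; simp at hk; omega
    | succ m ih =>
      intro k hk
      have h1 := h k
      have h2 := hτ.apply_add v k
      have h3 : (∑ j, if Q.arrow k j then τ v j else 0) = ∑ j, if Q.arrow k j then w j else 0 := by
        refine Finset.sum_congr rfl fun j _ => ?_
        by_cases hkj : Q.arrow k j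
        · rw [if_pos hkj, if_pos hkj]
          apply ih
          rw [hξ k j hkj]
          push_cast at hk
          omega
        · rw [if_neg hkj, if_neg hkj]
      rw [h3] at h2
      linarith
  funext k
  exact hne (ξ k - (⨅ i, ξ i) + 1).toNat k (by omega)

theorem IsHeightFunction.adjacent (hξ : Q.IsHeightFunction ξ) {i j : Fin n} (h : Adjacent i j) :
    (Q.arrow i j ∧ ξ j = ξ i - 1) ∨ (Q.arrow j i ∧ ξ j = ξ i + 1) := by
  rcases (Q.adjacent_iff i j).1 h with h | h
  · exact Or.inl ⟨h, hξ i j h⟩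
  · refine Or.inr ⟨h, ?_⟩
    have := hξ j i h
    omega

/-- Height functions are `1`-Lipschitz, and their parity is that of the distance. -/
theorem IsHeightFunction.sub_le (hξ : Q.IsHeightFunction ξ) (hn : 4 ≤ n) (i j : Fin n) :
    ξ i - ξ j ≤ diagDist i j ∧ ξ j - ξ i ≤ diagDist i j ∧ (ξ i - ξ j - diagDist i j) % 2 = 0 := by
  have key : ∀ (m : ℕ) (j : Fin n), diagDist j i ≤ m →
      ξ i - ξ j ≤ diagDist j i ∧ ξ j - ξ i ≤ diagDist j i ∧
        (ξ i - ξ j - diagDist j i) % 2 = 0 := by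
    intro m
    induction m with
    | zero =>
      intro j hj
      have h1 := diagDist_spec j i
      have h2 : j = i := Fin.ext (by omega)
      subst h2
      simp [diagDist_self]
    | succ m ih =>
      intro j hj
      by_cases h : i = j
      · subst h
        simp [diagDist_self]
      · obtain ⟨k, hk, hd⟩ := exists_adjacent_closer hn h
        have := ih k (by push_cast at hj; omega)
        have := hξ.adjacent hk
        omega
  rw [diagDist_comm]
  exact key (diagDist j i).toNat j (by omega)

theorem IsHeightFunction.sub_row_mod_two (hξ : Q.IsHeightFunction ξ) (hn : 4 ≤ n) (i j : Fin n) :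
    (ξ i - ξ j - row i - row j) % 2 = 0 := by
  have := hξ.sub_le hn i j
  have := row_spec i
  have := row_spec j
  have := diagDist_spec i j
  omega

theorem IsHeightFunction.reflTransGen_iff (hξ : Q.IsHeightFunction ξ) (hn : 4 ≤ n) (i j : Fin n) :
    Relation.ReflTransGen Q.arrow j i ↔ ξ j - ξ i = diagDist j i := by
  constructor
  · intro h
    refine le_antisymm (hξ.sub_le hn j i).1 ?_
    induction h using Relation.ReflTransGen.head_induction_on with
    | refl => simp [diagDist_self]
    | head h _ ih =>
      have := hξ _ _ h
      have := diagDist_le_of_adjacent hn h.adjacent i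
      omega
  · have key : ∀ (m : ℕ) (j : Fin n), diagDist j i ≤ m → ξ j - ξ i = diagDist j i →
        Relation.ReflTransGen Q.arrow j i := by
      intro m
      induction m with
      | zero =>
        intro j hj _
        have h1 := diagDist_spec j i
        have h2 : j = i := Fin.ext (by omega)
        subst h2
        exact .refl
      | succ m ih =>
        intro j hj hd
        by_cases h : i = j
        · subst h
          exact .refl
        · obtain ⟨k, hk, hk'⟩ := exists_adjacent_closer hn h
          have h1 := hξ.sub_le hn k i
          rcases hξ.adjacent hk with ⟨h2, h3⟩ | ⟨h2, h3⟩
          · exact .head h2 (ih k (by push_cast at hj; omega) (by omega))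
          · omega
    exact key (diagDist j i).toNat j (by omega)

theorem IsHeightFunction.eta_apply (hξ : Q.IsHeightFunction ξ) (hn : 4 ≤ n) (i j : Fin n) :
    Q.eta i j = if ξ j - ξ i = diagDist j i then 1 else 0 := by
  classical
  rw [DynkinQuiver.eta, Finset.sum_apply, Finset.sum_eq_single j]
  · rw [if_congr (hξ.reflTransGen_iff hn i j) rfl rfl]
    split_ifs <;> simp [simpleRoot]
  · intro k _ hk
    split_ifs <;> simp [simpleRoot, hk.symm]
  · simp

end DynkinQuiver

/-! ### Square waves and additive functions on the repetition quiver -/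

/-- The square wave with value `1` on `(0, 2n - 2]` and `wave n (y + (2n - 2)) = - wave n y`. -/
def wave (n : ℕ) (y : ℤ) : ℤ := if ((y - 1) / (2 * (n : ℤ) - 2)) % 2 = 0 then 1 else -1

theorem wave_add_mul (hn : 4 ≤ n) (y q : ℤ) :
    wave n (y + q * (2 * n - 2)) = if q % 2 = 0 then wave n y else -wave n y := by
  unfold wave
  rw [show y + q * (2 * (n : ℤ) - 2) - 1 = (y - 1) + q * (2 * n - 2) by ring,
    Int.add_mul_ediv_right _ _ (by omega)]
  split_ifs <;> first | rfl | omega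

theorem wave_eq_of_ediv {y q : ℤ} (h1 : q * (2 * n - 2) < y)
    (h2 : y ≤ (q + 1) * (2 * n - 2)) : wave n y = if q % 2 = 0 then 1 else -1 := by
  unfold wave
  have hpos : 0 < 2 * (n : ℤ) - 2 := by nlinarith
  rw [show (y - 1) / (2 * (n : ℤ) - 2) = q from ?_]
  refine Int.ediv_eq_iff_of_pos hpos |>.2 ?_
  constructor <;> linarith

/-- The values of the square wave around the origin, in a form suited to linear arithmetic. -/
theorem wave_spec (y : ℤ) :
    (0 < y → y ≤ 2 * n - 2 → wave n y = 1) ∧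
    (-(2 * n - 2) < y → y ≤ 0 → wave n y = -1) ∧
    (2 * n - 2 < y → y ≤ 2 * (2 * n - 2) → wave n y = -1) ∧
    (-2 * (2 * n - 2) < y → y ≤ -(2 * n - 2) → wave n y = 1) := by
  refine ⟨fun h1 h2 => ?_, fun h1 h2 => ?_, fun h1 h2 => ?_, fun h1 h2 => ?_⟩
  · simpa using wave_eq_of_ediv (n := n) (y := y) (q := 0) (by linarith) (by linarith)
  · simpa using wave_eq_of_ediv (n := n) (y := y) (q := -1) (by linarith) (by linarith)
  · simpa using wave_eq_of_ediv (n := n) (y := y) (q := 1) (by linarith) (by linarith)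
  · simpa using wave_eq_of_ediv (n := n) (y := y) (q := -2) (by linarith) (by linarith)

theorem wave_add (hn : 4 ≤ n) (y : ℤ) : wave n (y + (2 * n - 2)) = -wave n y := by
  simpa using wave_add_mul hn y 1

theorem wave_sub (hn : 4 ≤ n) (y : ℤ) : wave n (y - (2 * n - 2)) = -wave n y := by
  rw [← neg_eq_iff_eq_neg, ← wave_add hn]; congr 1; ring

/-- The function with period pattern `1, 1, -1, -1`. -/
def altSign (y : ℤ) : ℤ := if (y / 2) % 2 = 0 then 1 else -1

theorem altSign_sub_two (y : ℤ) : altSign (y - 2) = -altSign y := by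
  unfold altSign
  split_ifs <;> omega

theorem altSign_eq (y : ℤ) : altSign y = 1 ∨ altSign y = -1 := by
  unfold altSign; split_ifs <;> simp

/-- The coordinate at the vertex `j` of the vector `2ε` attached to the position `y`, where
positions are counted from the height of `j`. -/
def pulse (j : Fin n) (y : ℤ) : ℤ :=
  if IsTip j then wave n (y + row j) else wave n (y + row j) - wave n (y - row j)

theorem pulse_add_mul (hn : 4 ≤ n) (j : Fin n) (y q : ℤ) :
    pulse j (y + q * (2 * n - 2)) = if q % 2 = 0 then pulse j y else -pulse j y := by
  unfold pulse
  rw [show y + q * (2 * (n : ℤ) - 2) + row j = (y + row j) + q * (2 * n - 2) by ring,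
    show y + q * (2 * (n : ℤ) - 2) - row j = (y - row j) + q * (2 * n - 2) by ring,
    wave_add_mul hn, wave_add_mul hn]
  split_ifs <;> ring

/-- The coordinate at the vertex `j` of the vector `±2ε` that is negated by the Coxeter
transformation, with the sign that it has for the tip `i`. -/
def forkPart (i j : Fin n) (y : ℤ) : ℤ :=
  if IsTip j then if i = j then altSign y else -altSign y else 0

/-- Twice the coordinate at `j` of the root at a vertex of the repetition quiver in the row of
`i`, at horizontal distance `y` from the vertex of `j` on the height function. -/
def doubleCoord (i j : Fin n) (y : ℤ) : ℤ :=
  if IsTip i then pulse j (y + row i) + forkPart i j y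
  else pulse j (y + row i) - pulse j (y - row i)

theorem neighborSum_add (g h : Fin n → ℤ) (k : Fin n) :
    neighborSum (fun j => g j + h j) k = neighborSum g k + neighborSum h k := by
  unfold neighborSum
  rw [← Finset.sum_add_distrib]
  exact Finset.sum_congr rfl fun j _ => by split_ifs <;> simp

theorem neighborSum_sub (g h : Fin n → ℤ) (k : Fin n) :
    neighborSum (fun j => g j - h j) k = neighborSum g k - neighborSum h k := by
  unfold neighborSum
  rw [← Finset.sum_sub_distrib]
  exact Finset.sum_congr rfl fun j _ => by split_ifs <;> simp

/-- Pulses are additive on the meshes of the repetition quiver. -/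
theorem neighborSum_pulse (hn : 4 ≤ n) (k : Fin n) (y : ℤ) :
    neighborSum (fun j => pulse j (y - 1)) k = pulse k y + pulse k (y - 2) := by
  have hc : ((n - 3 : ℕ) : ℤ) = n - 3 := by omega
  have hc4 : ((n - 4 : ℕ) : ℤ) = n - 4 := by omega
  have ht2 : IsTip (⟨n - 2, by omega⟩ : Fin n) := by simp [IsTip]; omega
  have ht1 : IsTip (⟨n - 1, by omega⟩ : Fin n) := by simp [IsTip]; omega
  have ht3 : ¬ IsTip (⟨n - 3, by omega⟩ : Fin n) := by simp [IsTip]; omega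
  have ht4 : ¬ IsTip (⟨n - 4, by omega⟩ : Fin n) := by simp [IsTip]; omega
  rcases vertex_cases hn k with rfl | ⟨l, hl, rfl⟩ | rfl | hk
  · rw [neighborSum_zero hn]
    have h0 : ¬ IsTip (⟨0, by omega⟩ : Fin n) := by simp [IsTip]; omega
    have h1 : ¬ IsTip (⟨1, by omega⟩ : Fin n) := by simp [IsTip]; omega
    simp only [pulse, h0, h1, row, if_false]
    push_cast
    ring_nf
  · rw [neighborSum_middle hn _ l hl]
    have h0 : ¬ IsTip (⟨l, by omega⟩ : Fin n) := by simp [IsTip]; omega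
    have h1 : ¬ IsTip (⟨l + 1, by omega⟩ : Fin n) := by simp [IsTip]; omega
    have h2 : ¬ IsTip (⟨l + 2, by omega⟩ : Fin n) := by simp [IsTip]; omega
    simp only [pulse, h0, h1, h2, row, if_false]
    push_cast
    ring_nf
  · rw [neighborSum_fork hn]
    simp only [pulse, ht1, ht2, ht3, ht4, row, if_false, if_true, hc, hc4]
    have h1 := wave_sub hn (y - 1 + (n - 1))
    rw [show y - 1 + ((n : ℤ) - 1) - (2 * n - 2) = y - n by ring] at h1
    ring_nf at h1 ⊢
    linarith
  · rw [neighborSum_tip hn _ k hk]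
    simp only [pulse, hk, ht3, row, if_false, if_true, hc]
    have h1 := wave_sub hn (y + (n - 1))
    rw [show y + ((n : ℤ) - 1) - (2 * n - 2) = y + 1 - n by ring] at h1
    ring_nf at h1 ⊢
    linarith

theorem neighborSum_forkPart (hn : 4 ≤ n) {i : Fin n} (hi : IsTip i) (k : Fin n) (y : ℤ) :
    neighborSum (fun j => forkPart i j (y - 1)) k = forkPart i k y + forkPart i k (y - 2) := by
  have ht2 : IsTip (⟨n - 2, by omega⟩ : Fin n) := by simp [IsTip]; omega
  have ht1 : IsTip (⟨n - 1, by omega⟩ : Fin n) := by simp [IsTip]; omega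
  have ht3 : ¬ IsTip (⟨n - 3, by omega⟩ : Fin n) := by simp [IsTip]; omega
  have ht4 : ¬ IsTip (⟨n - 4, by omega⟩ : Fin n) := by simp [IsTip]; omega
  rcases vertex_cases hn k with rfl | ⟨l, hl, rfl⟩ | rfl | hk
  · rw [neighborSum_zero hn]
    have h0 : ¬ IsTip (⟨0, by omega⟩ : Fin n) := by simp [IsTip]; omega
    have h1 : ¬ IsTip (⟨1, by omega⟩ : Fin n) := by simp [IsTip]; omega
    simp [forkPart, h0, h1]
  · rw [neighborSum_middle hn _ l hl]
    have h0 : ¬ IsTip (⟨l, by omega⟩ : Fin n) := by simp [IsTip]; omega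
    have h1 : ¬ IsTip (⟨l + 1, by omega⟩ : Fin n) := by simp [IsTip]; omega
    have h2 : ¬ IsTip (⟨l + 2, by omega⟩ : Fin n) := by simp [IsTip]; omega
    simp [forkPart, h0, h1, h2]
  · rw [neighborSum_fork hn]
    simp only [forkPart, ht1, ht2, ht3, ht4, if_false, if_true]
    have h1 : n ≤ i.val + 2 := hi
    have h2 := i.2
    simp only [Fin.ext_iff]
    split_ifs <;> omega
  · rw [neighborSum_tip hn _ k hk]
    simp only [forkPart, ht3, hk, if_true, if_false, altSign_sub_two]
    split_ifs <;> ring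

theorem neighborSum_doubleCoord (hn : 4 ≤ n) (i k : Fin n) (y : ℤ) :
    neighborSum (fun j => doubleCoord i j (y - 1)) k =
      doubleCoord i k y + doubleCoord i k (y - 2) := by
  have h1 := neighborSum_pulse hn k (y + row i)
  have h2 := neighborSum_pulse hn k (y - row i)
  by_cases hi : IsTip i
  · have h3 := neighborSum_forkPart hn hi k y
    simp only [doubleCoord, hi, if_true]
    rw [neighborSum_add, h3, show y - 1 + row i = y + row i - 1 by ring, h1]
    ring_nf
  · simp only [doubleCoord, hi, if_false]
    rw [neighborSum_sub, show y - 1 + row i = y + row i - 1 by ring, h1,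
      show y - 1 - row i = y - row i - 1 by ring, h2]
    ring_nf

/-- Twice the root (up to the sign `(-1)^m`) at the vertex `(i, p)` of the repetition quiver. -/
def doubleRoot (ξ : Fin n → ℤ) (i : Fin n) (p : ℤ) : RootLattice n :=
  fun j => doubleCoord i j (p - ξ j)

/-- The vector `±2ε_k` at the position `x`; the roots in the long rows are halves of differences
of two of these. -/
def epsVec (ξ : Fin n → ℤ) (x : ℤ) : RootLattice n := fun j => pulse j (x - ξ j)

/-- The vector `±2ε_k` that is negated by the Coxeter transformation. -/
def forkVec (ξ : Fin n → ℤ) (i : Fin n) (p : ℤ) : RootLattice n := fun j => forkPart i j (p - ξ j)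

theorem doubleRoot_of_not_isTip (ξ : Fin n → ℤ) {i : Fin n} (hi : ¬ IsTip i) (p : ℤ) :
    doubleRoot ξ i p = epsVec ξ (p + row i) - epsVec ξ (p - row i) := by
  funext j
  simp only [doubleRoot, doubleCoord, hi, if_false, epsVec, Pi.sub_apply]
  ring_nf

theorem doubleRoot_of_isTip (ξ : Fin n → ℤ) {i : Fin n} (hi : IsTip i) (p : ℤ) :
    doubleRoot ξ i p = epsVec ξ (p + row i) + forkVec ξ i p := by
  funext j
  simp only [doubleRoot, doubleCoord, hi, if_true, epsVec, Pi.add_apply, forkVec]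
  ring_nf

theorem epsVec_add_mul (hn : 4 ≤ n) (ξ : Fin n → ℤ) (x q : ℤ) :
    epsVec ξ (x + q * (2 * n - 2)) = if q % 2 = 0 then epsVec ξ x else -epsVec ξ x := by
  funext j
  simp only [epsVec]
  rw [show x + q * (2 * (n : ℤ) - 2) - ξ j = x - ξ j + q * (2 * n - 2) by ring, pulse_add_mul hn]
  split_ifs <;> rfl

theorem epsVec_add (hn : 4 ≤ n) (ξ : Fin n → ℤ) (x : ℤ) :
    epsVec ξ (x + (2 * n - 2)) = -epsVec ξ x := by
  simpa using epsVec_add_mul hn ξ x 1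

theorem epsVec_sub (hn : 4 ≤ n) (ξ : Fin n → ℤ) (x : ℤ) :
    epsVec ξ (x - (2 * n - 2)) = -epsVec ξ x := by
  rw [← neg_eq_iff_eq_neg, ← epsVec_add hn]; congr 1; ring

namespace DynkinQuiver

variable {Q : DynkinQuiver n} {ξ : Fin n → ℤ} {τ : RootLattice n ≃ₗ[ℤ] RootLattice n}

/-- A family of functions of the distance to the height function that is additive on meshes is
translated by the Coxeter transformation. -/
theorem IsCoxeterElement.apply_of_additive (hτ : Q.IsCoxeterElement τ) (hξ : Q.IsHeightFunction ξ)
    (g : Fin n → ℤ → ℤ)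
    (hg : ∀ k y, neighborSum (fun j => g j (y - 1)) k = g k y + g k (y - 2)) (p : ℤ) :
    τ (fun j => g j (p - ξ j)) = fun j => g j (p - 2 - ξ j) := by
  classical
  apply hτ.eq_of_apply_add hξ
  intro k
  have h := hg k (p - ξ k)
  rw [show p - 2 - ξ k = p - ξ k - 2 by ring, add_comm, ← h, neighborSum,
    ← Finset.sum_add_distrib]
  refine Finset.sum_congr rfl fun j _ => ?_
  by_cases hkj : Adjacent k j
  · rw [if_pos hkj]
    rcases hξ.adjacent hkj with ⟨h1, h2⟩ | ⟨h1, h2⟩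
    · rw [if_neg (Q.asymm _ _ h1), if_pos h1, h2, zero_add]
      congr 1; ring
    · rw [if_pos h1, if_neg (Q.asymm _ _ h1), h2, add_zero]
      congr 1; ring
  · rw [if_neg hkj, if_neg fun h => hkj h.adjacent.symm, if_neg fun h => hkj h.adjacent, add_zero]

theorem IsCoxeterElement.apply_doubleRoot (hτ : Q.IsCoxeterElement τ) (hξ : Q.IsHeightFunction ξ)
    (hn : 4 ≤ n) (i : Fin n) (p : ℤ) : τ (doubleRoot ξ i p) = doubleRoot ξ i (p - 2) :=
  hτ.apply_of_additive hξ (doubleCoord i) (neighborSum_doubleCoord hn i) p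

theorem IsCoxeterElement.apply_epsVec (hτ : Q.IsCoxeterElement τ) (hξ : Q.IsHeightFunction ξ)
    (hn : 4 ≤ n) (x : ℤ) : τ (epsVec ξ x) = epsVec ξ (x - 2) :=
  hτ.apply_of_additive hξ pulse (neighborSum_pulse hn) x

theorem IsCoxeterElement.inv_apply_doubleRoot (hτ : Q.IsCoxeterElement τ)
    (hξ : Q.IsHeightFunction ξ) (hn : 4 ≤ n) (i : Fin n) (p : ℤ) :
    τ⁻¹ (doubleRoot ξ i p) = doubleRoot ξ i (p + 2) := by
  have h := hτ.apply_doubleRoot hξ hn i (p + 2)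
  rw [add_sub_cancel_right] at h
  rw [← h, ← LinearEquiv.mul_apply, inv_mul_cancel, LinearEquiv.coe_one, id]

theorem IsCoxeterElement.inv_apply_epsVec (hτ : Q.IsCoxeterElement τ)
    (hξ : Q.IsHeightFunction ξ) (hn : 4 ≤ n) (x : ℤ) :
    τ⁻¹ (epsVec ξ x) = epsVec ξ (x + 2) := by
  have h := hτ.apply_epsVec hξ hn (x + 2)
  rw [add_sub_cancel_right] at h
  rw [← h, ← LinearEquiv.mul_apply, inv_mul_cancel, LinearEquiv.coe_one, id]

end DynkinQuiver

/-! ### The vertices that carry the positive roots -/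

theorem row_of_isTip {i : Fin n} (h : IsTip i) : row i = n - 1 := if_pos h

theorem row_of_not_isTip {i : Fin n} (h : ¬ IsTip i) : row i = i.val + 1 := if_neg h

/-- The values of a pulse at a vertex of the long arm. -/
theorem pulse_spec {j : Fin n} (hj : ¬ IsTip j) (y : ℤ) :
    (-row j < y → y ≤ row j → pulse j y = 2) ∧
    (row j < y → y ≤ 2 * n - 2 - row j → pulse j y = 0) ∧
    (-(2 * n - 2) + row j < y → y ≤ -row j → pulse j y = 0) ∧
    (-(2 * n - 2) - row j < y → y ≤ -(2 * n - 2) + row j → pulse j y = -2) ∧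
    (2 * n - 2 - row j < y → y ≤ 2 * n - 2 + row j → pulse j y = -2) ∧
    (-2 * (2 * n - 2) + row j < y → y ≤ -(2 * n - 2) - row j → pulse j y = 0) := by
  have h1 := wave_spec (n := n) (y + row j)
  have h2 := wave_spec (n := n) (y - row j)
  have h3 := row_spec j
  have h4 : n > j.val + 2 := not_le.1 hj
  simp only [pulse, hj, if_false]
  omega

theorem pulse_of_isTip {j : Fin n} (hj : IsTip j) (y : ℤ) :
    pulse j y = wave n (y + (n - 1)) := by
  simp [pulse, hj, row]

/-- The other tip, for a tip; all other vertices are fixed. -/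
def tipSwap (i : Fin n) : Fin n :=
  if h : IsTip i then ⟨2 * n - 3 - i.val, by have := i.2; unfold IsTip at h; omega⟩ else i

/-- The involution of the diagram given by the longest element of the Weyl group. -/
def star (i : Fin n) : Fin n := if n % 2 = 0 then i else tipSwap i

theorem tipSwap_spec (i : Fin n) :
    (i.val + 2 < n ∧ (tipSwap i).val = i.val) ∨
      (n ≤ i.val + 2 ∧ (tipSwap i).val + i.val = 2 * n - 3) := by
  have := i.2
  unfold tipSwap
  by_cases h : IsTip i
  · have h' : n ≤ i.val + 2 := h
    rw [dif_pos h]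
    simp only
    omega
  · have h' : ¬ n ≤ i.val + 2 := h
    rw [dif_neg h]
    omega

theorem star_spec (i : Fin n) :
    (i.val + 2 < n ∧ (star i).val = i.val) ∨
      (n ≤ i.val + 2 ∧ n % 2 = 0 ∧ (star i).val = i.val) ∨
      (n ≤ i.val + 2 ∧ n % 2 = 1 ∧ (star i).val + i.val = 2 * n - 3) := by
  have := tipSwap_spec i
  unfold star
  split_ifs <;> omega

theorem star_star (i : Fin n) : star (star i) = i := by
  have h1 := star_spec i
  have h2 := star_spec (star i)
  have := i.2
  exact Fin.ext (by omega)

theorem star_of_not_isTip {i : Fin n} (h : ¬ IsTip i) : star i = i := by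
  have h1 := star_spec i
  have h' : ¬ n ≤ i.val + 2 := h
  exact Fin.ext (by omega)

theorem isTip_star {i : Fin n} : IsTip (star i) ↔ IsTip i := by
  have h1 := star_spec i
  unfold IsTip
  have := i.2
  omega

theorem row_star (i : Fin n) : row (star i) = row i := by
  by_cases h : IsTip i
  · rw [row_of_isTip h, row_of_isTip (isTip_star.2 h)]
  · rw [star_of_not_isTip h]

theorem altSign_add (y : ℤ) :
    altSign (y + (2 * n - 2)) = if n % 2 = 0 then -altSign y else altSign y := by
  unfold altSign
  split_ifs <;> omega

theorem forkPart_add (hn : 4 ≤ n) {i : Fin n} (hi : IsTip i) (j : Fin n) (y : ℤ) :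
    forkPart i j (y + (2 * n - 2)) = -forkPart (star i) j y := by
  have h1 := star_spec i
  have h2 : n ≤ i.val + 2 := hi
  have h3 := i.2
  have h4 := j.2
  unfold forkPart
  rw [altSign_add]
  simp only [Fin.ext_iff, IsTip]
  split_ifs <;> omega

/-- Shifting by the Coxeter number negates the roots, up to the involution `star`. -/
theorem doubleRoot_add (hn : 4 ≤ n) (ξ : Fin n → ℤ) (i : Fin n) (p : ℤ) :
    doubleRoot ξ i (p + (2 * n - 2)) = -doubleRoot ξ (star i) p := by
  by_cases hi : IsTip i
  · rw [doubleRoot_of_isTip ξ hi, doubleRoot_of_isTip ξ (isTip_star.2 hi), row_star,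
      add_right_comm, epsVec_add hn]
    funext j
    have := forkPart_add hn hi j (p - ξ j)
    simp only [Pi.add_apply, Pi.neg_apply, forkVec]
    rw [show p + (2 * (n : ℤ) - 2) - ξ j = p - ξ j + (2 * n - 2) by ring, this]
    ring
  · rw [star_of_not_isTip hi, doubleRoot_of_not_isTip ξ hi, doubleRoot_of_not_isTip ξ hi,
      add_right_comm, epsVec_add hn, add_sub_right_comm, epsVec_add hn]
    abel

theorem doubleRoot_sub (hn : 4 ≤ n) (ξ : Fin n → ℤ) (i : Fin n) (p : ℤ) :
    doubleRoot ξ i (p - (2 * n - 2)) = -doubleRoot ξ (star i) p := by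
  have h := doubleRoot_add hn ξ (star i) (p - (2 * n - 2))
  rw [sub_add_cancel, star_star] at h
  rw [h, neg_neg]

/-- The vertex `(i, p)` of the repetition quiver lies between the height function and its
translate by the inverse Nakayama permutation; these vertices turn out to be those of the
Auslander-Reiten quiver. -/
structure InBand (ξ : Fin n → ℤ) (i : Fin n) (p : ℤ) : Prop where
  lower : ξ (star i) - (2 * n - 2) < p
  upper : p ≤ ξ i
  parity : (p - ξ i) % 2 = 0

namespace DynkinQuiver

variable {Q : DynkinQuiver n} {ξ : Fin n → ℤ} {τ : RootLattice n ≃ₗ[ℤ] RootLattice n}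

theorem IsHeightFunction.sub_star (hξ : Q.IsHeightFunction ξ) (hn : 4 ≤ n) (i : Fin n) :
    ξ i - ξ (star i) ≤ 2 ∧ ξ (star i) - ξ i ≤ 2 ∧ (ξ i - ξ (star i)) % 2 = 0 := by
  have h1 := hξ.sub_le hn i (star i)
  have h2 := star_spec i
  have h3 := diagDist_spec i (star i)
  have := i.2
  omega

theorem _root_.TypeD.diagDist_of_not_isTip {i : Fin n} (hi : ¬ IsTip i) (j : Fin n) :
    diagDist i j = |row i - row j| := if_neg fun h => hi h.1

theorem IsHeightFunction.sub_le_of_not_isTip (hξ : Q.IsHeightFunction ξ) (hn : 4 ≤ n)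
    {i j : Fin n} (hi : ¬ IsTip i) (hj : ¬ IsTip j) :
    ((row i ≤ row j ∧ ξ i - ξ j ≤ row j - row i ∧ ξ j - ξ i ≤ row j - row i) ∨
      (row j ≤ row i ∧ ξ i - ξ j ≤ row i - row j ∧ ξ j - ξ i ≤ row i - row j)) ∧
    1 ≤ row i ∧ 1 ≤ row j ∧ row i ≤ n - 2 ∧ row j ≤ n - 2 := by
  have h1 := hξ.sub_le hn i j
  rw [diagDist_of_not_isTip hi] at h1
  have h2 := row_of_not_isTip hi
  have h3 := row_of_not_isTip hj
  have h4 : ¬ n ≤ i.val + 2 := hi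
  have h5 : ¬ n ≤ j.val + 2 := hj
  rcases le_total (row i) (row j) with h | h
  · rw [abs_of_nonpos (by omega)] at h1
    omega
  · rw [abs_of_nonneg (by omega)] at h1
    omega

theorem IsHeightFunction.sub_le_of_isTip (hξ : Q.IsHeightFunction ξ) (hn : 4 ≤ n)
    {i j : Fin n} (hi : IsTip i) (hj : ¬ IsTip j) :
    diagDist i j = n - 1 - row j ∧ ξ i - ξ j ≤ n - 1 - row j ∧ ξ j - ξ i ≤ n - 1 - row j ∧
      1 ≤ row j ∧ row j ≤ n - 2 := by
  have h1 := hξ.sub_le hn i j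
  have h2 := row_of_not_isTip hj
  have h4 : ¬ n ≤ j.val + 2 := hj
  rw [diagDist_comm, diagDist_of_not_isTip hj, row_of_isTip hi, abs_of_nonpos (by omega)] at *
  omega

theorem IsHeightFunction.sub_tips (hξ : Q.IsHeightFunction ξ) (hn : 4 ≤ n)
    {i j : Fin n} (hi : IsTip i) (hj : IsTip j) :
    (i = j ∧ ξ i - ξ j = 0 ∧ diagDist i j = 0) ∨
      (i ≠ j ∧ diagDist i j = 2 ∧ (ξ i - ξ j = 0 ∨ ξ i - ξ j = 2 ∨ ξ i - ξ j = -2)) := by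
  by_cases h : i = j
  · subst h; simp [diagDist_self]
  · have h1 := hξ.sub_le hn i j
    have h2 : diagDist i j = 2 := if_pos ⟨hi, hj, h⟩
    refine Or.inr ⟨h, h2, ?_⟩
    omega

/-- The roots `η_i` sit on the height function. -/
theorem IsHeightFunction.doubleRoot_self (hξ : Q.IsHeightFunction ξ) (hn : 4 ≤ n) (i : Fin n) :
    doubleRoot ξ i (ξ i) = 2 • Q.eta i := by
  funext j
  rw [Pi.smul_apply, two_nsmul, hξ.eta_apply hn, doubleRoot, doubleCoord, diagDist_comm j i]
  by_cases hi : IsTip i <;> by_cases hj : IsTip j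
  · simp only [hi, hj, if_true, pulse_of_isTip, forkPart, row_of_isTip hi]
    obtain ⟨a1, -, a3, -⟩ := wave_spec (n := n) (ξ i - ξ j + (n - 1) + (n - 1))
    rcases hξ.sub_tips hn hi hj with ⟨h, h1, h2⟩ | ⟨h, h2, h1 | h1 | h1⟩
    · rw [a1 (by omega) (by omega), h1, h2]; simp [h, altSign]
    · rw [a1 (by omega) (by omega), h1, h2]; simp [h, altSign]; omega
    · rw [a3 (by omega) (by omega), h1, h2]; simp [h, altSign]; omega
    · rw [a1 (by omega) (by omega), h1, h2]; simp [h, altSign]; omega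
  · simp only [hi, hj, if_true, if_false, forkPart, row_of_isTip hi]
    obtain ⟨h2, h3, h4, h5, h6⟩ := hξ.sub_le_of_isTip hn hi hj
    obtain ⟨a1, a2, -, -, -⟩ := pulse_spec hj (ξ i - ξ j + (n - 1))
    rw [h2]
    split_ifs with h
    · rw [a1 (by omega) (by omega)]; norm_num
    · rw [a2 (by omega) (by omega)]
  · simp only [hi, if_false, pulse_of_isTip hj]
    obtain ⟨h2, h3, h4, h5, h6⟩ := hξ.sub_le_of_isTip hn hj hi
    obtain ⟨a1, -, -, -⟩ := wave_spec (n := n) (ξ i - ξ j + row i + (n - 1))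
    obtain ⟨b1, b2, -, -⟩ := wave_spec (n := n) (ξ i - ξ j - row i + (n - 1))
    rw [diagDist_comm, h2, a1 (by omega) (by omega)]
    split_ifs with h
    · rw [b2 (by omega) (by omega)]; norm_num
    · rw [b1 (by omega) (by omega)]; norm_num
  · simp only [hi, if_false]
    have h7 := hξ.sub_le_of_not_isTip hn hi hj
    rw [diagDist_of_not_isTip hi]
    obtain ⟨a1, a2, -, -, -⟩ := pulse_spec hj (ξ i - ξ j + row i)
    obtain ⟨b1, -, b3, -, -⟩ := pulse_spec hj (ξ i - ξ j - row i)
    rcases le_or_gt (row i) (row j) with h | h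
    · rw [abs_of_nonpos (by omega), a1 (by omega) (by omega)]
      split_ifs with h'
      · rw [b3 (by omega) (by omega)]; norm_num
      · rw [b1 (by omega) (by omega)]; norm_num
    · rw [abs_of_pos (by omega), b3 (by omega) (by omega)]
      split_ifs with h'
      · rw [a1 (by omega) (by omega)]; norm_num
      · rw [a2 (by omega) (by omega)]; norm_num

/-- Twice the roots on the band are nonnegative. -/
theorem IsHeightFunction.doubleRoot_nonneg (hξ : Q.IsHeightFunction ξ) (hn : 4 ≤ n) {i : Fin n}
    {p : ℤ} (h : InBand ξ i p) (j : Fin n) : 0 ≤ doubleRoot ξ i p j := by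
  obtain ⟨hl, hu, hp⟩ := h
  rw [doubleRoot, doubleCoord]
  by_cases hi : IsTip i <;> by_cases hj : IsTip j
  · simp only [hi, hj, if_true, pulse_of_isTip, forkPart, row_of_isTip hi]
    have hs := star_spec i
    have h1 : n ≤ i.val + 2 := hi
    have h2 : n ≤ j.val + 2 := hj
    have h3 := hξ.sub_tips hn hi hj
    have h4 := hξ.sub_tips hn (isTip_star.2 hi) hj
    have h5 := altSign_eq (p - ξ j)
    obtain ⟨a1, a2, a3, -⟩ := wave_spec (n := n) (p - ξ j + (n - 1) + (n - 1))
    have hjn := j.2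
    have hin := i.2
    -- The two summands only have opposite signs inside the window of length `2n - 2`.
    by_cases c1 : -(2 * n - 2) < p - ξ j ∧ p - ξ j ≤ 0
    · rw [a1 (by omega) (by omega)]
      split_ifs <;> omega
    · have c2 : p - ξ j = 2 ∨ p - ξ j = -(2 * n - 2) := by
        omega
      rcases c2 with c2 | c2
      · have h6 : i ≠ j := by rintro rfl; omega
        rw [a3 (by omega) (by omega), if_neg h6, c2]
        simp [altSign]
      · rw [a2 (by omega) (by omega), c2]
        have h7 : star i ≠ j := by rintro rfl; omega
        simp only [Fin.ext_iff, Ne, altSign] at h7 ⊢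
        split_ifs <;> omega
  · simp only [hi, hj, if_true, if_false, forkPart, row_of_isTip hi]
    obtain ⟨h2, h3, h4, h5, h6⟩ := hξ.sub_le_of_isTip hn hi hj
    obtain ⟨-, h3', h4', -, -⟩ := hξ.sub_le_of_isTip hn (isTip_star.2 hi) hj
    obtain ⟨a1, a2, a3, -, -⟩ := pulse_spec hj (p - ξ j + (n - 1))
    by_cases c1 : row j < p - ξ j + (n - 1)
    · rw [a2 c1 (by omega)]; norm_num
    · by_cases c2 : -row j < p - ξ j + (n - 1)
      · rw [a1 c2 (by omega)]; norm_num
      · rw [a3 (by omega) (by omega)]; norm_num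
  · rw [star_of_not_isTip hi] at hl
    simp only [hi, if_false, pulse_of_isTip hj]
    obtain ⟨h2, h3, h4, h5, h6⟩ := hξ.sub_le_of_isTip hn hj hi
    obtain ⟨a1, a2, -, -⟩ := wave_spec (n := n) (p - ξ j + row i + (n - 1))
    obtain ⟨b1, b2, -, b4⟩ := wave_spec (n := n) (p - ξ j - row i + (n - 1))
    by_cases c1 : 0 < p - ξ j + row i + (n - 1)
    · rw [a1 c1 (by omega)]
      by_cases c2 : 0 < p - ξ j - row i + (n - 1)
      · rw [b1 c2 (by omega)]; norm_num
      · rw [b2 (by omega) (by omega)]; norm_num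
    · rw [a2 (by omega) (by omega), b2 (by omega) (by omega)]; norm_num
  · rw [star_of_not_isTip hi] at hl
    simp only [hi, if_false]
    have h7 := hξ.sub_le_of_not_isTip hn hi hj
    obtain ⟨a1, a2, a3, a4, -⟩ := pulse_spec hj (p - ξ j + row i)
    obtain ⟨b1, -, b3, b4, -, b6⟩ := pulse_spec hj (p - ξ j - row i)
    by_cases c1 : -row j < p - ξ j + row i ∧ p - ξ j + row i ≤ row j
    · rw [a1 c1.1 c1.2]
      by_cases c2 : -row j < p - ξ j - row i
      · rw [b1 c2 (by omega)]; norm_num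
      · by_cases c3 : -(2 * n - 2) + row j < p - ξ j - row i
        · rw [b3 c3 (by omega)]; norm_num
        · rw [b4 (by omega) (by omega)]; norm_num
    · by_cases c2 : row j < p - ξ j + row i
      · rw [a2 c2 (by omega)]
        by_cases c3 : -(2 * n - 2) + row j < p - ξ j - row i
        · rw [b3 c3 (by omega)]; norm_num
        · rw [b4 (by omega) (by omega)]; norm_num
      · by_cases c3 : -(2 * n - 2) + row j < p - ξ j - row i
        · rw [a3 (by omega) (by omega), b3 c3 (by omega)]; norm_num
        · by_cases c4 : -(2 * n - 2) + row j < p - ξ j + row i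
          · rw [a3 c4 (by omega)]
            by_cases c5 : -(2 * n - 2) - row j < p - ξ j - row i
            · rw [b4 c5 (by omega)]; norm_num
            · rw [b6 (by omega) (by omega)]; norm_num
          · rw [a4 (by omega) (by omega), b4 (by omega) (by omega)]; norm_num

theorem IsHeightFunction.inBand_self (hξ : Q.IsHeightFunction ξ) (hn : 4 ≤ n) (i : Fin n) :
    InBand ξ i (ξ i) := by
  have := hξ.sub_star hn i
  exact ⟨by omega, le_rfl, by simp⟩

/-- One step to the left in a row stays in the band or enters its negative translate. -/
theorem IsHeightFunction.inBand_sub_two (hξ : Q.IsHeightFunction ξ) (hn : 4 ≤ n) {i : Fin n}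
    {p : ℤ} (h : InBand ξ i p) :
    InBand ξ i (p - 2) ∨ InBand ξ (star i) (p - 2 + (2 * n - 2)) := by
  obtain ⟨hl, hu, hp⟩ := h
  have := hξ.sub_star hn i
  by_cases h2 : ξ (star i) - (2 * n - 2) < p - 2
  · exact Or.inl ⟨h2, by omega, by omega⟩
  · refine Or.inr ⟨?_, by omega, by omega⟩
    rw [star_star]
    omega

/-- One step to the right in a row stays in the band or enters its negative translate. -/
theorem IsHeightFunction.inBand_add_two (hξ : Q.IsHeightFunction ξ) (hn : 4 ≤ n) {i : Fin n}
    {p : ℤ} (h : InBand ξ i p) :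
    InBand ξ i (p + 2) ∨ InBand ξ (star i) (p + 2 - (2 * n - 2)) := by
  obtain ⟨hl, hu, hp⟩ := h
  have := hξ.sub_star hn i
  by_cases h2 : p + 2 ≤ ξ i
  · exact Or.inl ⟨by omega, by omega, by omega⟩
  · refine Or.inr ⟨?_, by omega, by omega⟩
    rw [star_star]
    omega

end DynkinQuiver

/-! ### The roots in orthonormal coordinates -/

/-- The vector `2ε_k` in the usual model `±ε_i ± ε_j` of the roots of type `D_n`. -/
def twoEps (k : Fin n) : RootLattice n := fun j =>
  if k.val + 1 = n then (if j.val + 2 = n then -1 else if j.val + 1 = n then 1 else 0)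
  else if j.val < k.val then 0 else if IsTip j then 1 else 2

/-- The vectors `±2ε_k`. -/
def IsSignedEps (s : RootLattice n) : Prop := ∃ k, s = twoEps k ∨ s = -twoEps k

theorem IsSignedEps.neg {s : RootLattice n} (h : IsSignedEps s) : IsSignedEps (-s) := by
  obtain ⟨k, rfl | rfl⟩ := h
  · exact ⟨k, Or.inr rfl⟩
  · exact ⟨k, Or.inl (neg_neg _)⟩

theorem two_smul_simpleRoot (k l : Fin n) (h : k.val + 1 = l.val) :
    (2 : ℤ) • simpleRoot k = twoEps k - twoEps l := by
  funext j
  have := l.2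
  have := j.2
  simp only [simpleRoot, Pi.smul_apply, Pi.single_apply, Pi.sub_apply, twoEps, smul_eq_mul,
    Fin.ext_iff, IsTip]
  split_ifs <;> omega

theorem two_smul_simpleRoot_last (k l : Fin n) (hk : k.val + 2 = n) (hl : l.val + 1 = n) :
    (2 : ℤ) • simpleRoot l = twoEps k + twoEps l := by
  funext j
  have := j.2
  simp only [simpleRoot, Pi.smul_apply, Pi.single_apply, Pi.add_apply, twoEps, smul_eq_mul,
    Fin.ext_iff, IsTip]
  split_ifs <;> omega

theorem simpleCoroot_twoEps (hn : 4 ≤ n) (k m : Fin n) :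
    simpleCoroot k (twoEps m) =
      if k.val + 1 = n then (if n ≤ m.val + 2 then 2 else 0)
      else if m = k then 2 else if m.val = k.val + 1 then -2 else 0 := by
  rw [simpleCoroot_apply]
  have hm := m.2
  rcases vertex_cases hn k with rfl | ⟨l, hl, rfl⟩ | rfl | hk
  · rw [neighborSum_zero hn]
    simp only [twoEps, IsTip, Fin.ext_iff]
    split_ifs <;> omega
  · rw [neighborSum_middle hn _ l hl]
    simp only [twoEps, IsTip, Fin.ext_iff]
    split_ifs <;> omega
  · rw [neighborSum_fork hn]
    simp only [twoEps, IsTip, Fin.ext_iff]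
    split_ifs <;> omega
  · rw [neighborSum_tip hn _ k hk]
    have hk' : n ≤ k.val + 2 := hk
    have hk2 := k.2
    simp only [twoEps, IsTip, Fin.ext_iff]
    split_ifs <;> omega

/-- The simple reflections other than the last one interchange neighbouring `ε`s. -/
theorem simpleReflection_twoEps_swap (hn : 4 ≤ n) (k l m : Fin n) (h : k.val + 1 = l.val) :
    simpleReflection k (twoEps m) = twoEps (Equiv.swap k l m) := by
  have hl := l.2
  have h2 := two_smul_simpleRoot k l h
  rw [simpleReflection_apply, simpleCoroot_twoEps hn, if_neg (by omega)]
  by_cases h3 : m = k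
  · rw [if_pos h3, h2, h3, Equiv.swap_apply_left]; abel
  · rw [if_neg h3]
    by_cases h4 : m = l
    · rw [if_pos (by rw [h4, h]), h4, Equiv.swap_apply_right, neg_smul, h2]; abel
    · rw [if_neg fun h5 => h4 (Fin.ext (by omega)), Equiv.swap_apply_of_ne_of_ne h3 h4]; simp

/-- The last simple reflection interchanges the last two `ε`s and changes their signs. -/
theorem simpleReflection_twoEps_last (hn : 4 ≤ n) (k l m : Fin n) (hk : k.val + 2 = n)
    (hl : l.val + 1 = n) :
    simpleReflection l (twoEps m) =
      if n ≤ m.val + 2 then -twoEps (Equiv.swap k l m) else twoEps m := by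
  have h2 := two_smul_simpleRoot_last k l hk hl
  rw [simpleReflection_apply, simpleCoroot_twoEps hn, if_pos hl]
  by_cases h3 : n ≤ m.val + 2
  · rw [if_pos h3, if_pos h3, h2]
    have hm := m.2
    have h4 : m = k ∨ m = l := by simp only [Fin.ext_iff]; omega
    rcases h4 with rfl | rfl
    · rw [Equiv.swap_apply_left]; abel
    · rw [Equiv.swap_apply_right]; abel
  · rw [if_neg h3, if_neg h3]; simp

theorem IsSignedEps.simpleReflection (hn : 4 ≤ n) (k : Fin n) {s : RootLattice n}
    (h : IsSignedEps s) : IsSignedEps (simpleReflection k s) := by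
  have key : ∀ m, IsSignedEps (TypeD.simpleReflection k (twoEps m)) := by
    intro m
    by_cases hk : k.val + 1 = n
    · rw [simpleReflection_twoEps_last hn ⟨n - 2, by omega⟩ k m (by simp; omega) hk]
      split_ifs
      · exact ⟨_, Or.inr rfl⟩
      · exact ⟨_, Or.inl rfl⟩
    · have := k.2
      rw [simpleReflection_twoEps_swap hn k ⟨k.val + 1, by omega⟩ m rfl]
      exact ⟨_, Or.inl rfl⟩
  obtain ⟨m, rfl | rfl⟩ := h
  · exact key m
  · rw [map_neg]
    exact (key m).neg

theorem IsSignedEps.weylGroup (hn : 4 ≤ n) {w : RootLattice n ≃ₗ[ℤ] RootLattice n}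
    (hw : w ∈ weylGroup n) {s : RootLattice n} (h : IsSignedEps s) : IsSignedEps (w s) := by
  induction hw using Subgroup.closure_induction'' generalizing s with
  | mem x hx =>
    obtain ⟨k, rfl⟩ := hx
    exact h.simpleReflection hn k
  | inv_mem x hx =>
    obtain ⟨k, rfl⟩ := hx
    have : (TypeD.simpleReflection k)⁻¹ = TypeD.simpleReflection k := Module.reflection_inv _
    rw [this]
    exact h.simpleReflection hn k
  | one => exact h
  | mul x y _ _ hx hy => exact hx (hy h)

theorem isRoot_simpleRoot (k : Fin n) : IsRoot (simpleRoot k) := ⟨1, Subgroup.one_mem _, k, rfl⟩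

theorem IsRoot.map {w : RootLattice n ≃ₗ[ℤ] RootLattice n} (hw : w ∈ weylGroup n)
    {v : RootLattice n} (h : IsRoot v) : IsRoot (w v) := by
  obtain ⟨u, hu, i, rfl⟩ := h
  exact ⟨w * u, mul_mem hw hu, i, rfl⟩

theorem simpleReflection_mem (k : Fin n) : simpleReflection k ∈ weylGroup n :=
  Subgroup.subset_closure ⟨k, rfl⟩

theorem IsRoot.neg {v : RootLattice n} (h : IsRoot v) : IsRoot (-v) := by
  obtain ⟨u, hu, i, rfl⟩ := h
  refine ⟨u * simpleReflection i, mul_mem hu (simpleReflection_mem i), i, ?_⟩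
  rw [LinearEquiv.mul_apply, simpleReflection, Module.reflection_apply_self, map_neg]

theorem IsRoot.ne_zero {v : RootLattice n} (h : IsRoot v) : v ≠ 0 := by
  obtain ⟨u, hu, i, rfl⟩ := h
  rw [Ne, LinearEquiv.map_eq_zero_iff]
  intro h
  have := congrFun h i
  simp [simpleRoot] at this

/-- Twice a root is the sum of two independent vectors `±2ε`. -/
theorem IsRoot.exists_add (hn : 4 ≤ n) {v : RootLattice n} (h : IsRoot v) :
    ∃ s t, IsSignedEps s ∧ IsSignedEps t ∧ s ≠ t ∧ s ≠ -t ∧ (2 : ℤ) • v = s + t := by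
  obtain ⟨w, hw, k, rfl⟩ := h
  have key : ∃ s t : RootLattice n, IsSignedEps s ∧ IsSignedEps t ∧ s ≠ t ∧ s ≠ -t ∧
      (2 : ℤ) • simpleRoot k = s + t := by
    by_cases hk : k.val + 1 = n
    · refine ⟨twoEps ⟨n - 2, by omega⟩, twoEps k, ⟨_, Or.inl rfl⟩, ⟨_, Or.inl rfl⟩, ?_, ?_,
        two_smul_simpleRoot_last _ _ (by simp; omega) hk⟩
      · intro h
        have := congrFun h ⟨n - 2, by omega⟩
        simp only [twoEps, IsTip] at this
        split_ifs at this <;> omega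
      · intro h
        have := congrFun h ⟨n - 1, by omega⟩
        simp only [twoEps, IsTip, Pi.neg_apply] at this
        split_ifs at this <;> omega
    · have := k.2
      refine ⟨twoEps k, -twoEps ⟨k.val + 1, by omega⟩, ⟨_, Or.inl rfl⟩, ⟨_, Or.inr rfl⟩, ?_, ?_,
        (two_smul_simpleRoot k ⟨k.val + 1, by omega⟩ rfl).trans (sub_eq_add_neg _ _)⟩
      · intro h
        have := congrFun h ⟨n - 1, by omega⟩
        simp only [twoEps, IsTip, Pi.neg_apply] at this
        split_ifs at this <;> omega
      · intro h
        have := congrFun h k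
        simp only [twoEps, IsTip, neg_neg] at this
        split_ifs at this <;> omega
  obtain ⟨s, t, hs, ht, h1, h2, h3⟩ := key
  refine ⟨w s, w t, hs.weylGroup hn hw, ht.weylGroup hn hw, w.injective.ne h1, ?_, ?_⟩
  · rw [← map_neg]
    exact w.injective.ne h2
  · rw [← map_add, ← h3, map_smul]

theorem exists_isRoot_sub (hn : 4 ≤ n) (d : ℕ) (i j : Fin n) (h : i.val + d + 1 = j.val) :
    ∃ v, IsRoot v ∧ (2 : ℤ) • v = twoEps i - twoEps j := by
  induction d generalizing j with
  | zero => exact ⟨_, isRoot_simpleRoot i, two_smul_simpleRoot i j h⟩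
  | succ d ih =>
    have := j.2
    obtain ⟨v, hv, h2⟩ := ih ⟨i.val + d + 1, by omega⟩ rfl
    refine ⟨_, hv.map (simpleReflection_mem ⟨i.val + d + 1, by omega⟩), ?_⟩
    rw [← map_smul, h2, map_sub, simpleReflection_twoEps_swap hn _ j _ (by simp; omega),
      simpleReflection_twoEps_swap hn _ j _ (by simp; omega), Equiv.swap_apply_left,
      Equiv.swap_apply_of_ne_of_ne]
    · simp only [Ne, Fin.ext_iff]; omega
    · simp only [Ne, Fin.ext_iff]; omega

theorem exists_isRoot_add_last (hn : 4 ≤ n) (i j : Fin n) (hj : j.val + 1 = n)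
    (hi : i.val + 1 < n) : ∃ v, IsRoot v ∧ (2 : ℤ) • v = twoEps i + twoEps j := by
  by_cases h : i.val + 2 = n
  · exact ⟨_, isRoot_simpleRoot j, two_smul_simpleRoot_last i j h hj⟩
  · obtain ⟨v, hv, h2⟩ := exists_isRoot_sub hn (n - 3 - i.val) i ⟨n - 2, by omega⟩
      (by simp; omega)
    refine ⟨_, hv.map (simpleReflection_mem j), ?_⟩
    rw [← map_smul, h2, map_sub, simpleReflection_twoEps_last hn ⟨n - 2, by omega⟩ j _
      (by simp; omega) hj, simpleReflection_twoEps_last hn ⟨n - 2, by omega⟩ j _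
      (by simp; omega) hj, if_neg (by omega), if_pos (by simp; omega), Equiv.swap_apply_left,
      sub_neg_eq_add]

theorem exists_isRoot_add (hn : 4 ≤ n) (d : ℕ) (i j : Fin n) (hd : j.val + d + 1 = n)
    (hij : i < j) : ∃ v, IsRoot v ∧ (2 : ℤ) • v = twoEps i + twoEps j := by
  induction d generalizing j with
  | zero => exact exists_isRoot_add_last hn i j hd (by have := Fin.lt_def.1 hij; omega)
  | succ d ih =>
    have hij' := Fin.lt_def.1 hij
    obtain ⟨v, hv, h2⟩ := ih ⟨j.val + 1, by omega⟩ (by simp; omega)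
      (Fin.lt_def.2 (by simp; omega))
    refine ⟨_, hv.map (simpleReflection_mem j), ?_⟩
    rw [← map_smul, h2, map_add, simpleReflection_twoEps_swap hn j ⟨j.val + 1, by omega⟩ _ rfl,
      simpleReflection_twoEps_swap hn j ⟨j.val + 1, by omega⟩ _ rfl, Equiv.swap_apply_right,
      Equiv.swap_apply_of_ne_of_ne]
    · simp only [Ne, Fin.ext_iff]; omega
    · simp only [Ne, Fin.ext_iff]; omega

theorem two_smul_injective {v w : RootLattice n} (h : (2 : ℤ) • v = (2 : ℤ) • w) : v = w := by
  funext j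
  have := congrFun h j
  simp only [Pi.smul_apply, smul_eq_mul] at this
  omega

/-- The converse of `IsRoot.exists_add`. -/
theorem isRoot_of_add (hn : 4 ≤ n) {v s t : RootLattice n} (hs : IsSignedEps s)
    (ht : IsSignedEps t) (h1 : s ≠ t) (h2 : s ≠ -t) (h : (2 : ℤ) • v = s + t) : IsRoot v := by
  -- Up to the sign and the order of the summands there are two cases.
  have key : ∀ i j : Fin n, i < j → ∀ v : RootLattice n,
      ((2 : ℤ) • v = twoEps i - twoEps j ∨ (2 : ℤ) • v = twoEps i + twoEps j) → IsRoot v := by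
    intro i j hij v hv
    have hij' := Fin.lt_def.1 hij
    have hj := j.2
    rcases hv with hv | hv
    · obtain ⟨w, hw, h⟩ := exists_isRoot_sub hn (j.val - i.val - 1) i j (by omega)
      rwa [two_smul_injective (hv.trans h.symm)]
    · obtain ⟨w, hw, h⟩ := exists_isRoot_add hn (n - 1 - j.val) i j (by omega) hij
      rwa [two_smul_injective (hv.trans h.symm)]
  have key2 : ∀ i j : Fin n, i ≠ j → ∀ v : RootLattice n,
      ((2 : ℤ) • v = twoEps i - twoEps j ∨ (2 : ℤ) • v = twoEps i + twoEps j) → IsRoot v := by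
    intro i j hij v hv
    rcases lt_or_gt_of_ne hij with h | h
    · exact key i j h v hv
    · rcases hv with hv | hv
      · rw [← neg_neg v]
        apply IsRoot.neg
        apply key j i h _ (Or.inl _)
        rw [smul_neg, hv, neg_sub]
      · exact key j i h v (Or.inr (hv.trans (add_comm _ _)))
  obtain ⟨i, rfl | rfl⟩ := hs <;> obtain ⟨j, rfl | rfl⟩ := ht
  · exact key2 i j (by rintro rfl; exact h1 rfl) v (Or.inr h)
  · exact key2 i j (by rintro rfl; exact h2 (neg_neg _).symm) v
      (Or.inl (h.trans (sub_eq_add_neg _ _).symm))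
  · exact key2 j i (by rintro rfl; exact h2 rfl) v (Or.inl (by rw [h]; abel))
  · rw [← neg_neg v]
    apply IsRoot.neg
    refine key2 i j (by rintro rfl; exact h1 rfl) _ (Or.inr ?_)
    rw [smul_neg, h]; abel

/-! ### Positive roots as vertices of the band -/

/-- The positions `x` at which `epsVec ξ x` is defined by vertices of the repetition quiver. -/
def IsPosition (ξ : Fin n → ℤ) (x : ℤ) : Prop := ∀ j, (x - ξ j - row j) % 2 = 0

theorem forkPart_tip_cases {i j : Fin n} (hj : IsTip j) (y : ℤ) :
    forkPart i j y = 1 ∨ forkPart i j y = -1 := by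
  have := altSign_eq y
  simp only [forkPart, hj, if_true]
  split_ifs <;> omega

theorem isSignedEps_forkVec (hn : 4 ≤ n) (ξ : Fin n → ℤ) (i : Fin n) (p : ℤ) :
    IsSignedEps (forkVec ξ i p) := by
  have ht2 : IsTip (⟨n - 2, by omega⟩ : Fin n) := by simp [IsTip]; omega
  have ht1 : IsTip (⟨n - 1, by omega⟩ : Fin n) := by simp [IsTip]; omega
  have key : ∀ s : RootLattice n, (∀ j, ¬ IsTip j → s j = 0) →
      (s ⟨n - 2, by omega⟩ = 1 ∨ s ⟨n - 2, by omega⟩ = -1) →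
      (s ⟨n - 1, by omega⟩ = 1 ∨ s ⟨n - 1, by omega⟩ = -1) → IsSignedEps s := by
    intro s h0 h2 h1
    have ext : ∀ t : RootLattice n, (∀ j, ¬ IsTip j → t j = 0) →
        s ⟨n - 2, by omega⟩ = t ⟨n - 2, by omega⟩ → s ⟨n - 1, by omega⟩ = t ⟨n - 1, by omega⟩ →
        s = t := by
      intro t t0 t2 t1
      funext j
      by_cases hj : IsTip j
      · have h3 : n ≤ j.val + 2 := hj
        have h4 := j.2
        have h5 : j = ⟨n - 2, by omega⟩ ∨ j = ⟨n - 1, by omega⟩ := by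
          simp only [Fin.ext_iff]; omega
        rcases h5 with h5 | h5
        · rw [h5, t2]
        · rw [h5, t1]
      · rw [h0 j hj, t0 j hj]
    have z2 : ∀ j : Fin n, ¬ IsTip j → twoEps ⟨n - 2, by omega⟩ j = 0 := by
      intro j hj
      have hj' : ¬ n ≤ j.val + 2 := hj
      simp only [twoEps]
      split_ifs <;> omega
    have z1 : ∀ j : Fin n, ¬ IsTip j → twoEps ⟨n - 1, by omega⟩ j = 0 := by
      intro j hj
      have hj' : ¬ n ≤ j.val + 2 := hj
      simp only [twoEps]
      split_ifs <;> omega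
    have e22 : twoEps (⟨n - 2, by omega⟩ : Fin n) ⟨n - 2, by omega⟩ = 1 := by
      simp only [twoEps, IsTip]; split_ifs <;> omega
    have e21 : twoEps (⟨n - 2, by omega⟩ : Fin n) ⟨n - 1, by omega⟩ = 1 := by
      simp only [twoEps, IsTip]; split_ifs <;> omega
    have e12 : twoEps (⟨n - 1, by omega⟩ : Fin n) ⟨n - 2, by omega⟩ = -1 := by
      simp only [twoEps, IsTip]; split_ifs <;> omega
    have e11 : twoEps (⟨n - 1, by omega⟩ : Fin n) ⟨n - 1, by omega⟩ = 1 := by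
      simp only [twoEps, IsTip]; split_ifs <;> omega
    rcases h2 with h2 | h2 <;> rcases h1 with h1 | h1
    · exact ⟨⟨n - 2, by omega⟩, Or.inl (ext _ z2 (by omega) (by omega))⟩
    · exact ⟨⟨n - 1, by omega⟩, Or.inr (ext _ (fun j hj => by simp [z1 j hj])
        (by rw [Pi.neg_apply]; omega) (by rw [Pi.neg_apply]; omega))⟩
    · exact ⟨⟨n - 1, by omega⟩, Or.inl (ext _ z1 (by omega) (by omega))⟩
    · exact ⟨⟨n - 2, by omega⟩, Or.inr (ext _ (fun j hj => by simp [z2 j hj])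
        (by rw [Pi.neg_apply]; omega) (by rw [Pi.neg_apply]; omega))⟩
  apply key
  · intro j hj
    simp [forkVec, forkPart, hj]
  · exact forkPart_tip_cases ht2 _
  · exact forkPart_tip_cases ht1 _

namespace DynkinQuiver

variable {Q : DynkinQuiver n} {ξ : Fin n → ℤ} {τ : RootLattice n ≃ₗ[ℤ] RootLattice n}

theorem IsHeightFunction.isPosition (hξ : Q.IsHeightFunction ξ) (hn : 4 ≤ n) {x : ℤ} (i : Fin n)
    (h : (x - ξ i - row i) % 2 = 0) : IsPosition ξ x := by
  intro j
  have := hξ.sub_row_mod_two hn i j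
  omega

/-- On the long arm, the vertices closer to the far end than `k` do not see the two positions
`ξ k + row k` and `ξ k - row k + 2` that `k` adds to those of its predecessor. -/
theorem IsHeightFunction.epsVec_eq_zero (hξ : Q.IsHeightFunction ξ) (hn : 4 ≤ n) {l k j : Fin n}
    (hlk : Adjacent l k) (hl : row l = row k - 1) (hj : ¬ IsTip j) (hjk : row j < row k) :
    ∃ x, IsPosition ξ x ∧ ((x = ξ k + row k ∧ ξ k = ξ l + 1) ∨
      (x = ξ k - row k + 2 ∧ ξ k = ξ l - 1)) ∧ epsVec ξ x j = 0 := by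
  have h2 : ¬ IsTip l := by
    intro h
    have := row_le k
    rw [row_of_isTip h] at hl
    omega
  have h3 := hξ.sub_le_of_not_isTip hn h2 hj
  have h5 := row_le k
  obtain ⟨-, a2, a3, -⟩ := pulse_spec hj (ξ k + row k - ξ j)
  obtain ⟨-, b2, b3, -⟩ := pulse_spec hj (ξ k - row k + 2 - ξ j)
  rcases hξ.adjacent hlk with ⟨-, h4⟩ | ⟨-, h4⟩
  · exact ⟨ξ k - row k + 2, hξ.isPosition hn k (by omega), Or.inr ⟨rfl, h4⟩,
      b3 (by omega) (by omega)⟩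
  · exact ⟨ξ k + row k, hξ.isPosition hn k (by omega), Or.inl ⟨rfl, h4⟩,
      a2 (by omega) (by omega)⟩

theorem IsHeightFunction.twoEps_arm (hξ : Q.IsHeightFunction ξ) (hn : 4 ≤ n) {k : Fin n}
    (hk : ¬ IsTip k) : ∃ x, IsPosition ξ x ∧ twoEps k = epsVec ξ x := by
  have hk' : ¬ n ≤ k.val + 2 := hk
  have hrk := row_of_not_isTip hk
  have upper : ∀ x, (x = ξ k + row k ∨ x = ξ k - row k + 2) → ∀ j : Fin n, k.val ≤ j.val →
      twoEps k j = epsVec ξ x j := by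
    intro x hx j hkj
    by_cases hj : IsTip j
    · obtain ⟨h2, h3, h4, h5, h6⟩ := hξ.sub_le_of_isTip hn hj hk
      obtain ⟨a1, -⟩ := wave_spec (n := n) (x - ξ j + (n - 1))
      rw [epsVec, pulse_of_isTip hj, a1 (by omega) (by omega)]
      simp only [twoEps, hj, if_true]
      rw [if_neg (by omega), if_neg (by omega)]
    · have h3 := hξ.sub_le_of_not_isTip hn hk hj
      have hrj := row_of_not_isTip hj
      obtain ⟨a1, -⟩ := pulse_spec hj (x - ξ j)
      rw [epsVec, a1 (by omega) (by omega)]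
      simp only [twoEps, hj, if_false]
      rw [if_neg (by omega), if_neg (by omega)]
  by_cases h0 : k.val = 0
  · refine ⟨ξ k + row k, hξ.isPosition hn k (by omega), ?_⟩
    funext j
    exact upper _ (Or.inl rfl) j (by omega)
  · have hadj : Adjacent ⟨k.val - 1, by omega⟩ k := by
      rw [adjacent_iff_val hn]
      simp only
      omega
    have hl : row (⟨k.val - 1, by omega⟩ : Fin n) = row k - 1 := by
      rw [hrk, row_of_not_isTip (by simp only [IsTip]; omega)]
      simp only
      omega
    have hex : ∃ x, IsPosition ξ x ∧ ((x = ξ k + row k ∧ ξ k = ξ ⟨k.val - 1, by omega⟩ + 1) ∨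
        (x = ξ k - row k + 2 ∧ ξ k = ξ ⟨k.val - 1, by omega⟩ - 1)) := by
      obtain ⟨x, h1, h2, -⟩ := hξ.epsVec_eq_zero hn hadj hl
        (j := ⟨k.val - 1, by omega⟩) (by simp only [IsTip]; omega) (by omega)
      exact ⟨x, h1, h2⟩
    obtain ⟨x, hx, hxk⟩ := hex
    refine ⟨x, hx, ?_⟩
    funext j
    by_cases hkj : k.val ≤ j.val
    · exact upper x (by omega) j hkj
    · have hj : ¬ IsTip j := by simp only [IsTip]; omega
      obtain ⟨y, -, hy, h0⟩ := hξ.epsVec_eq_zero hn hadj hl hj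
        (by rw [hrk, row_of_not_isTip hj]; omega)
      have : y = x := by omega
      rw [← this, h0]
      simp only [twoEps]
      rw [if_neg (by omega), if_pos (by omega)]

/-- If the two tips have equal heights, the Coxeter transformation negates `ε_n`, and otherwise
`ε_{n-1}`; the other one of them sits at some position. -/
theorem IsHeightFunction.twoEps_tip (hξ : Q.IsHeightFunction ξ) (hn : 4 ≤ n) {k : Fin n}
    (hk : IsTip k) (h : (k.val + 2 = n ∧ ξ (tipSwap k) = ξ k) ∨
      (k.val + 1 = n ∧ ξ (tipSwap k) ≠ ξ k)) :
    ∃ x, IsPosition ξ x ∧ twoEps k = epsVec ξ x := by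
  have hk' : n ≤ k.val + 2 := hk
  have hrk := row_of_isTip hk
  have h3 : ¬ IsTip (⟨n - 3, by omega⟩ : Fin n) := by simp only [IsTip]; omega
  have hadj : Adjacent ⟨n - 3, by omega⟩ k := by
    rw [adjacent_iff_val hn]
    simp only
    omega
  have hl : row (⟨n - 3, by omega⟩ : Fin n) = row k - 1 := by
    rw [hrk, row_of_not_isTip h3]
    simp only
    omega
  obtain ⟨x, hx, hxk, -⟩ := hξ.epsVec_eq_zero hn hadj hl h3 (by omega)
  refine ⟨x, hx, ?_⟩
  funext j
  by_cases hj : IsTip j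
  · have hsw : tipSwap k = j ∨ k = j := by
      have h4 := tipSwap_spec k
      have h5 : n ≤ j.val + 2 := hj
      have := j.2
      simp only [Fin.ext_iff]
      omega
    have h7 := hξ.sub_tips hn hk hj
    have hadj' : Adjacent ⟨n - 3, by omega⟩ j := by
      have h5 : n ≤ j.val + 2 := hj
      have := j.2
      rw [adjacent_iff_val hn]
      simp only
      omega
    have h9 := hξ.adjacent hadj'
    obtain ⟨a1, a2, a3, -⟩ := wave_spec (n := n) (x - ξ j + (n - 1))
    rw [epsVec, pulse_of_isTip hj]
    rcases hsw with rfl | rfl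
    · rcases h with ⟨h, h6⟩ | ⟨h, h6⟩
      · rw [a1 (by omega) (by omega)]
        simp only [twoEps, hj, if_true]
        have h4 := tipSwap_spec k
        rw [if_neg (by omega), if_neg (by omega)]
      · have h4 := tipSwap_spec k
        simp only [twoEps, h, if_true]
        rw [if_pos (by omega)]
        rcases hxk with hxk | hxk
        · rw [a3 (by omega) (by omega)]
        · rw [a2 (by omega) (by omega)]
    · rw [a1 (by omega) (by omega)]
      simp only [twoEps, hk, if_true]
      split_ifs <;> omega
  · obtain ⟨y, -, hy, h0⟩ := hξ.epsVec_eq_zero hn hadj hl hj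
      (by
        have : ¬ n ≤ j.val + 2 := hj
        rw [hrk, row_of_not_isTip hj]; omega)
    have : y = x := by omega
    rw [← this, h0]
    have h5 : ¬ n ≤ j.val + 2 := hj
    simp only [twoEps]
    split_ifs <;> omega

theorem IsHeightFunction.twoEps_fork (hξ : Q.IsHeightFunction ξ) (hn : 4 ≤ n) {k : Fin n}
    (hk : IsTip k) (h : (k.val + 2 = n ∧ ξ (tipSwap k) ≠ ξ k) ∨
      (k.val + 1 = n ∧ ξ (tipSwap k) = ξ k)) (p : ℤ) (hp : (p - ξ k) % 2 = 0) :
    ∃ i, IsTip i ∧ twoEps k = forkVec ξ i p := by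
  have hk' : n ≤ k.val + 2 := hk
  have h4 := tipSwap_spec k
  have hk2 : IsTip (tipSwap k) := by simp only [IsTip]; omega
  have h7 := hξ.sub_tips hn hk hk2
  have hne : k ≠ tipSwap k := by simp only [Ne, Fin.ext_iff]; omega
  have hne' : tipSwap k ≠ k := hne.symm
  have hsign : (ξ (tipSwap k) = ξ k ∧ altSign (p - ξ (tipSwap k)) = altSign (p - ξ k)) ∨
      (ξ (tipSwap k) ≠ ξ k ∧ altSign (p - ξ (tipSwap k)) = -altSign (p - ξ k)) := by
    by_cases he : ξ (tipSwap k) = ξ k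
    · exact Or.inl ⟨he, by rw [he]⟩
    · refine Or.inr ⟨he, ?_⟩
      unfold altSign
      split_ifs <;> omega
  have ext : ∀ s t : RootLattice n, (∀ j, ¬ IsTip j → s j = t j) → s k = t k →
      s (tipSwap k) = t (tipSwap k) → s = t := by
    intro s t h0 h1 h2
    funext j
    by_cases hj : IsTip j
    · have h5 : n ≤ j.val + 2 := hj
      have := j.2
      have h6 : j = k ∨ j = tipSwap k := by simp only [Fin.ext_iff]; omega
      rcases h6 with rfl | rfl
      · exact h1
      · exact h2
    · exact h0 j hj
  have z : ∀ i j, ¬ IsTip j → twoEps k j = forkVec ξ i p j := by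
    intro i j hj
    have h5 : ¬ n ≤ j.val + 2 := hj
    simp only [twoEps, forkVec, forkPart, hj, if_false]
    split_ifs <;> omega
  have v1 : twoEps k k = 1 := by
    simp only [twoEps, hk, if_true]
    split_ifs <;> omega
  have v2 : (k.val + 2 = n ∧ twoEps k (tipSwap k) = 1) ∨
      (k.val + 1 = n ∧ twoEps k (tipSwap k) = -1) := by
    simp only [twoEps, hk2, if_true]
    split_ifs <;> omega
  rcases altSign_eq (p - ξ k) with hs | hs
  · refine ⟨k, hk, ext _ _ (z k) ?_ ?_⟩
    · simp [forkVec, forkPart, hk, hs, v1]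
    · simp only [forkVec, forkPart, hk2, if_true, hne, if_false]
      omega
  · refine ⟨tipSwap k, hk2, ext _ _ (z _) ?_ ?_⟩
    · simp [forkVec, forkPart, hk, hs, v1, hne']
    · simp only [forkVec, forkPart, hk2, if_true]
      omega

/-- A vector `±2ε_k` either has a position, or is the vector negated by the Coxeter
transformation, up to a sign that is accounted for by the choice of a tip. -/
theorem IsHeightFunction.signedEps_cases (hξ : Q.IsHeightFunction ξ) (hn : 4 ≤ n)
    {s : RootLattice n} (hs : IsSignedEps s) :
    (∃ x, IsPosition ξ x ∧ s = epsVec ξ x) ∨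
      ∀ p, (∃ i, IsTip i ∧ (p - ξ i) % 2 = 0) → ∃ i, IsTip i ∧ s = forkVec ξ i p := by
  have hswap : ∀ i : Fin n, IsTip i → IsTip (tipSwap i) ∧
      ∀ p, forkVec ξ (tipSwap i) p = -forkVec ξ i p := by
    intro i hi
    have hi' : n ≤ i.val + 2 := hi
    have h4 := tipSwap_spec i
    refine ⟨by simp only [IsTip]; omega, fun p => ?_⟩
    funext j
    have := j.2
    simp only [forkVec, forkPart, Pi.neg_apply, IsTip, Fin.ext_iff]
    split_ifs <;> omega
  have key : ∀ k, (∃ x, IsPosition ξ x ∧ twoEps k = epsVec ξ x) ∨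
      ∀ p, (∃ i, IsTip i ∧ (p - ξ i) % 2 = 0) → ∃ i, IsTip i ∧ twoEps k = forkVec ξ i p := by
    intro k
    by_cases hk : IsTip k
    · have hk' : n ≤ k.val + 2 := hk
      have := k.2
      by_cases h : (k.val + 2 = n ∧ ξ (tipSwap k) = ξ k) ∨ (k.val + 1 = n ∧ ξ (tipSwap k) ≠ ξ k)
      · exact Or.inl (hξ.twoEps_tip hn hk h)
      · refine Or.inr fun p ⟨i, hi, hp⟩ => hξ.twoEps_fork hn hk (by omega) p ?_
        have := hξ.sub_tips hn hi hk
        omega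
    · exact Or.inl (hξ.twoEps_arm hn hk)
  obtain ⟨k, rfl | rfl⟩ := hs
  · exact key k
  · rcases key k with ⟨x, hx, h⟩ | h
    · refine Or.inl ⟨x + (2 * n - 2), fun j => ?_, ?_⟩
      · have := hx j
        omega
      · rw [epsVec_add hn, h]
    · refine Or.inr fun p hp => ?_
      obtain ⟨i, hi, h'⟩ := h p hp
      exact ⟨tipSwap i, (hswap i hi).1, by rw [(hswap i hi).2, h']⟩

/-- Every vertex of the repetition quiver is, up to the sign of its root, a vertex of the band. -/
theorem IsHeightFunction.exists_inBand (hξ : Q.IsHeightFunction ξ) (hn : 4 ≤ n) (i : Fin n)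
    {p : ℤ} (hp : (p - ξ i) % 2 = 0) :
    ∃ i' p', InBand ξ i' p' ∧
      (doubleRoot ξ i p = doubleRoot ξ i' p' ∨ doubleRoot ξ i p = -doubleRoot ξ i' p') := by
  -- This form of the claim can be carried one step to the left or to the right in a row.
  have key : ∀ t : ℤ, ∃ i' p', InBand ξ i' p' ∧
      ((∀ c, doubleRoot ξ i (ξ i + 2 * t + c) = doubleRoot ξ i' (p' + c)) ∨
        ∀ c, doubleRoot ξ i (ξ i + 2 * t + c) = -doubleRoot ξ i' (p' + c)) := by
    intro t
    induction t using Int.induction_on with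
    | zero => exact ⟨i, ξ i, hξ.inBand_self hn i, Or.inl fun c => by simp⟩
    | succ t ih =>
      obtain ⟨i', p', hb, h⟩ := ih
      rcases hξ.inBand_add_two hn hb with hb' | hb'
      · refine ⟨i', p' + 2, hb', ?_⟩
        rcases h with h | h
        · refine Or.inl fun c => ?_
          rw [show p' + 2 + c = p' + (2 + c) by ring, ← h]; ring_nf
        · refine Or.inr fun c => ?_
          rw [show p' + 2 + c = p' + (2 + c) by ring, ← h]; ring_nf
      · refine ⟨star i', p' + 2 - (2 * n - 2), hb', ?_⟩
        have h' : ∀ c, doubleRoot ξ (star i') (p' + 2 - (2 * n - 2) + c) =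
            -doubleRoot ξ i' (p' + (2 + c)) := by
          intro c
          have := doubleRoot_sub hn ξ (star i') (p' + (2 + c))
          rw [star_star] at this
          rw [← this]; ring_nf
        rcases h with h | h
        · refine Or.inr fun c => ?_
          rw [h', neg_neg, ← h]; ring_nf
        · refine Or.inl fun c => ?_
          rw [h', ← h]; ring_nf
    | pred t ih =>
      obtain ⟨i', p', hb, h⟩ := ih
      rcases hξ.inBand_sub_two hn hb with hb' | hb'
      · refine ⟨i', p' - 2, hb', ?_⟩
        rcases h with h | h
        · refine Or.inl fun c => ?_
          rw [show p' - 2 + c = p' + (c - 2) by ring, ← h]; ring_nf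
        · refine Or.inr fun c => ?_
          rw [show p' - 2 + c = p' + (c - 2) by ring, ← h]; ring_nf
      · refine ⟨star i', p' - 2 + (2 * n - 2), hb', ?_⟩
        have h' : ∀ c, doubleRoot ξ (star i') (p' - 2 + (2 * n - 2) + c) =
            -doubleRoot ξ i' (p' + (c - 2)) := by
          intro c
          have := doubleRoot_add hn ξ (star i') (p' + (c - 2))
          rw [star_star] at this
          rw [← this]; ring_nf
        rcases h with h | h
        · refine Or.inr fun c => ?_
          rw [h', neg_neg, ← h]; ring_nf
        · refine Or.inl fun c => ?_
          rw [h', ← h]; ring_nf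
  obtain ⟨i', p', hb, h⟩ := key ((p - ξ i) / 2)
  refine ⟨i', p', hb, ?_⟩
  have e : ξ i + 2 * ((p - ξ i) / 2) + 0 = p := by omega
  rcases h with h | h
  · refine Or.inl ?_
    have := h 0
    rwa [e, add_zero] at this
  · refine Or.inr ?_
    have := h 0
    rwa [e, add_zero] at this

theorem IsHeightFunction.exists_doubleRoot_eq_add (hξ : Q.IsHeightFunction ξ) (hn : 4 ≤ n)
    {s t : RootLattice n} (hs : IsSignedEps s) (ht : IsSignedEps t) (h1 : s ≠ t) (h2 : s ≠ -t) :
    ∃ i p, (p - ξ i) % 2 = 0 ∧ s + t = doubleRoot ξ i p := by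
  have hMpos : (0 : ℤ) < 2 * n - 2 := by omega
  have hnt : ∀ r : ℤ, 0 < r → r < 2 * n - 2 → r % 2 = 0 →
      ∃ i : Fin n, ¬ IsTip i ∧ 2 * row i = r := by
    intro r h1 h2 h3
    have h4 : ¬ IsTip (⟨(r / 2 - 1).toNat, by omega⟩ : Fin n) := by
      simp only [IsTip]; omega
    refine ⟨_, h4, ?_⟩
    rw [row_of_not_isTip h4]
    simp only
    omega
  have mixed : ∀ s t : RootLattice n, IsSignedEps t → (∃ x, IsPosition ξ x ∧ s = epsVec ξ x) →
      (∀ p, (∃ i, IsTip i ∧ (p - ξ i) % 2 = 0) → ∃ i, IsTip i ∧ t = forkVec ξ i p) →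
      ∃ i p, (p - ξ i) % 2 = 0 ∧ s + t = doubleRoot ξ i p := by
    rintro s t - ⟨x, hx, rfl⟩ h
    have ht1 : IsTip (⟨n - 1, by omega⟩ : Fin n) := by simp [IsTip]; omega
    obtain ⟨i, hi, rfl⟩ := h (x - (n - 1)) ⟨_, ht1, by
      have := hx ⟨n - 1, by omega⟩
      rw [row_of_isTip ht1] at this
      omega⟩
    refine ⟨i, x - (n - 1), ?_, ?_⟩
    · have := hx i
      rw [row_of_isTip hi] at this
      omega
    · rw [doubleRoot_of_isTip ξ hi, row_of_isTip hi, sub_add_cancel]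
  rcases hξ.signedEps_cases hn hs with hs' | hs' <;> rcases hξ.signedEps_cases hn ht with ht' | ht'
  · obtain ⟨x, hx, rfl⟩ := hs'
    obtain ⟨y, hy, rfl⟩ := ht'
    -- Write `t = - epsVec ξ z` and reduce the difference `x - z` modulo `2n - 2`.
    set z := y + (2 * n - 2) with hz
    have ht2 : epsVec ξ y = -epsVec ξ z := by rw [hz, epsVec_add hn, neg_neg]
    set r := (x - z) % (2 * n - 2) with hr
    set q := (x - z) / (2 * n - 2) with hq
    have hxr : x = z + r + q * (2 * n - 2) := by
      have := Int.mul_ediv_add_emod (x - z) (2 * n - 2)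
      rw [← hr, ← hq] at this
      linarith
    have hr0 : 0 ≤ r := Int.emod_nonneg _ hMpos.ne'
    have hr1 : r < 2 * n - 2 := Int.emod_lt_of_pos _ hMpos
    have hx' := epsVec_add_mul hn ξ (z + r) q
    rw [← hxr] at hx'
    have hrne : r ≠ 0 := by
      intro h
      rw [h, add_zero] at hx'
      split_ifs at hx' with hq2
      · exact h2 (by rw [hx', ht2, neg_neg])
      · exact h1 (by rw [hx', ht2])
    have hr2 : r % 2 = 0 := by
      have e1 := hx ⟨0, by omega⟩
      have e2 := hy ⟨0, by omega⟩
      have : (x - z) % 2 = 0 := by omega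
      have e3 : r = (x - z) - 2 * (q * (n - 1)) := by rw [hxr]; ring
      omega
    split_ifs at hx' with hq2
    · obtain ⟨i, hi, hri⟩ := hnt r (by omega) hr1 hr2
      refine ⟨i, z + row i, ?_, ?_⟩
      · have := hy i
        omega
      · rw [doubleRoot_of_not_isTip ξ hi, hx', ht2, add_sub_cancel_right,
          show z + row i + row i = z + r by linarith, sub_eq_add_neg]
    · obtain ⟨i, hi, hri⟩ := hnt (2 * n - 2 - r) (by omega) (by omega) (by omega)
      refine ⟨i, z + r + row i, ?_, ?_⟩
      · have := hy i
        omega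
      · rw [doubleRoot_of_not_isTip ξ hi, hx', ht2, add_sub_cancel_right,
          show z + r + row i + row i = z + (2 * n - 2) by linarith, epsVec_add hn ξ z]
        abel
  · exact mixed s t ht hs' ht'
  · obtain ⟨i, p, h⟩ := mixed t s hs ht' hs'
    exact ⟨i, p, by rwa [add_comm s t]⟩
  · exfalso
    have ht1 : IsTip (⟨n - 1, by omega⟩ : Fin n) := by simp [IsTip]; omega
    obtain ⟨i, hi, h3⟩ := hs' (ξ ⟨n - 1, by omega⟩) ⟨_, ht1, by simp⟩
    obtain ⟨j, hj, h4⟩ := ht' (ξ ⟨n - 1, by omega⟩) ⟨_, ht1, by simp⟩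
    by_cases hij : i = j
    · exact h1 (by rw [h3, h4, hij])
    · apply h2
      rw [h3, h4]
      funext k
      have hi' : n ≤ i.val + 2 := hi
      have hj' : n ≤ j.val + 2 := hj
      have := i.2
      have := j.2
      have := k.2
      have hij' : i.val ≠ j.val := fun e => hij (Fin.ext e)
      simp only [forkVec, forkPart, Pi.neg_apply, IsTip, Fin.ext_iff]
      split_ifs <;> omega

/-- Every positive root occurs on the band. -/
theorem IsHeightFunction.exists_doubleRoot (hξ : Q.IsHeightFunction ξ) (hn : 4 ≤ n)
    {v : RootLattice n} (hv : IsPosRoot v) :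
    ∃ i p, InBand ξ i p ∧ (2 : ℤ) • v = doubleRoot ξ i p := by
  obtain ⟨s, t, hs, ht, h1, h2, h3⟩ := hv.1.exists_add hn
  obtain ⟨i, p, hp, h4⟩ := hξ.exists_doubleRoot_eq_add hn hs ht h1 h2
  obtain ⟨i', p', hb, h5 | h5⟩ := hξ.exists_inBand hn i hp
  · exact ⟨i', p', hb, by rw [h3, h4, h5]⟩
  · exfalso
    apply hv.1.ne_zero
    funext j
    have h6 := hv.2 j
    have h7 := hξ.doubleRoot_nonneg hn hb j
    have h8 := congrFun (h3.trans (h4.trans h5)) j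
    simp only [Pi.smul_apply, Pi.neg_apply, smul_eq_mul, Pi.zero_apply] at *
    omega

theorem IsCoxeterElement.isSignedEps_epsVec (hτ : Q.IsCoxeterElement τ)
    (hξ : Q.IsHeightFunction ξ) (hn : 4 ≤ n) {x : ℤ} (hx : IsPosition ξ x) :
    IsSignedEps (epsVec ξ x) := by
  obtain ⟨y, hy, h⟩ := hξ.twoEps_arm hn (k := ⟨0, by omega⟩) (by simp only [IsTip]; omega)
  have key : ∀ t : ℤ, IsSignedEps (epsVec ξ (y + 2 * t)) := by
    intro t
    induction t using Int.induction_on with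
    | zero => exact ⟨⟨0, by omega⟩, Or.inl (by rw [h]; simp)⟩
    | succ t ih =>
      rw [show y + 2 * ((t : ℤ) + 1) = y + 2 * t + 2 by ring, ← hτ.inv_apply_epsVec hξ hn]
      exact ih.weylGroup hn (inv_mem hτ.mem_weylGroup)
    | pred t ih =>
      rw [show y + 2 * (-(t : ℤ) - 1) = y + 2 * -t - 2 by ring, ← hτ.apply_epsVec hξ hn]
      exact ih.weylGroup hn hτ.mem_weylGroup
  have h1 := hx ⟨0, by omega⟩
  have h2 := hy ⟨0, by omega⟩
  rw [show x = y + 2 * ((x - y) / 2) by omega]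
  exact key _

end DynkinQuiver

theorem pulse_even {j : Fin n} (hj : ¬ IsTip j) (y : ℤ) : pulse j y % 2 = 0 := by
  simp only [pulse, hj, if_false, wave]
  split_ifs <;> omega

/-- The row in which a vertex of the repetition quiver is found after `m` negations. -/
def starPow (m : ℤ) (i : Fin n) : Fin n := if m % 2 = 0 then i else star i

theorem starPow_add_one (m : ℤ) (i : Fin n) : starPow (m + 1) i = star (starPow m i) := by
  unfold starPow
  split_ifs <;> first | omega | simp [star_star]

theorem starPow_sub_one (m : ℤ) (i : Fin n) : starPow (m - 1) i = star (starPow m i) := by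
  unfold starPow
  split_ifs <;> first | omega | simp [star_star]

namespace DynkinQuiver

variable {Q : DynkinQuiver n} {ξ : Fin n → ℤ} {τ : RootLattice n ≃ₗ[ℤ] RootLattice n}

theorem IsHeightFunction.not_isPosRoot_neg (hξ : Q.IsHeightFunction ξ) (hn : 4 ≤ n) {i : Fin n}
    {p : ℤ} (hb : InBand ξ i p) {v : RootLattice n} (hv : (2 : ℤ) • v = doubleRoot ξ i p) :
    ¬ IsPosRoot (-v) := by
  intro h
  apply h.1.ne_zero
  funext j
  have h1 := h.2 j
  have h2 := hξ.doubleRoot_nonneg hn hb j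
  have h3 := congrFun hv j
  simp only [Pi.smul_apply, Pi.neg_apply, smul_eq_mul, Pi.zero_apply] at *
  omega

theorem IsCoxeterElement.isRoot_eta (hτ : Q.IsCoxeterElement τ) (hξ : Q.IsHeightFunction ξ)
    (hn : 4 ≤ n) (i : Fin n) : IsRoot (Q.eta i) := by
  have h := hξ.doubleRoot_self hn i
  have hi1 : Q.eta i i = 1 := by rw [hξ.eta_apply hn]; simp [diagDist_self]
  have h2 : (2 : ℤ) • Q.eta i = doubleRoot ξ i (ξ i) := by
    rw [h]; funext j; simp
  have hpos : ∀ c, c = ξ i + row i ∨ c = ξ i - row i → IsPosition ξ c := by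
    intro c hc
    apply hξ.isPosition hn i
    omega
  have hs := hτ.isSignedEps_epsVec hξ hn (hpos _ (Or.inl rfl))
  by_cases hi : IsTip i
  · rw [doubleRoot_of_isTip ξ hi] at h2
    have hi' : n ≤ i.val + 2 := hi
    have h4 := tipSwap_spec i
    have hj : IsTip (tipSwap i) := by simp only [IsTip]; omega
    have hij : i ≠ tipSwap i := by simp only [Ne, Fin.ext_iff]; omega
    have h3 : ¬ IsTip (⟨n - 3, by omega⟩ : Fin n) := by simp only [IsTip]; omega
    have r3 := row_of_not_isTip h3
    simp only at r3
    have hadj : ∀ j : Fin n, IsTip j → Adjacent ⟨n - 3, by omega⟩ j := by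
      intro j hj
      have h5 : n ≤ j.val + 2 := hj
      have := j.2
      rw [adjacent_iff_val hn]
      simp only
      omega
    have hne : epsVec ξ (ξ i + row i) ≠ forkVec ξ i (ξ i) := by
      intro he
      -- If `i` is a sink, the vectors differ at the branch vertex, else at the other tip.
      rcases hξ.adjacent (hadj i hi) with ⟨-, hl⟩ | ⟨-, hu⟩
      · have e1 := congrFun he ⟨n - 3, by omega⟩
        obtain ⟨a1, -⟩ := pulse_spec h3 (ξ i + row i - ξ ⟨n - 3, by omega⟩)
        rw [epsVec, a1 (by rw [row_of_isTip hi]; omega) (by rw [row_of_isTip hi]; omega)] at e1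
        simp [forkVec, forkPart, h3] at e1
      · have e1 := congrFun he (tipSwap i)
        obtain ⟨a1, -, a3, -⟩ := wave_spec (n := n) (ξ i + row i - ξ (tipSwap i) + (n - 1))
        have h6 := hξ.adjacent (hadj _ hj)
        rw [row_of_isTip hi] at a1 a3
        rw [epsVec, pulse_of_isTip hj, row_of_isTip hi] at e1
        simp only [forkVec, forkPart, hj, hij, if_true, if_false] at e1
        have h7 : ξ i - ξ (tipSwap i) = 0 ∨ ξ i - ξ (tipSwap i) = 2 := by omega
        rcases h7 with h7 | h7
        · rw [a1 (by omega) (by omega), h7] at e1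
          simp [altSign] at e1
        · rw [a3 (by omega) (by omega), h7] at e1
          simp [altSign] at e1
    have hne' : epsVec ξ (ξ i + row i) ≠ -forkVec ξ i (ξ i) := by
      intro he
      rw [he] at h2
      have := congrFun h2 i
      simp [hi1] at this
    exact isRoot_of_add hn hs (isSignedEps_forkVec hn ξ i (ξ i)) hne hne' h2
  · rw [doubleRoot_of_not_isTip ξ hi, sub_eq_add_neg] at h2
    have ht := hτ.isSignedEps_epsVec hξ hn (hpos _ (Or.inr rfl))
    refine isRoot_of_add hn hs ht.neg ?_ ?_ h2
    · intro he
      rw [← he] at h2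
      have h3 := congrFun h2 i
      have h4 := pulse_even hi (ξ i + row i - ξ i)
      simp only [Pi.smul_apply, Pi.add_apply, hi1, epsVec, smul_eq_mul] at h3
      omega
    · intro he
      rw [he] at h2
      have := congrFun h2 i
      simp [hi1] at this

/-- The coordinates of the bijection between the repetition quiver and `Φ⁺ × ℤ`, in terms of
the band. -/
theorem Coord.inBand (hξ : Q.IsHeightFunction ξ) (hτ : Q.IsCoxeterElement τ) (hn : 4 ≤ n)
    {i : Fin n} {p : ℤ} {β : RootLattice n} {m : ℤ} (h : Q.Coord ξ τ i p β m) :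
    InBand ξ (starPow m i) (p - m * (2 * n - 2)) ∧
      (2 : ℤ) • β = doubleRoot ξ (starPow m i) (p - m * (2 * n - 2)) := by
  induction h with
  | base =>
    simp only [starPow, zero_mul, sub_zero, Int.zero_emod, if_true]
    refine ⟨hξ.inBand_self hn i, ?_⟩
    rw [hξ.doubleRoot_self hn]; funext j; simp
  | @down_pos p β m h hp ih =>
    obtain ⟨hb, h2⟩ := ih
    have h3 : (2 : ℤ) • τ β = doubleRoot ξ (starPow m i) (p - m * (2 * n - 2) - 2) := by
      rw [← map_smul, h2, hτ.apply_doubleRoot hξ hn]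
    rw [show p - 2 - m * (2 * (n : ℤ) - 2) = p - m * (2 * n - 2) - 2 by ring]
    rcases hξ.inBand_sub_two hn hb with hb' | hb'
    · exact ⟨hb', h3⟩
    · exfalso
      refine hξ.not_isPosRoot_neg hn hb' (v := -τ β) ?_ (by rwa [neg_neg])
      rw [doubleRoot_add hn, star_star, smul_neg, h3]
  | @down_neg p β m h hp ih =>
    obtain ⟨hb, h2⟩ := ih
    have h3 : (2 : ℤ) • τ β = doubleRoot ξ (starPow m i) (p - m * (2 * n - 2) - 2) := by
      rw [← map_smul, h2, hτ.apply_doubleRoot hξ hn]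
    rw [show p - 2 - (m - 1) * (2 * (n : ℤ) - 2) = p - m * (2 * n - 2) - 2 + (2 * n - 2) by ring,
      starPow_sub_one]
    rcases hξ.inBand_sub_two hn hb with hb' | hb'
    · exact absurd hp (hξ.not_isPosRoot_neg hn hb' h3)
    · refine ⟨hb', ?_⟩
      rw [doubleRoot_add hn, star_star, smul_neg, h3]
  | @up_pos p β m h hp ih =>
    obtain ⟨hb, h2⟩ := ih
    have h3 : (2 : ℤ) • τ⁻¹ β = doubleRoot ξ (starPow m i) (p - m * (2 * n - 2) + 2) := by
      rw [← map_smul, h2, hτ.inv_apply_doubleRoot hξ hn]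
    rw [show p + 2 - m * (2 * (n : ℤ) - 2) = p - m * (2 * n - 2) + 2 by ring]
    rcases hξ.inBand_add_two hn hb with hb' | hb'
    · exact ⟨hb', h3⟩
    · exfalso
      refine hξ.not_isPosRoot_neg hn hb' (v := -τ⁻¹ β) ?_ (by rwa [neg_neg])
      rw [doubleRoot_sub hn, star_star, smul_neg, h3]
  | @up_neg p β m h hp ih =>
    obtain ⟨hb, h2⟩ := ih
    have h3 : (2 : ℤ) • τ⁻¹ β = doubleRoot ξ (starPow m i) (p - m * (2 * n - 2) + 2) := by
      rw [← map_smul, h2, hτ.inv_apply_doubleRoot hξ hn]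
    rw [show p + 2 - (m + 1) * (2 * (n : ℤ) - 2) = p - m * (2 * n - 2) + 2 - (2 * n - 2) by ring,
      starPow_add_one]
    rcases hξ.inBand_add_two hn hb with hb' | hb'
    · exact absurd hp (hξ.not_isPosRoot_neg hn hb' h3)
    · refine ⟨hb', ?_⟩
      rw [doubleRoot_sub hn, star_star, smul_neg, h3]

theorem IsCoxeterElement.exists_coord (hτ : Q.IsCoxeterElement τ) (hξ : Q.IsHeightFunction ξ)
    (hn : 4 ≤ n) {i : Fin n} {p : ℤ} (hb : InBand ξ i p) :
    ∃ β, IsPosRoot β ∧ Q.Coord ξ τ i p β 0 ∧ (2 : ℤ) • β = doubleRoot ξ i p := by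
  have key : ∀ (t : ℕ), InBand ξ i (ξ i - 2 * t) →
      ∃ β, IsPosRoot β ∧ Q.Coord ξ τ i (ξ i - 2 * t) β 0 ∧
        (2 : ℤ) • β = doubleRoot ξ i (ξ i - 2 * t) := by
    intro t
    induction t with
    | zero =>
      intro _
      refine ⟨Q.eta i, ⟨hτ.isRoot_eta hξ hn i, fun j => ?_⟩, ?_, ?_⟩
      · rw [hξ.eta_apply hn]; split_ifs <;> simp
      · simpa using Coord.base i
      · rw [Nat.cast_zero, mul_zero, sub_zero, hξ.doubleRoot_self hn]; funext j; simp
    | succ t ih =>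
      intro hb'
      have hs : ξ i - 2 * ((t + 1 : ℕ) : ℤ) = ξ i - 2 * t - 2 := by push_cast; ring
      rw [hs] at hb' ⊢
      obtain ⟨β, hβ, hc, h2⟩ := ih
        ⟨by have := hb'.lower; omega, by omega, by have := hb'.parity; omega⟩
      have h3 : (2 : ℤ) • τ β = doubleRoot ξ i (ξ i - 2 * t - 2) := by
        rw [← map_smul, h2, hτ.apply_doubleRoot hξ hn]
      have hpos : IsPosRoot (τ β) := by
        refine ⟨hβ.1.map hτ.mem_weylGroup, fun j => ?_⟩
        have h4 := hξ.doubleRoot_nonneg hn hb' j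
        have h5 := congrFun h3 j
        simp only [Pi.smul_apply, smul_eq_mul] at h5
        omega
      exact ⟨τ β, hpos, Coord.down_pos hc hpos, h3⟩
  obtain ⟨hl, hu, hp⟩ := hb
  have e : p = ξ i - 2 * (((ξ i - p) / 2).toNat : ℤ) := by omega
  rw [e]
  apply key
  rw [← e]
  exact ⟨hl, hu, hp⟩

theorem IsCoxeterElement.coord_zero_iff (hτ : Q.IsCoxeterElement τ) (hξ : Q.IsHeightFunction ξ)
    (hn : 4 ≤ n) {i : Fin n} {p : ℤ} {β : RootLattice n} :
    Q.Coord ξ τ i p β 0 ↔ InBand ξ i p ∧ (2 : ℤ) • β = doubleRoot ξ i p := by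
  constructor
  · intro h
    simpa [starPow] using h.inBand hξ hτ hn
  · rintro ⟨hb, h⟩
    obtain ⟨β', -, hc, h'⟩ := hτ.exists_coord hξ hn hb
    rwa [two_smul_injective (h.trans h'.symm)]

end DynkinQuiver

/-! ### Sums of two positive roots -/

/-- The sign with which two positions at distance `z` carry the same vector `2ε`, and `0` if they
carry different ones. -/
def coincide (M z : ℤ) : ℤ := if z % M = 0 then (if (z / M) % 2 = 0 then 1 else -1) else 0

theorem coincide_add_mul {M : ℤ} (hM : M ≠ 0) (z q : ℤ) :
    coincide M (z + q * M) = if q % 2 = 0 then coincide M z else -coincide M z := by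
  unfold coincide
  rw [Int.add_mul_emod_self_right, Int.add_mul_ediv_right _ _ hM]
  split_ifs <;> first | rfl | omega

theorem coincide_add {M : ℤ} (hM : M ≠ 0) (z : ℤ) : coincide M (z + M) = -coincide M z := by
  simpa using coincide_add_mul hM z 1

theorem coincide_sub {M : ℤ} (hM : M ≠ 0) (z : ℤ) : coincide M (z - M) = -coincide M z := by
  rw [← neg_eq_iff_eq_neg, ← coincide_add hM]; congr 1; ring

theorem coincide_zero (M : ℤ) : coincide M 0 = 1 := by simp [coincide]

theorem coincide_eq_zero {M z : ℤ} (h1 : 0 < z) (h2 : z < M) : coincide M z = 0 := by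
  have : z % M = z := Int.emod_eq_of_lt h1.le h2
  unfold coincide
  rw [if_neg (by omega)]

/-- The values of `coincide` around the origin, in a form suited to linear arithmetic. -/
theorem coincide_spec {M z : ℤ} (h1 : -2 * M < z) (h2 : z < 2 * M) :
    (z = 0 ∧ coincide M z = 1) ∨ (z ≠ 0 ∧ (z = M ∨ z = -M) ∧ coincide M z = -1) ∨
      (z ≠ 0 ∧ z ≠ M ∧ z ≠ -M ∧ coincide M z = 0) := by
  have hM : M ≠ 0 := by omega
  have hz := coincide_zero M
  by_cases c1 : z < -M
  · have := coincide_eq_zero (M := M) (z := z + M + M) (by omega) (by omega)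
    rw [coincide_add hM, coincide_add hM] at this
    omega
  by_cases c2 : z = -M
  · have := coincide_add hM z
    rw [c2, neg_add_cancel] at this
    rw [c2]
    omega
  by_cases c3 : z < 0
  · have := coincide_eq_zero (M := M) (z := z + M) (by omega) (by omega)
    rw [coincide_add hM] at this
    omega
  by_cases c4 : z = 0
  · rw [c4]; omega
  by_cases c5 : z < M
  · have := coincide_eq_zero (M := M) (z := z) (by omega) (by omega)
    omega
  by_cases c6 : z = M
  · have := coincide_sub hM z
    rw [c6, sub_self] at this
    rw [c6]
    omega
  · have := coincide_eq_zero (M := M) (z := z - M) (by omega) (by omega)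
    rw [coincide_sub hM] at this
    omega

/-- The possible places of the two ends of an interval that stands for a positive root: the
bounds by `X` come from the far end of the long arm, those by `A` from the branch vertex. -/
structure IsArm (M X A a b : ℤ) : Prop where
  lt_far : a < X
  far_lt : X - M < b
  branch_lt : A - M < a
  le_branch : b ≤ A + M - 2
  lt : a < b
  lt_add : b < a + M

/-- The possible places of the right end of an interval of length `M`; these intervals stand for
the roots in the rows of the tips. -/
structure IsTipEnd (M X A b : ℤ) : Prop where
  lt_far : b - M < X
  far_lt : X - M < b
  branch_le : A ≤ b
  le_branch : b ≤ A + M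

section

variable {M X A a b a₁ b₁ a₂ b₂ : ℤ}

/-- The four relative positions of two roots in the rows of the long arm whose sum is such a
root, where the first summand is the one to the right of the sum. -/
def ArmSplit (M a b a₁ b₁ a₂ b₂ : ℤ) : Prop :=
  (b₁ = b ∧ a₂ = a ∧ a₁ = b₂) ∨ (b₁ = a + M ∧ a₂ = b - M ∧ a₁ = b₂) ∨
    (a₁ = a ∧ a₂ = b - M ∧ b₂ = b₁ - M) ∨ (b₁ = a + M ∧ b₂ = b ∧ a₂ = a₁ - M)

/-- If `e_b - e_a` is the sum of `e_{b₁} - e_{a₁}` and `e_{b₂} - e_{a₂}`, then one of the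
summands contains `e_b`. -/
theorem IsArm.right_cases (v : IsArm M X A a b) (v₁ : IsArm M X A a₁ b₁)
    (v₂ : IsArm M X A a₂ b₂)
    (h : coincide M (b - b) - coincide M (a - b) =
      coincide M (b₁ - b) - coincide M (a₁ - b) +
        (coincide M (b₂ - b) - coincide M (a₂ - b))) :
    (b₁ = b ∨ a₁ = b - M) ∨ (b₂ = b ∨ a₂ = b - M) := by
  obtain ⟨hX, hX', hA, hA', l, l'⟩ := v
  obtain ⟨hX₁, hX₁', hA₁, hA₁', l₁, l₁'⟩ := v₁
  obtain ⟨hX₂, hX₂', hA₂, hA₂', l₂, l₂'⟩ := v₂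
  have s0 := coincide_spec (M := M) (z := b - b) (by omega) (by omega)
  have s1 := coincide_spec (M := M) (z := a - b) (by omega) (by omega)
  have s2 := coincide_spec (M := M) (z := b₁ - b) (by omega) (by omega)
  have s3 := coincide_spec (M := M) (z := a₁ - b) (by omega) (by omega)
  have s4 := coincide_spec (M := M) (z := b₂ - b) (by omega) (by omega)
  have s5 := coincide_spec (M := M) (z := a₂ - b) (by omega) (by omega)
  omega

theorem IsArm.split_of_right_eq (v : IsArm M X A a b) (v₁ : IsArm M X A a₁ b₁)
    (v₂ : IsArm M X A a₂ b₂)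
    (h : ∀ x ∈ [a, b, a₁, b₁, a₂, b₂], coincide M (b - x) - coincide M (a - x) =
      coincide M (b₁ - x) - coincide M (a₁ - x) + (coincide M (b₂ - x) - coincide M (a₂ - x)))
    (hb : b₁ = b) :
    ArmSplit M a b a₁ b₁ a₂ b₂ ∨ ArmSplit M a b a₂ b₂ a₁ b₁ := by
  obtain ⟨hX, hX', hA, hA', l, l'⟩ := v
  obtain ⟨hX₁, hX₁', hA₁, hA₁', l₁, l₁'⟩ := v₁
  obtain ⟨hX₂, hX₂', hA₂, hA₂', l₂, l₂'⟩ := v₂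
  have hM : M ≠ 0 := by omega
  have hsub : ∀ y x, coincide M (y - M - x) = -coincide M (y - x) := fun y x => by
    rw [← coincide_sub hM]; ring_nf
  have hadd : ∀ y x, coincide M (y + M - x) = -coincide M (y - x) := fun y x => by
    rw [← coincide_add hM]; ring_nf
  have hself : ∀ y, coincide M (y - y) = 1 := fun y => by rw [sub_self, coincide_zero]
  subst hb
  -- The terms `e_b` cancel, and `e_a` is found among the remaining ones.
  have stage : a₂ = a ∨ b₂ = a + M := by
    by_cases e : a₁ = a
    · subst e
      have t := h b₂ (by simp)
      have t5 := coincide_spec (M := M) (z := a₂ - b₂) (by omega) (by omega)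
      rw [hself] at t
      omega
    · have t := h a (by simp)
      rw [hself] at t
      have s3 := coincide_spec (M := M) (z := a₁ - a) (by omega) (by omega)
      have s4 := coincide_spec (M := M) (z := b₂ - a) (by omega) (by omega)
      have s5 := coincide_spec (M := M) (z := a₂ - a) (by omega) (by omega)
      omega
  have t := h a₁ (by simp)
  rw [hself] at t
  rcases stage with rfl | rfl
  · have t4 := coincide_spec (M := M) (z := b₂ - a₁) (by omega) (by omega)
    have e : a₁ = b₂ := by clear hsub hadd hself h; omega
    exact Or.inl (Or.inl ⟨rfl, rfl, e⟩)
  · rw [hadd] at t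
    have t5 := coincide_spec (M := M) (z := a₂ - a₁) (by omega) (by omega)
    have e : a₁ = a₂ - M := by clear hsub hadd hself h; omega
    exact Or.inr (Or.inr (Or.inr (Or.inr ⟨rfl, rfl, e⟩)))

theorem IsArm.split_of_left_eq (v : IsArm M X A a b) (v₁ : IsArm M X A a₁ b₁)
    (v₂ : IsArm M X A a₂ b₂)
    (h : ∀ x ∈ [a, b, a₁, b₁, a₂, b₂], coincide M (b - x) - coincide M (a - x) =
      coincide M (b₁ - x) - coincide M (a₁ - x) + (coincide M (b₂ - x) - coincide M (a₂ - x)))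
    (hb : a₁ = b - M) :
    ArmSplit M a b a₁ b₁ a₂ b₂ ∨ ArmSplit M a b a₂ b₂ a₁ b₁ := by
  obtain ⟨hX, hX', hA, hA', l, l'⟩ := v
  obtain ⟨hX₁, hX₁', hA₁, hA₁', l₁, l₁'⟩ := v₁
  obtain ⟨hX₂, hX₂', hA₂, hA₂', l₂, l₂'⟩ := v₂
  have hM : M ≠ 0 := by omega
  have hsub : ∀ y x, coincide M (y - M - x) = -coincide M (y - x) := fun y x => by
    rw [← coincide_sub hM]; ring_nf
  have hadd : ∀ y x, coincide M (y + M - x) = -coincide M (y - x) := fun y x => by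
    rw [← coincide_add hM]; ring_nf
  have hself : ∀ y, coincide M (y - y) = 1 := fun y => by rw [sub_self, coincide_zero]
  subst hb
  have stage : a₂ = a ∨ b₂ = a + M := by
    by_cases e : b₁ = a + M
    · subst e
      have t := h b₂ (by simp)
      rw [hself, hadd, hsub] at t
      have t5 := coincide_spec (M := M) (z := a₂ - b₂) (by omega) (by omega)
      omega
    · have t := h a (by simp)
      rw [hself, hsub] at t
      have s3 := coincide_spec (M := M) (z := b₁ - a) (by omega) (by omega)
      have s4 := coincide_spec (M := M) (z := b₂ - a) (by omega) (by omega)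
      have s5 := coincide_spec (M := M) (z := a₂ - a) (by omega) (by omega)
      omega
  have t := h b₁ (by simp)
  rw [hself, hsub] at t
  rcases stage with rfl | rfl
  · have t4 := coincide_spec (M := M) (z := b₂ - b₁) (by omega) (by omega)
    have e : b₁ = b₂ - M := by clear hsub hadd hself h; omega
    exact Or.inr (Or.inr (Or.inr (Or.inl ⟨rfl, rfl, e⟩)))
  · rw [hadd] at t
    have t5 := coincide_spec (M := M) (z := a₂ - b₁) (by omega) (by omega)
    have e : a₂ = b₁ := by clear hsub hadd hself h; omega
    exact Or.inr (Or.inr (Or.inl ⟨rfl, rfl, e⟩))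

theorem IsArm.split_of_right (v : IsArm M X A a b) (v₁ : IsArm M X A a₁ b₁)
    (v₂ : IsArm M X A a₂ b₂)
    (h : ∀ x ∈ [a, b, a₁, b₁, a₂, b₂], coincide M (b - x) - coincide M (a - x) =
      coincide M (b₁ - x) - coincide M (a₁ - x) + (coincide M (b₂ - x) - coincide M (a₂ - x)))
    (hb : b₁ = b ∨ a₁ = b - M) :
    ArmSplit M a b a₁ b₁ a₂ b₂ ∨ ArmSplit M a b a₂ b₂ a₁ b₁ :=
  hb.elim (v.split_of_right_eq v₁ v₂ h) (v.split_of_left_eq v₁ v₂ h)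

theorem IsArm.split (v : IsArm M X A a b) (v₁ : IsArm M X A a₁ b₁) (v₂ : IsArm M X A a₂ b₂)
    (h : ∀ x ∈ [a, b, a₁, b₁, a₂, b₂], coincide M (b - x) - coincide M (a - x) =
      coincide M (b₁ - x) - coincide M (a₁ - x) + (coincide M (b₂ - x) - coincide M (a₂ - x))) :
    ArmSplit M a b a₁ b₁ a₂ b₂ ∨ ArmSplit M a b a₂ b₂ a₁ b₁ := by
  rcases v.right_cases v₁ v₂ (h b (by simp)) with h' | h'
  · exact v.split_of_right v₁ v₂ h h'
  · refine (v.split_of_right v₂ v₁ (fun x hx => ?_) h').symm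
    rw [h x (by simp only [List.mem_cons] at hx ⊢; tauto)]
    ring

/-- A root in a long row as the sum of two roots in the rows of the tips. -/
theorem IsArm.split_tips (v : IsArm M X A a b) (v₁ : IsTipEnd M X A b₁) (v₂ : IsTipEnd M X A b₂)
    (h : ∀ x ∈ [a, b, b₁, b₂], coincide M (b - x) - coincide M (a - x) =
      coincide M (b₁ - x) + coincide M (b₂ - x)) :
    (b₁ = b ∧ b₂ = a + M) ∨ (b₂ = b ∧ b₁ = a + M) := by
  obtain ⟨hX, hX', hA, hA', l, l'⟩ := v
  obtain ⟨hX₁, hX₁', hA₁, hA₁'⟩ := v₁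
  obtain ⟨hX₂, hX₂', hA₂, hA₂'⟩ := v₂
  have h1 := h b (by simp)
  have h2 := h a (by simp)
  have s0 := coincide_spec (M := M) (z := b - b) (by omega) (by omega)
  have s1 := coincide_spec (M := M) (z := a - b) (by omega) (by omega)
  have s2 := coincide_spec (M := M) (z := b₁ - b) (by omega) (by omega)
  have s3 := coincide_spec (M := M) (z := b₂ - b) (by omega) (by omega)
  have t0 := coincide_spec (M := M) (z := b - a) (by omega) (by omega)
  have t1 := coincide_spec (M := M) (z := a - a) (by omega) (by omega)
  have t2 := coincide_spec (M := M) (z := b₁ - a) (by omega) (by omega)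
  have t3 := coincide_spec (M := M) (z := b₂ - a) (by omega) (by omega)
  omega

/-- A root in the row of a tip as the sum of such a root and of one in a long row. -/
theorem IsTipEnd.split (v : IsTipEnd M X A b) (v₁ : IsTipEnd M X A b₁) (v₂ : IsArm M X A a₂ b₂)
    (h : ∀ x ∈ [b, b₁, a₂, b₂], coincide M (b - x) =
      coincide M (b₁ - x) + (coincide M (b₂ - x) - coincide M (a₂ - x))) :
    (b₂ = b ∧ a₂ = b₁) ∨ (a₂ = b - M ∧ b₂ = b₁ - M) := by
  obtain ⟨hX, hX', hA, hA'⟩ := v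
  obtain ⟨hX₁, hX₁', hA₁, hA₁'⟩ := v₁
  obtain ⟨hX₂, hX₂', hA₂, hA₂', l₂, l₂'⟩ := v₂
  have h1 := h b (by simp)
  have h2 := h b₁ (by simp)
  have h3 := h b₂ (by simp)
  have s0 := coincide_spec (M := M) (z := b - b) (by omega) (by omega)
  have s1 := coincide_spec (M := M) (z := b₁ - b) (by omega) (by omega)
  have s2 := coincide_spec (M := M) (z := b₂ - b) (by omega) (by omega)
  have s3 := coincide_spec (M := M) (z := a₂ - b) (by omega) (by omega)
  have t0 := coincide_spec (M := M) (z := b - b₁) (by omega) (by omega)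
  have t1 := coincide_spec (M := M) (z := b₁ - b₁) (by omega) (by omega)
  have t2 := coincide_spec (M := M) (z := b₂ - b₁) (by omega) (by omega)
  have t3 := coincide_spec (M := M) (z := a₂ - b₁) (by omega) (by omega)
  by_cases e : b₁ = b
  · subst e
    have r2 := coincide_spec (M := M) (z := b₂ - b₂) (by omega) (by omega)
    have r3 := coincide_spec (M := M) (z := a₂ - b₂) (by omega) (by omega)
    omega
  · clear h3
    omega

end

/-- The vertex at the far end of the long arm sees a position only if it carries `2ε_1`. -/
theorem pulse_first (hn : 4 ≤ n) (z : ℤ) (hz : z % 2 = 0) :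
    pulse (⟨0, by omega⟩ : Fin n) (z + 1) = 2 * coincide (2 * n - 2) z := by
  have hM : (2 * (n : ℤ) - 2) ≠ 0 := by omega
  have h0 : ¬ IsTip (⟨0, by omega⟩ : Fin n) := by simp only [IsTip]; omega
  have hr := row_of_not_isTip h0
  simp only [Nat.cast_zero, zero_add] at hr
  have e := Int.emod_add_mul_ediv z (2 * n - 2)
  set r := z % (2 * (n : ℤ) - 2) with hr'
  set q := z / (2 * (n : ℤ) - 2) with hq
  have h1 : 0 ≤ r := Int.emod_nonneg _ hM
  have h2 : r < 2 * n - 2 := Int.emod_lt_of_pos _ (by omega)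
  have h3 : r % 2 = 0 := by
    have : r = z - 2 * ((n - 1) * q) := by rw [← e]; ring
    omega
  rw [show z + 1 = r + 1 + q * (2 * n - 2) by rw [← e]; ring, pulse_add_mul hn,
    show z = r + q * (2 * n - 2) by rw [← e]; ring, coincide_add_mul hM]
  have key : pulse (⟨0, by omega⟩ : Fin n) (r + 1) = 2 * coincide (2 * n - 2) r := by
    obtain ⟨a1, a2, -⟩ := pulse_spec h0 (r + 1)
    rw [hr] at a1 a2
    by_cases h : r = 0
    · have h4 := a1 (by omega) (by omega); rw [h] at h4 ⊢; rw [h4, coincide_zero]; rfl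
    · rw [coincide_eq_zero (by omega) h2, a2 (by omega) (by omega)]; rfl
  rw [key]
  split_ifs <;> ring

/-- A linear form that vanishes on the vectors `±2ε` that have a position, but not on the one
negated by the Coxeter transformation. -/
def forkForm (hn : 4 ≤ n) (ξ : Fin n → ℤ) (v : RootLattice n) : ℤ :=
  if ξ ⟨n - 2, by omega⟩ = ξ ⟨n - 1, by omega⟩ then v ⟨n - 1, by omega⟩ - v ⟨n - 2, by omega⟩
  else v ⟨n - 1, by omega⟩ + v ⟨n - 2, by omega⟩ - v ⟨n - 3, by omega⟩

theorem forkForm_add (hn : 4 ≤ n) (ξ : Fin n → ℤ) (v w : RootLattice n) :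
    forkForm hn ξ (v + w) = forkForm hn ξ v + forkForm hn ξ w := by
  unfold forkForm
  split_ifs <;> simp only [Pi.add_apply] <;> ring

namespace DynkinQuiver

variable {Q : DynkinQuiver n} {ξ : Fin n → ℤ} {τ : RootLattice n ≃ₗ[ℤ] RootLattice n}

theorem IsHeightFunction.tips_spec (hξ : Q.IsHeightFunction ξ) (hn : 4 ≤ n) :
    (ξ ⟨n - 2, by omega⟩ = ξ ⟨n - 3, by omega⟩ + 1 ∨
      ξ ⟨n - 2, by omega⟩ = ξ ⟨n - 3, by omega⟩ - 1) ∧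
    (ξ ⟨n - 1, by omega⟩ = ξ ⟨n - 3, by omega⟩ + 1 ∨
      ξ ⟨n - 1, by omega⟩ = ξ ⟨n - 3, by omega⟩ - 1) := by
  have h2 := hξ.adjacent (i := ⟨n - 3, by omega⟩) (j := ⟨n - 2, by omega⟩)
    (by rw [adjacent_iff_val hn]; simp only; omega)
  have h1 := hξ.adjacent (i := ⟨n - 3, by omega⟩) (j := ⟨n - 1, by omega⟩)
    (by rw [adjacent_iff_val hn]; simp only; omega)
  tauto

theorem IsHeightFunction.forkForm_epsVec (hξ : Q.IsHeightFunction ξ) (hn : 4 ≤ n) (x : ℤ) :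
    forkForm hn ξ (epsVec ξ x) = 0 := by
  have ht2 : IsTip (⟨n - 2, by omega⟩ : Fin n) := by simp only [IsTip]; omega
  have ht1 : IsTip (⟨n - 1, by omega⟩ : Fin n) := by simp only [IsTip]; omega
  have ht3 : ¬ IsTip (⟨n - 3, by omega⟩ : Fin n) := by simp only [IsTip]; omega
  have hr := row_of_not_isTip ht3
  simp only at hr
  have hr' : row (⟨n - 3, by omega⟩ : Fin n) = n - 2 := by omega
  have h := hξ.tips_spec hn
  unfold forkForm
  simp only [epsVec, pulse_of_isTip ht1, pulse_of_isTip ht2]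
  split_ifs with he
  · rw [he, sub_self]
  · simp only [pulse, ht3, if_false, hr']
    set c := ξ ⟨n - 3, by omega⟩ with hc
    have h4 := wave_sub hn (x - c + n)
    rw [show x - c + (n : ℤ) - (2 * n - 2) = x - c - (n - 2) by ring] at h4
    have h5 : (ξ ⟨n - 2, by omega⟩ = c + 1 ∧ ξ ⟨n - 1, by omega⟩ = c - 1) ∨
        (ξ ⟨n - 2, by omega⟩ = c - 1 ∧ ξ ⟨n - 1, by omega⟩ = c + 1) := by omega
    rcases h5 with ⟨h5, h6⟩ | ⟨h5, h6⟩
    · rw [h5, h6, show x - (c - 1) + ((n : ℤ) - 1) = x - c + n by ring,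
        show x - (c + 1) + ((n : ℤ) - 1) = x - c + (n - 2) by ring, h4]
      ring
    · rw [h5, h6, show x - (c - 1) + ((n : ℤ) - 1) = x - c + n by ring,
        show x - (c + 1) + ((n : ℤ) - 1) = x - c + (n - 2) by ring, h4]
      ring

theorem IsHeightFunction.forkForm_forkVec (hξ : Q.IsHeightFunction ξ) (hn : 4 ≤ n) {i : Fin n}
    (hi : IsTip i) (p : ℤ) :
    forkForm hn ξ (forkVec ξ i p) = 2 ∨ forkForm hn ξ (forkVec ξ i p) = -2 := by
  have ht2 : IsTip (⟨n - 2, by omega⟩ : Fin n) := by simp only [IsTip]; omega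
  have ht1 : IsTip (⟨n - 1, by omega⟩ : Fin n) := by simp only [IsTip]; omega
  have ht3 : ¬ IsTip (⟨n - 3, by omega⟩ : Fin n) := by simp only [IsTip]; omega
  have h := hξ.tips_spec hn
  have hi' : n ≤ i.val + 2 := hi
  have := i.2
  have hcase : (i = ⟨n - 2, by omega⟩ ∧ i ≠ ⟨n - 1, by omega⟩) ∨
      (i ≠ ⟨n - 2, by omega⟩ ∧ i = ⟨n - 1, by omega⟩) := by
    simp only [Ne, Fin.ext_iff]; omega
  have hsign : (ξ ⟨n - 2, by omega⟩ = ξ ⟨n - 1, by omega⟩ ∧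
      altSign (p - ξ ⟨n - 2, by omega⟩) = altSign (p - ξ ⟨n - 1, by omega⟩)) ∨
      (ξ ⟨n - 2, by omega⟩ ≠ ξ ⟨n - 1, by omega⟩ ∧
      altSign (p - ξ ⟨n - 2, by omega⟩) = -altSign (p - ξ ⟨n - 1, by omega⟩)) := by
    by_cases he : ξ ⟨n - 2, by omega⟩ = ξ ⟨n - 1, by omega⟩
    · exact Or.inl ⟨he, by rw [he]⟩
    · refine Or.inr ⟨he, ?_⟩
      unfold altSign
      split_ifs <;> omega
  have hs := altSign_eq (p - ξ ⟨n - 1, by omega⟩)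
  unfold forkForm
  simp only [forkVec, forkPart, ht1, ht2, ht3, if_true, if_false]
  rcases hcase with ⟨h1, h2⟩ | ⟨h1, h2⟩
  · rw [if_pos h1, if_neg h2]
    split_ifs <;> omega
  · rw [if_neg h1, if_pos h2]
    split_ifs <;> omega

/-- Whether a root lies in the row of a tip is detected by the linear form `forkForm`. -/
theorem IsHeightFunction.forkForm_doubleRoot (hξ : Q.IsHeightFunction ξ) (hn : 4 ≤ n) (i : Fin n)
    (p : ℤ) : (¬ IsTip i ∧ forkForm hn ξ (doubleRoot ξ i p) = 0) ∨
      (IsTip i ∧ (forkForm hn ξ (doubleRoot ξ i p) = 2 ∨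
        forkForm hn ξ (doubleRoot ξ i p) = -2)) := by
  by_cases hi : IsTip i
  · refine Or.inr ⟨hi, ?_⟩
    rw [doubleRoot_of_isTip ξ hi, forkForm_add, hξ.forkForm_epsVec hn, zero_add]
    exact hξ.forkForm_forkVec hn hi p
  · refine Or.inl ⟨hi, ?_⟩
    have h := forkForm_add hn ξ (doubleRoot ξ i p) (epsVec ξ (p - row i))
    rw [doubleRoot_of_not_isTip ξ hi, sub_add_cancel, hξ.forkForm_epsVec hn,
      hξ.forkForm_epsVec hn] at h
    rw [doubleRoot_of_not_isTip ξ hi]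
    omega

theorem IsHeightFunction.isArm (hξ : Q.IsHeightFunction ξ) (hn : 4 ≤ n) {i : Fin n} {p : ℤ}
    (hb : InBand ξ i p) (hi : ¬ IsTip i) :
    IsArm (2 * n - 2) (ξ ⟨0, by omega⟩) (ξ ⟨n - 3, by omega⟩ - (n - 2)) (p - row i)
      (p + row i) := by
  obtain ⟨hl, hu, -⟩ := hb
  rw [star_of_not_isTip hi] at hl
  have h0 : ¬ IsTip (⟨0, by omega⟩ : Fin n) := by simp only [IsTip]; omega
  have ht3 : ¬ IsTip (⟨n - 3, by omega⟩ : Fin n) := by simp only [IsTip]; omega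
  have e0 := row_of_not_isTip h0
  have e3 := row_of_not_isTip ht3
  simp only [Nat.cast_zero, zero_add] at e0
  simp only at e3
  have h1 := hξ.sub_le_of_not_isTip hn hi h0
  have h2 := hξ.sub_le_of_not_isTip hn hi ht3
  constructor <;> omega

theorem IsHeightFunction.isTipEnd (hξ : Q.IsHeightFunction ξ) (hn : 4 ≤ n) {i : Fin n} {p : ℤ}
    (hb : InBand ξ i p) (hi : IsTip i) :
    IsTipEnd (2 * n - 2) (ξ ⟨0, by omega⟩) (ξ ⟨n - 3, by omega⟩ - (n - 2)) (p + row i) := by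
  obtain ⟨hl, hu, hp⟩ := hb
  have h0 : ¬ IsTip (⟨0, by omega⟩ : Fin n) := by simp only [IsTip]; omega
  have ht3 : ¬ IsTip (⟨n - 3, by omega⟩ : Fin n) := by simp only [IsTip]; omega
  have e0 := row_of_not_isTip h0
  have e3 := row_of_not_isTip ht3
  simp only [Nat.cast_zero, zero_add] at e0
  simp only at e3
  have e := row_of_isTip hi
  have h1 := hξ.sub_le_of_isTip hn hi h0
  have h2 := hξ.sub_le_of_isTip hn hi ht3
  have h3 := hξ.sub_le_of_isTip hn (isTip_star.2 hi) ht3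
  have h4 := hξ.sub_le_of_isTip hn (isTip_star.2 hi) h0
  have h5 := hξ.sub_row_mod_two hn i ⟨n - 3, by omega⟩
  constructor <;> omega

theorem IsHeightFunction.doubleRoot_first (hξ : Q.IsHeightFunction ξ) (hn : 4 ≤ n) {i : Fin n}
    {p : ℤ} (hp : (p - ξ i) % 2 = 0) {x : ℤ} (hx : (x - ξ ⟨0, by omega⟩) % 2 = 1) :
    doubleRoot ξ i (p + 2 * ((ξ ⟨0, by omega⟩ - x + 1) / 2)) ⟨0, by omega⟩ =
      2 * (coincide (2 * n - 2) (p + row i - x) -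
        if IsTip i then 0 else coincide (2 * n - 2) (p - row i - x)) := by
  have h0 : ¬ IsTip (⟨0, by omega⟩ : Fin n) := by simp only [IsTip]; omega
  have e0 := row_of_not_isTip h0
  simp only [Nat.cast_zero, zero_add] at e0
  have h1 := hξ.sub_row_mod_two hn i ⟨0, by omega⟩
  have e : 2 * ((ξ ⟨0, by omega⟩ - x + 1) / 2) = ξ ⟨0, by omega⟩ - x + 1 := by omega
  rw [e, doubleRoot, doubleCoord,
    show p + (ξ ⟨0, by omega⟩ - x + 1) - ξ ⟨0, by omega⟩ + row i = p + row i - x + 1 by ring,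
    show p + (ξ ⟨0, by omega⟩ - x + 1) - ξ ⟨0, by omega⟩ - row i = p - row i - x + 1 by ring,
    pulse_first hn _ (by omega), pulse_first hn _ (by omega)]
  split_ifs
  · simp [forkPart, h0]
  · ring

theorem IsCoxeterElement.doubleRoot_shift (hτ : Q.IsCoxeterElement τ) (hξ : Q.IsHeightFunction ξ)
    (hn : 4 ≤ n) (t : ℤ) (i : Fin n) (p : ℤ) :
    doubleRoot ξ i (p + 2 * t) = (τ⁻¹ ^ t : RootLattice n ≃ₗ[ℤ] RootLattice n)
      (doubleRoot ξ i p) := by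
  induction t using Int.induction_on with
  | zero => simp
  | succ t ih =>
    rw [show p + 2 * ((t : ℤ) + 1) = p + 2 * t + 2 by ring, ← hτ.inv_apply_doubleRoot hξ hn, ih,
      add_comm, zpow_add, zpow_one, LinearEquiv.mul_apply]
  | pred t ih =>
    rw [show p + 2 * (-(t : ℤ) - 1) = p + 2 * -t - 2 by ring, ← hτ.apply_doubleRoot hξ hn, ih,
      sub_eq_add_neg, add_comm, zpow_add, zpow_neg_one, inv_inv, LinearEquiv.mul_apply]

/-- The vertex `(i, p)` of the repetition quiver carries the root `β`. -/
def At (ξ : Fin n → ℤ) (i : Fin n) (p : ℤ) (β : RootLattice n) : Prop :=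
  InBand ξ i p ∧ (2 : ℤ) • β = doubleRoot ξ i p

theorem At.isPosition {i : Fin n} {p : ℤ} {β : RootLattice n} (h : At ξ i p β)
    (hξ : Q.IsHeightFunction ξ) (hn : 4 ≤ n) :
    (p + row i - ξ ⟨0, by omega⟩) % 2 = 1 ∧ (p - row i - ξ ⟨0, by omega⟩) % 2 = 1 := by
  have h0 : ¬ IsTip (⟨0, by omega⟩ : Fin n) := by simp only [IsTip]; omega
  have e0 := row_of_not_isTip h0
  simp only [Nat.cast_zero, zero_add] at e0
  have h1 := hξ.sub_row_mod_two hn i ⟨0, by omega⟩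
  have h2 := h.1.parity
  omega

/-- A sum of roots remains a sum after a translation; evaluating all translates at the far end of
the long arm compares the positions. -/
theorem At.add (hξ : Q.IsHeightFunction ξ) (hτ : Q.IsCoxeterElement τ) (hn : 4 ≤ n)
    {i i₁ i₂ : Fin n} {p p₁ p₂ : ℤ} {α β γ : RootLattice n} (h : At ξ i p γ) (h₁ : At ξ i₁ p₁ α)
    (h₂ : At ξ i₂ p₂ β) (hs : α + β = γ) {x : ℤ} (hx : (x - ξ ⟨0, by omega⟩) % 2 = 1) :
    (coincide (2 * n - 2) (p + row i - x) -
        if IsTip i then 0 else coincide (2 * n - 2) (p - row i - x)) =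
      (coincide (2 * n - 2) (p₁ + row i₁ - x) -
        if IsTip i₁ then 0 else coincide (2 * n - 2) (p₁ - row i₁ - x)) +
      (coincide (2 * n - 2) (p₂ + row i₂ - x) -
        if IsTip i₂ then 0 else coincide (2 * n - 2) (p₂ - row i₂ - x)) := by
  have key : doubleRoot ξ i p = doubleRoot ξ i₁ p₁ + doubleRoot ξ i₂ p₂ := by
    rw [← h.2, ← h₁.2, ← h₂.2, ← smul_add, hs]
  have key2 : ∀ t, doubleRoot ξ i (p + 2 * t) =
      doubleRoot ξ i₁ (p₁ + 2 * t) + doubleRoot ξ i₂ (p₂ + 2 * t) := by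
    intro t
    simp only [hτ.doubleRoot_shift hξ hn t, key, map_add]
  have e := congrFun (key2 ((ξ ⟨0, by omega⟩ - x + 1) / 2)) ⟨0, by omega⟩
  rw [Pi.add_apply, hξ.doubleRoot_first hn h.1.parity hx, hξ.doubleRoot_first hn h₁.1.parity hx,
    hξ.doubleRoot_first hn h₂.1.parity hx] at e
  linarith

end DynkinQuiver

/-! ### Paths in the Auslander-Reiten quiver -/

/-- The vertex `(j, q)` of the repetition quiver lies ahead of `(i, p)`: it is further to the
right, and so are, weakly, the two ends of the interval of positions that it stands for. -/
structure Ahead (i : Fin n) (p : ℤ) (j : Fin n) (q : ℤ) : Prop where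
  lt : p < q
  left : p - row i ≤ q - row j
  right : p + row i ≤ q + row j

theorem Ahead.trans {i j k : Fin n} {p q r : ℤ} (h₁ : Ahead i p j q) (h₂ : Ahead j q k r) :
    Ahead i p k r :=
  ⟨h₁.lt.trans h₂.lt, h₁.left.trans h₂.left, h₁.right.trans h₂.right⟩

theorem diagDist_of_adjacent (hn : 4 ≤ n) {i j : Fin n} (h : Adjacent i j) : diagDist i j = 1 := by
  have h1 := diagDist_spec i j
  rw [adjacent_iff_val hn] at h
  omega

theorem Adjacent.star (hn : 4 ≤ n) {i j : Fin n} (h : Adjacent i j) :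
    Adjacent (star i) (star j) := by
  have h1 := star_spec i
  have h2 := star_spec j
  rw [adjacent_iff_val hn] at h ⊢
  omega

theorem diagDist_eq_zero_iff {i j : Fin n} : diagDist i j = 0 ↔ i = j := by
  have h1 := diagDist_spec i j
  rw [Fin.ext_iff]
  omega

namespace DynkinQuiver

variable {Q : DynkinQuiver n} {ξ : Fin n → ℤ} {τ : RootLattice n ≃ₗ[ℤ] RootLattice n}

/-- A vertex that lies ahead is at least as many columns ahead as its distance in the diagram. -/
theorem _root_.TypeD.Ahead.diagDist_le {i j : Fin n} {p q : ℤ} (h : Ahead i p j q)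
    (hξ : Q.IsHeightFunction ξ) (hn : 4 ≤ n) (hi : InBand ξ i p) (hj : InBand ξ j q) :
    diagDist i j ≤ q - p := by
  have h1 := hi.parity
  have h2 := hj.parity
  have h3 := (hξ.sub_le hn i j).2.2
  have h4 := diagDist_spec i j
  have h5 := row_spec i
  have h6 := row_spec j
  obtain ⟨h7, h8, h9⟩ := h
  have := i.2
  have := j.2
  omega

theorem At.unique (hξ : Q.IsHeightFunction ξ) (hτ : Q.IsCoxeterElement τ) (hn : 4 ≤ n)
    {i j : Fin n} {p q : ℤ} {β : RootLattice n} (h₁ : At ξ i p β) (h₂ : At ξ j q β) :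
    i = j ∧ p = q := by
  have key : doubleRoot ξ i p = doubleRoot ξ j q := by rw [← h₁.2, ← h₂.2]
  have first : ∀ x, (x - ξ ⟨0, by omega⟩) % 2 = 1 →
      (coincide (2 * n - 2) (p + row i - x) -
        if IsTip i then 0 else coincide (2 * n - 2) (p - row i - x)) =
      (coincide (2 * n - 2) (q + row j - x) -
        if IsTip j then 0 else coincide (2 * n - 2) (q - row j - x)) := by
    intro x hx
    have e : doubleRoot ξ i (p + 2 * ((ξ ⟨0, by omega⟩ - x + 1) / 2)) =
        doubleRoot ξ j (q + 2 * ((ξ ⟨0, by omega⟩ - x + 1) / 2)) := by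
      rw [hτ.doubleRoot_shift hξ hn, hτ.doubleRoot_shift hξ hn, key]
    have e' := congrFun e ⟨0, by omega⟩
    rw [hξ.doubleRoot_first hn h₁.1.parity hx, hξ.doubleRoot_first hn h₂.1.parity hx] at e'
    linarith
  have f1 := hξ.forkForm_doubleRoot hn i p
  have f2 := hξ.forkForm_doubleRoot hn j q
  rw [← key] at f2
  obtain ⟨pb, pa⟩ := h₁.isPosition hξ hn
  by_cases hi : IsTip i
  · have hj : IsTip j := by by_contra hj; simp only [hi, hj] at f1 f2; simp at f1 f2; omega
    have v := hξ.isTipEnd hn h₁.1 hi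
    have w := hξ.isTipEnd hn h₂.1 hj
    have e1 := first _ pb
    simp only [hi, hj, if_true] at e1
    obtain ⟨hX, hX', hA, hA'⟩ := v
    obtain ⟨hX₁, hX₁', hA₁, hA₁'⟩ := w
    have s0 := coincide_spec (M := 2 * n - 2) (z := p + row i - (p + row i)) (by omega) (by omega)
    have s1 := coincide_spec (M := 2 * n - 2) (z := q + row j - (p + row i)) (by omega) (by omega)
    have hr := row_of_isTip hi
    have hr' := row_of_isTip hj
    have hpq : p = q := by omega
    subst hpq
    refine ⟨?_, rfl⟩
    by_contra hne
    rw [doubleRoot_of_isTip ξ hi, doubleRoot_of_isTip ξ hj, hr, hr'] at key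
    have e2 := congrFun (add_left_cancel key) i
    have := altSign_eq (p - ξ i)
    simp only [forkVec, forkPart, hi, if_true] at e2
    omega
  · have hj : ¬ IsTip j := by intro hj; simp only [hi, hj] at f1 f2; simp at f1 f2; omega
    have v := hξ.isArm hn h₁.1 hi
    have w := hξ.isArm hn h₂.1 hj
    have e1 := first _ pb
    have e2 := first _ pa
    simp only [hi, hj, if_false] at e1 e2
    obtain ⟨hX, hX', hA, hA', l, l'⟩ := v
    obtain ⟨hX₁, hX₁', hA₁, hA₁', l₁, l₁'⟩ := w
    have c1 : q + row j = p + row i ∨ q - row j = p + row i - (2 * n - 2) := by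
      clear e2 first f1 f2
      have s0 := coincide_spec (M := 2 * n - 2) (z := p + row i - (p + row i)) (by omega) (by omega)
      have s1 := coincide_spec (M := 2 * n - 2) (z := p - row i - (p + row i)) (by omega) (by omega)
      have s2 := coincide_spec (M := 2 * n - 2) (z := q + row j - (p + row i)) (by omega) (by omega)
      have s3 := coincide_spec (M := 2 * n - 2) (z := q - row j - (p + row i)) (by omega) (by omega)
      omega
    have c2 : q - row j = p - row i ∨ q + row j = p - row i + (2 * n - 2) := by
      clear e1 c1 first f1 f2
      have t0 := coincide_spec (M := 2 * n - 2) (z := p + row i - (p - row i)) (by omega) (by omega)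
      have t1 := coincide_spec (M := 2 * n - 2) (z := p - row i - (p - row i)) (by omega) (by omega)
      have t2 := coincide_spec (M := 2 * n - 2) (z := q + row j - (p - row i)) (by omega) (by omega)
      have t3 := coincide_spec (M := 2 * n - 2) (z := q - row j - (p - row i)) (by omega) (by omega)
      omega
    have hr := row_of_not_isTip hi
    have hr' := row_of_not_isTip hj
    rw [Fin.ext_iff]
    clear e1 e2 first f1 f2
    omega

theorem At.eq {i : Fin n} {p : ℤ} {β β' : PosRoot n} (h₁ : At ξ i p β.1) (h₂ : At ξ i p β'.1) :
    β = β' :=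
  Subtype.ext (two_smul_injective (h₁.2.trans h₂.2.symm))

theorem IsCoxeterElement.exists_at (hτ : Q.IsCoxeterElement τ) (hξ : Q.IsHeightFunction ξ)
    (hn : 4 ≤ n) {i : Fin n} {p : ℤ} (hb : InBand ξ i p) : ∃ β : PosRoot n, At ξ i p β.1 :=
  let ⟨β, h, _, h'⟩ := hτ.exists_coord hξ hn hb
  ⟨⟨β, h⟩, hb, h'⟩

theorem IsHeightFunction.exists_at (hξ : Q.IsHeightFunction ξ) (hn : 4 ≤ n) (β : PosRoot n) :
    ∃ i p, At ξ i p β.1 :=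
  hξ.exists_doubleRoot hn β.2

theorem ahead_of_arLt (hξ : Q.IsHeightFunction ξ) (hτ : Q.IsCoxeterElement τ) (hn : 4 ≤ n)
    {α β : PosRoot n} (h : Q.ARLt ξ τ α β) {i j : Fin n} {p q : ℤ} (hβ : At ξ i p β.1)
    (hα : At ξ j q α.1) : Ahead i p j q := by
  have step : ∀ {β β' : PosRoot n}, Q.ARArrow ξ τ β β' → ∀ {i j : Fin n} {p q : ℤ},
      At ξ i p β.1 → At ξ j q β'.1 → Ahead i p j q := by
    rintro β β' ⟨i', j', p', h1, h2, h3⟩ i j p q hβ hα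
    obtain ⟨rfl, rfl⟩ := hβ.unique hξ hτ hn ((hτ.coord_zero_iff hξ hn).1 h1)
    obtain ⟨rfl, rfl⟩ := hα.unique hξ hτ hn ((hτ.coord_zero_iff hξ hn).1 h2)
    have h4 := diagDist_of_adjacent hn h3
    have h5 := abs_row_sub_le_diagDist i j
    constructor <;> omega
  unfold ARLt at h
  induction h generalizing j q with
  | single h => exact step h hβ hα
  | @tail b c h h' ih =>
    obtain ⟨k, r, hb⟩ := hξ.exists_at hn b
    exact (ih hb).trans (step h' hb hα)

/-- A vertex of the Auslander-Reiten quiver that is far enough to the right is reached by a path: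
there is always a neighbour from which it is still far enough. -/
theorem reflTransGen_of_diagDist_le (hξ : Q.IsHeightFunction ξ) (hτ : Q.IsCoxeterElement τ)
    (hn : 4 ≤ n) {α : PosRoot n} {j : Fin n} {q : ℤ} (hα : At ξ j q α.1) (m : ℕ) {β : PosRoot n}
    {i : Fin n} {p : ℤ} (hβ : At ξ i p β.1) (hm : q - p = m) (hd : diagDist i j ≤ m) :
    Relation.ReflTransGen (Q.ARArrow ξ τ) β α := by
  induction m generalizing β i p with
  | zero =>
    have h1 := (abs_row_sub_le_diagDist i j).2.2
    obtain rfl : i = j := diagDist_eq_zero_iff.1 (by push_cast at hd; omega)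
    obtain rfl : q = p := by push_cast at hm; omega
    rw [hβ.eq hα]
  | succ m ih =>
    push_cast at hm hd
    obtain ⟨k, hk, hkd⟩ : ∃ k, Adjacent i k ∧ diagDist k j ≤ m := by
      by_cases hij : i = j
      · subst hij
        obtain ⟨k, hk⟩ := exists_adjacent hn i
        refine ⟨k, hk, ?_⟩
        rw [diagDist_of_adjacent hn hk.symm]
        have h1 := hβ.1.parity
        have h2 := hα.1.parity
        omega
      · obtain ⟨k, hk, hkd⟩ := exists_adjacent_closer hn (Ne.symm hij)
        exact ⟨k, hk, by omega⟩
    have hb : InBand ξ k (p + 1) := by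
      have h1 := hξ.sub_le hn i k
      have h2 := hξ.sub_le hn (star i) (star k)
      have h3 := hξ.sub_le hn k j
      rw [diagDist_of_adjacent hn hk] at h1
      rw [diagDist_of_adjacent hn (hk.star hn)] at h2
      obtain ⟨b1, b2, b3⟩ := hβ.1
      have := hα.1.upper
      constructor <;> omega
    obtain ⟨β', hβ'⟩ := hτ.exists_at hξ hn hb
    refine .head ⟨i, k, p, (hτ.coord_zero_iff hξ hn).2 hβ, (hτ.coord_zero_iff hξ hn).2 hβ', hk⟩ ?_
    exact ih hβ' (by omega) hkd

theorem arLt_of_ahead (hξ : Q.IsHeightFunction ξ) (hτ : Q.IsCoxeterElement τ) (hn : 4 ≤ n)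
    {α β : PosRoot n} {i j : Fin n} {p q : ℤ} (hβ : At ξ i p β.1) (hα : At ξ j q α.1)
    (h : Ahead i p j q) : Q.ARLt ξ τ α β := by
  have hd := h.diagDist_le hξ hn hβ.1 hα.1
  have hlt := h.lt
  have e : ((q - p).toNat : ℤ) = q - p := Int.toNat_of_nonneg (by omega)
  have h1 := reflTransGen_of_diagDist_le hξ hτ hn hα (q - p).toNat hβ e.symm (by omega)
  refine ((Relation.reflTransGen_iff_eq_or_transGen).1 h1).resolve_left ?_
  rintro rfl
  have := (hβ.unique hξ hτ hn hα).2
  omega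

theorem arLt_iff_ahead (hξ : Q.IsHeightFunction ξ) (hτ : Q.IsCoxeterElement τ) (hn : 4 ≤ n)
    {α β : PosRoot n} {i j : Fin n} {p q : ℤ} (hβ : At ξ i p β.1) (hα : At ξ j q α.1) :
    Q.ARLt ξ τ α β ↔ Ahead i p j q :=
  ⟨fun h => ahead_of_arLt hξ hτ hn h hβ hα, arLt_of_ahead hξ hτ hn hβ hα⟩

theorem ARLt.asymm (hξ : Q.IsHeightFunction ξ) (hτ : Q.IsCoxeterElement τ) (hn : 4 ≤ n)
    {α β : PosRoot n} (h : Q.ARLt ξ τ α β) : ¬ Q.ARLt ξ τ β α := by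
  intro h'
  obtain ⟨i, p, hα⟩ := hξ.exists_at hn α
  obtain ⟨j, q, hβ⟩ := hξ.exists_at hn β
  have h1 := (ahead_of_arLt hξ hτ hn h hβ hα).lt
  have h2 := (ahead_of_arLt hξ hτ hn h' hα hβ).lt
  omega

end DynkinQuiver

/-! ### Comparing the decompositions of a root -/

namespace DynkinQuiver

variable {Q : DynkinQuiver n} {ξ : Fin n → ℤ} {τ : RootLattice n ≃ₗ[ℤ] RootLattice n}

/-- All the ways in which the vertices of two positive roots can lie relative to the vertex of
their sum. -/
theorem At.split (hξ : Q.IsHeightFunction ξ) (hτ : Q.IsCoxeterElement τ) (hn : 4 ≤ n)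
    {i i₁ i₂ : Fin n} {p p₁ p₂ : ℤ} {α β γ : RootLattice n} (h : At ξ i p γ) (h₁ : At ξ i₁ p₁ α)
    (h₂ : At ξ i₂ p₂ β) (hs : α + β = γ) :
    (¬ IsTip i ∧ ¬ IsTip i₁ ∧ ¬ IsTip i₂ ∧
      (ArmSplit (2 * n - 2) (p - row i) (p + row i) (p₁ - row i₁) (p₁ + row i₁) (p₂ - row i₂)
          (p₂ + row i₂) ∨
        ArmSplit (2 * n - 2) (p - row i) (p + row i) (p₂ - row i₂) (p₂ + row i₂) (p₁ - row i₁)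
          (p₁ + row i₁))) ∨
    (¬ IsTip i ∧ IsTip i₁ ∧ IsTip i₂ ∧
      ((p₁ + row i₁ = p + row i ∧ p₂ + row i₂ = p - row i + (2 * n - 2)) ∨
        (p₂ + row i₂ = p + row i ∧ p₁ + row i₁ = p - row i + (2 * n - 2)))) ∨
    (IsTip i ∧ IsTip i₁ ∧ ¬ IsTip i₂ ∧
      ((p₂ + row i₂ = p + row i ∧ p₂ - row i₂ = p₁ + row i₁) ∨
        (p₂ - row i₂ = p + row i - (2 * n - 2) ∧ p₂ + row i₂ = p₁ + row i₁ - (2 * n - 2)))) ∨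
    (IsTip i ∧ ¬ IsTip i₁ ∧ IsTip i₂ ∧
      ((p₁ + row i₁ = p + row i ∧ p₁ - row i₁ = p₂ + row i₂) ∨
        (p₁ - row i₁ = p + row i - (2 * n - 2) ∧ p₁ + row i₁ = p₂ + row i₂ - (2 * n - 2)))) := by
  have hadd := fun x hx => At.add hξ hτ hn h h₁ h₂ hs (x := x) hx
  have key : doubleRoot ξ i p = doubleRoot ξ i₁ p₁ + doubleRoot ξ i₂ p₂ := by
    rw [← h.2, ← h₁.2, ← h₂.2, ← smul_add, hs]
  have hf := congrArg (forkForm hn ξ) key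
  rw [forkForm_add] at hf
  have f := hξ.forkForm_doubleRoot hn i p
  have f₁ := hξ.forkForm_doubleRoot hn i₁ p₁
  have f₂ := hξ.forkForm_doubleRoot hn i₂ p₂
  obtain ⟨pb, pa⟩ := h.isPosition hξ hn
  obtain ⟨pb₁, pa₁⟩ := h₁.isPosition hξ hn
  obtain ⟨pb₂, pa₂⟩ := h₂.isPosition hξ hn
  -- The values `0` and `±2` of the linear form only leave an even number of tips.
  have cases : (¬ IsTip i ∧ ¬ IsTip i₁ ∧ ¬ IsTip i₂) ∨ (¬ IsTip i ∧ IsTip i₁ ∧ IsTip i₂) ∨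
      (IsTip i ∧ IsTip i₁ ∧ ¬ IsTip i₂) ∨ (IsTip i ∧ ¬ IsTip i₁ ∧ IsTip i₂) := by
    rcases f with ⟨t, f⟩ | ⟨t, f⟩ <;> rcases f₁ with ⟨t₁, f₁⟩ | ⟨t₁, f₁⟩ <;>
      rcases f₂ with ⟨t₂, f₂⟩ | ⟨t₂, f₂⟩ <;> first | omega | simp [t, t₁, t₂]
  rcases cases with ⟨t, t₁, t₂⟩ | ⟨t, t₁, t₂⟩ | ⟨t, t₁, t₂⟩ | ⟨t, t₁, t₂⟩ <;>
    simp only [t, t₁, t₂, if_true, if_false, sub_zero] at hadd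
  · refine Or.inl ⟨t, t₁, t₂, ?_⟩
    refine (hξ.isArm hn h.1 t).split (hξ.isArm hn h₁.1 t₁) (hξ.isArm hn h₂.1 t₂) fun x hx => ?_
    refine hadd x ?_
    simp only [List.mem_cons, List.not_mem_nil, or_false] at hx
    rcases hx with rfl | rfl | rfl | rfl | rfl | rfl <;> assumption
  · refine Or.inr (Or.inl ⟨t, t₁, t₂, ?_⟩)
    refine (hξ.isArm hn h.1 t).split_tips (hξ.isTipEnd hn h₁.1 t₁) (hξ.isTipEnd hn h₂.1 t₂)
      fun x hx => ?_
    refine hadd x ?_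
    simp only [List.mem_cons, List.not_mem_nil, or_false] at hx
    rcases hx with rfl | rfl | rfl | rfl <;> assumption
  · refine Or.inr (Or.inr (Or.inl ⟨t, t₁, t₂, ?_⟩))
    refine (hξ.isTipEnd hn h.1 t).split (hξ.isTipEnd hn h₁.1 t₁) (hξ.isArm hn h₂.1 t₂)
      fun x hx => ?_
    refine hadd x ?_
    simp only [List.mem_cons, List.not_mem_nil, or_false] at hx
    rcases hx with rfl | rfl | rfl | rfl <;> assumption
  · refine Or.inr (Or.inr (Or.inr ⟨t, t₁, t₂, ?_⟩))
    refine (hξ.isTipEnd hn h.1 t).split (hξ.isTipEnd hn h₂.1 t₂) (hξ.isArm hn h₁.1 t₁)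
      fun x hx => ?_
    refine (hadd x ?_).trans (add_comm _ _)
    simp only [List.mem_cons, List.not_mem_nil, or_false] at hx
    rcases hx with rfl | rfl | rfl | rfl <;> assumption

theorem At.ahead_or (hξ : Q.IsHeightFunction ξ) (hτ : Q.IsCoxeterElement τ) (hn : 4 ≤ n)
    {i i₁ i₂ : Fin n} {p p₁ p₂ : ℤ} {α β γ : RootLattice n} (h : At ξ i p γ) (h₁ : At ξ i₁ p₁ α)
    (h₂ : At ξ i₂ p₂ β) (hs : α + β = γ) :
    (Ahead i₂ p₂ i p ∧ Ahead i p i₁ p₁) ∨ (Ahead i₁ p₁ i p ∧ Ahead i p i₂ p₂) := by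
  suffices H : ((p₂ < p ∧ p₂ - row i₂ ≤ p - row i ∧ p₂ + row i₂ ≤ p + row i) ∧
      p < p₁ ∧ p - row i ≤ p₁ - row i₁ ∧ p + row i ≤ p₁ + row i₁) ∨
      ((p₁ < p ∧ p₁ - row i₁ ≤ p - row i ∧ p₁ + row i₁ ≤ p + row i) ∧
      p < p₂ ∧ p - row i ≤ p₂ - row i₂ ∧ p + row i ≤ p₂ + row i₂) by
    rcases H with ⟨⟨a1, a2, a3⟩, a4, a5, a6⟩ | ⟨⟨a1, a2, a3⟩, a4, a5, a6⟩
    · exact Or.inl ⟨⟨a1, a2, a3⟩, a4, a5, a6⟩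
    · exact Or.inr ⟨⟨a1, a2, a3⟩, a4, a5, a6⟩
  rcases h.split hξ hτ hn h₁ h₂ hs with ⟨t, t₁, t₂, H⟩ | ⟨t, t₁, t₂, H⟩ | ⟨t, t₁, t₂, H⟩ |
    ⟨t, t₁, t₂, H⟩
  · obtain ⟨-, -, -, -, l, l'⟩ := hξ.isArm hn h.1 t
    obtain ⟨-, -, -, -, l₁, l₁'⟩ := hξ.isArm hn h₁.1 t₁
    obtain ⟨-, -, -, -, l₂, l₂'⟩ := hξ.isArm hn h₂.1 t₂
    unfold ArmSplit at H
    rcases H with (H | H | H | H) | (H | H | H | H) <;> omega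
  · obtain ⟨-, -, -, -, l, l'⟩ := hξ.isArm hn h.1 t
    have := row_of_isTip t₁
    have := row_of_isTip t₂
    omega
  · obtain ⟨-, -, -, -, l₂, l₂'⟩ := hξ.isArm hn h₂.1 t₂
    have := row_of_isTip t
    have := row_of_isTip t₁
    omega
  · obtain ⟨-, -, -, -, l₁, l₁'⟩ := hξ.isArm hn h₁.1 t₁
    have := row_of_isTip t
    have := row_of_isTip t₂
    omega

theorem arLt_or_of_add_eq (hξ : Q.IsHeightFunction ξ) (hτ : Q.IsCoxeterElement τ) (hn : 4 ≤ n)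
    {α β γ : PosRoot n} (hs : α.1 + β.1 = γ.1) :
    (Q.ARLt ξ τ α γ ∧ Q.ARLt ξ τ γ β) ∨ (Q.ARLt ξ τ β γ ∧ Q.ARLt ξ τ γ α) := by
  obtain ⟨i, p, h⟩ := hξ.exists_at hn γ
  obtain ⟨i₁, p₁, h₁⟩ := hξ.exists_at hn α
  obtain ⟨i₂, p₂, h₂⟩ := hξ.exists_at hn β
  rw [arLt_iff_ahead hξ hτ hn h h₁, arLt_iff_ahead hξ hτ hn h₂ h, arLt_iff_ahead hξ hτ hn h h₂,
    arLt_iff_ahead hξ hτ hn h₁ h, and_comm, and_comm (a := Ahead i p i₂ p₂)]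
  exact h.ahead_or hξ hτ hn h₁ h₂ hs

/-- Nested decompositions force the interval of the sum to have in its interior the position at
which `epsVec` vanishes at the branch vertex. -/
theorem At.straddle_of_nested (hξ : Q.IsHeightFunction ξ) (hτ : Q.IsCoxeterElement τ) (hn : 4 ≤ n)
    {i i₁ i₂ j₁ j₂ : Fin n} {p p₁ p₂ q₁ q₂ : ℤ} {α β α' β' γ : RootLattice n} (h : At ξ i p γ)
    (h₁ : At ξ i₁ p₁ α) (h₂ : At ξ i₂ p₂ β) (hs : α + β = γ) (h₁' : At ξ j₁ q₁ α')
    (h₂' : At ξ j₂ q₂ β') (hs' : α' + β' = γ) (a₁ : Ahead j₁ q₁ i₁ p₁) (a₂ : Ahead i p j₁ q₁)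
    (a₃ : Ahead j₂ q₂ i p) (a₄ : Ahead i₂ p₂ j₂ q₂) :
    ¬ IsTip i ∧ p - row i ≤ ξ ⟨n - 3, by omega⟩ - (n - 2) - 2 ∧
      ξ ⟨n - 3, by omega⟩ - (n - 2) < p + row i := by
  obtain ⟨b₁, b₁', b₁''⟩ := a₁
  obtain ⟨b₂, b₂', b₂''⟩ := a₂
  obtain ⟨b₃, b₃', b₃''⟩ := a₃
  obtain ⟨b₄, b₄', b₄''⟩ := a₄
  rcases h.split hξ hτ hn h₁ h₂ hs with ⟨t, t₁, t₂, H⟩ | ⟨t, t₁, t₂, H⟩ | ⟨t, t₁, t₂, H⟩ |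
    ⟨t, t₁, t₂, H⟩ <;>
  rcases h.split hξ hτ hn h₁' h₂' hs' with ⟨u, u₁, u₂, H'⟩ | ⟨u, u₁, u₂, H'⟩ | ⟨u, u₁, u₂, H'⟩ |
    ⟨u, u₁, u₂, H'⟩ <;>
  first | exact absurd t u | exact absurd u t | skip
  · obtain ⟨-, -, -, -, l, l'⟩ := hξ.isArm hn h.1 t
    obtain ⟨-, -, A₁, A₁', l₁, l₁'⟩ := hξ.isArm hn h₁.1 t₁
    obtain ⟨-, -, A₂, A₂', l₂, l₂'⟩ := hξ.isArm hn h₂.1 t₂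
    obtain ⟨-, -, -, -, m₁, m₁'⟩ := hξ.isArm hn h₁'.1 u₁
    obtain ⟨-, -, -, -, m₂, m₂'⟩ := hξ.isArm hn h₂'.1 u₂
    unfold ArmSplit at H H'
    refine ⟨t, ?_⟩
    rcases H with (H | H | H | H) | (H | H | H | H) <;> omega
  · obtain ⟨-, -, -, -, l, l'⟩ := hξ.isArm hn h.1 t
    obtain ⟨-, -, A₁, A₁', l₁, l₁'⟩ := hξ.isArm hn h₁.1 t₁
    obtain ⟨-, -, A₂, A₂', l₂, l₂'⟩ := hξ.isArm hn h₂.1 t₂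
    have := row_of_isTip u₁
    have := row_of_isTip u₂
    unfold ArmSplit at H
    refine ⟨t, ?_⟩
    rcases H with (H | H | H | H) | (H | H | H | H) <;> omega
  · obtain ⟨-, -, -, -, l, l'⟩ := hξ.isArm hn h.1 t
    obtain ⟨-, -, -, -, m₁, m₁'⟩ := hξ.isArm hn h₁'.1 u₁
    obtain ⟨-, -, -, -, m₂, m₂'⟩ := hξ.isArm hn h₂'.1 u₂
    have := row_of_isTip t₁
    have := row_of_isTip t₂
    unfold ArmSplit at H'
    refine ⟨t, ?_⟩
    rcases H' with (H' | H' | H' | H') | (H' | H' | H' | H') <;> omega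
  · have := row_of_isTip t₁
    have := row_of_isTip t₂
    have := row_of_isTip u₁
    have := row_of_isTip u₂
    omega
  · obtain ⟨-, -, -, -, l₂, l₂'⟩ := hξ.isArm hn h₂.1 t₂
    obtain ⟨-, -, -, -, m₂, m₂'⟩ := hξ.isArm hn h₂'.1 u₂
    have := row_of_isTip t
    have := row_of_isTip t₁
    have := row_of_isTip u₁
    omega
  · obtain ⟨-, -, -, -, l₂, l₂'⟩ := hξ.isArm hn h₂.1 t₂
    obtain ⟨-, -, -, -, m₁, m₁'⟩ := hξ.isArm hn h₁'.1 u₁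
    have := row_of_isTip t
    have := row_of_isTip t₁
    have := row_of_isTip u₂
    omega
  · obtain ⟨-, -, -, -, l₁, l₁'⟩ := hξ.isArm hn h₁.1 t₁
    obtain ⟨-, -, -, -, m₂, m₂'⟩ := hξ.isArm hn h₂'.1 u₂
    have := row_of_isTip t
    have := row_of_isTip t₂
    have := row_of_isTip u₁
    omega
  · obtain ⟨-, -, -, -, l₁, l₁'⟩ := hξ.isArm hn h₁.1 t₁
    obtain ⟨-, -, -, -, m₁, m₁'⟩ := hξ.isArm hn h₁'.1 u₁
    have := row_of_isTip t
    have := row_of_isTip t₂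
    have := row_of_isTip u₂
    omega

theorem wave_eq_or (y : ℤ) : wave n y = 1 ∨ wave n y = -1 := by
  unfold wave
  split_ifs <;> simp

theorem two_mul_apply_of_two_smul_eq {v w : RootLattice n} (h : (2 : ℤ) • v = w) (j : Fin n) :
    2 * v j = w j := by
  rw [← h, Pi.smul_apply, smul_eq_mul]

/-- A root has multiplicity two at the branch vertex if its interval has in its interior the
position at which `epsVec` vanishes there: the two ends then contribute with opposite signs. -/
theorem At.apply_branch_of_straddle (hξ : Q.IsHeightFunction ξ) (hn : 4 ≤ n) {i : Fin n} {p : ℤ}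
    {γ : RootLattice n} (h : At ξ i p γ) (hi : ¬ IsTip i)
    (h₁ : p - row i ≤ ξ ⟨n - 3, by omega⟩ - (n - 2) - 2)
    (h₂ : ξ ⟨n - 3, by omega⟩ - (n - 2) < p + row i) : γ ⟨n - 3, by omega⟩ = 2 := by
  have ht3 : ¬ IsTip (⟨n - 3, by omega⟩ : Fin n) := by simp only [IsTip]; omega
  have e3 := row_of_not_isTip ht3
  simp only at e3
  obtain ⟨-, -, A, A', -, -⟩ := hξ.isArm hn h.1 hi
  have e := two_mul_apply_of_two_smul_eq h.2 ⟨n - 3, by omega⟩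
  rw [doubleRoot_of_not_isTip ξ hi, Pi.sub_apply, epsVec, epsVec] at e
  have s₁ := (pulse_spec ht3 (p + row i - ξ ⟨n - 3, by omega⟩)).1 (by omega) (by omega)
  have s₂ := (pulse_spec ht3 (p - row i - ξ ⟨n - 3, by omega⟩)).2.2.2.1 (by omega) (by omega)
  omega

/-- Conversely, the interval of a root with a multiplicity above one has that position in its
interior. -/
theorem At.straddle_of_two_le (hξ : Q.IsHeightFunction ξ) (hn : 4 ≤ n) {i j : Fin n} {p : ℤ}
    {γ : RootLattice n} (h : At ξ i p γ) (hj : 2 ≤ γ j) :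
    ¬ IsTip i ∧ p - row i ≤ ξ ⟨n - 3, by omega⟩ - (n - 2) - 2 ∧
      ξ ⟨n - 3, by omega⟩ - (n - 2) < p + row i := by
  have e := two_mul_apply_of_two_smul_eq h.2 j
  by_cases tj : IsTip j
  · -- at a tip, both contributions to twice the coordinate are signs
    exfalso
    rw [doubleRoot, doubleCoord] at e
    simp only [pulse_of_isTip tj, forkPart, tj, if_true] at e
    have w₁ := wave_eq_or (n := n) (p - ξ j + row i + (n - 1))
    have w₂ := wave_eq_or (n := n) (p - ξ j - row i + (n - 1))
    have w₃ := altSign_eq (p - ξ j)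
    split_ifs at e <;> omega
  have ht3 : ¬ IsTip (⟨n - 3, by omega⟩ : Fin n) := by simp only [IsTip]; omega
  have e3 := row_of_not_isTip ht3
  simp only at e3
  have d := hξ.sub_le_of_not_isTip hn tj ht3
  obtain ⟨hl, hu, -⟩ := h.1
  by_cases ti : IsTip i
  · exfalso
    rw [doubleRoot, doubleCoord] at e
    simp only [forkPart, ti, tj, if_true, if_false] at e
    have := pulse_spec tj (p - ξ j + row i)
    have d₁ := hξ.sub_le_of_isTip hn ti tj
    have d₂ := hξ.sub_le_of_isTip hn (isTip_star.2 ti) tj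
    have r := row_of_isTip ti
    omega
  · refine ⟨ti, ?_⟩
    rw [star_of_not_isTip ti] at hl
    rw [doubleRoot_of_not_isTip ξ ti, Pi.sub_apply, epsVec, epsVec] at e
    have s₁ := pulse_spec tj (p + row i - ξ j)
    have s₂ := pulse_spec tj (p - row i - ξ j)
    have d₁ := hξ.sub_le_of_not_isTip hn ti tj
    have c₁ : -row j < p + row i - ξ j ∧ p + row i - ξ j ≤ row j := by omega
    have c₂ : p - row i - ξ j ≤ -(2 * n - 2) + row j := by omega
    omega

/-- Every interval of even length below `2n - 2` that starts or ends at the position at which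
`epsVec` vanishes at the branch vertex stands for a positive root. -/
theorem IsCoxeterElement.exists_at_interval (hτ : Q.IsCoxeterElement τ)
    (hξ : Q.IsHeightFunction ξ) (hn : 4 ≤ n) {a b : ℤ}
    (hab : a = ξ ⟨n - 3, by omega⟩ - (n - 2) ∨ b = ξ ⟨n - 3, by omega⟩ - (n - 2)) (hlt : a < b)
    (hle : b ≤ a + (2 * n - 4)) (hpar : (b - a) % 2 = 0) :
    ∃ (i : Fin n) (p : ℤ) (β : PosRoot n), At ξ i p β.1 ∧ p - row i = a ∧ p + row i = b ∧
      (2 : ℤ) • β.1 = epsVec ξ b - epsVec ξ a := by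
  have ht3 : ¬ IsTip (⟨n - 3, by omega⟩ : Fin n) := by simp only [IsTip]; omega
  have e3 := row_of_not_isTip ht3
  simp only at e3
  obtain ⟨r, hr⟩ : ∃ r : ℕ, (r : ℤ) + 1 = (b - a) / 2 := ⟨((b - a) / 2 - 1).toNat, by omega⟩
  have hrn : r < n := by omega
  have ti : ¬ IsTip (⟨r, hrn⟩ : Fin n) := by simp only [IsTip]; omega
  have er := row_of_not_isTip ti
  simp only at er
  have d := hξ.sub_le_of_not_isTip hn ti ht3
  have par := hξ.sub_row_mod_two hn ⟨r, hrn⟩ ⟨n - 3, by omega⟩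
  have hb : InBand ξ ⟨r, hrn⟩ ((a + b) / 2) := by
    constructor
    · rw [star_of_not_isTip ti]; omega
    · omega
    · omega
  obtain ⟨β, hβ⟩ := hτ.exists_at hξ hn hb
  have ha' : (a + b) / 2 - row ⟨r, hrn⟩ = a := by omega
  have hb' : (a + b) / 2 + row ⟨r, hrn⟩ = b := by omega
  refine ⟨_, _, β, hβ, ha', hb', ?_⟩
  rw [hβ.2, doubleRoot_of_not_isTip ξ ti, ha', hb']

/-- A root with a multiplicity above one has two nested decompositions. If its interval is `[a, b]`
and `c` is the position in its interior at which `epsVec` vanishes at the branch vertex, the inner one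
is `[a, c] + [c, b]`, and the outer one is `[b - M, c] + [c, a + M]`, where a translation by
`M = 2n - 2` changes the sign. -/
theorem exists_nested_of_two_le (hξ : Q.IsHeightFunction ξ) (hτ : Q.IsCoxeterElement τ)
    (hn : 4 ≤ n) {γ : PosRoot n} {j : Fin n} (hj : 2 ≤ γ.1 j) :
    ∃ α β α' β' : PosRoot n, α.1 + β.1 = γ.1 ∧ α'.1 + β'.1 = γ.1 ∧ Q.ARLt ξ τ α α' ∧
      Q.ARLt ξ τ α' γ ∧ Q.ARLt ξ τ γ β' ∧ Q.ARLt ξ τ β' β := by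
  obtain ⟨i, p, h⟩ := hξ.exists_at hn γ
  obtain ⟨ti, l, r⟩ := h.straddle_of_two_le hξ hn hj
  obtain ⟨-, -, A, A', -, -⟩ := hξ.isArm hn h.1 ti
  have hi := row_of_not_isTip ti
  have ti' : ¬ n ≤ i.val + 2 := ti
  have ht3 : ¬ IsTip (⟨n - 3, by omega⟩ : Fin n) := by simp only [IsTip]; omega
  have e3 := row_of_not_isTip ht3
  simp only at e3
  have par := hξ.sub_row_mod_two hn i ⟨n - 3, by omega⟩
  have par' := h.1.parity
  have hγ := h.2
  rw [doubleRoot_of_not_isTip ξ ti] at hγ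
  set c := ξ ⟨n - 3, by omega⟩ - ((n : ℤ) - 2) with hc
  obtain ⟨i₁, p₁, α, h₁, a₁, b₁, eα⟩ := hτ.exists_at_interval hξ hn
    (a := c) (b := p - row i + (2 * n - 2)) (Or.inl rfl) (by omega) (by omega) (by omega)
  obtain ⟨i₂, p₂, β, h₂, a₂, b₂, eβ⟩ := hτ.exists_at_interval hξ hn
    (a := p + row i - (2 * n - 2)) (b := c) (Or.inr rfl) (by omega) (by omega) (by omega)
  obtain ⟨i₃, p₃, α', h₃, a₃, b₃, eα'⟩ := hτ.exists_at_interval hξ hn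
    (a := c) (b := p + row i) (Or.inl rfl) (by omega) (by omega) (by omega)
  obtain ⟨i₄, p₄, β', h₄, a₄, b₄, eβ'⟩ := hτ.exists_at_interval hξ hn
    (a := p - row i) (b := c) (Or.inr rfl) (by omega) (by omega) (by omega)
  refine ⟨α, β, α', β', two_smul_injective ?_, two_smul_injective ?_,
    arLt_of_ahead hξ hτ hn h₃ h₁ ?_, arLt_of_ahead hξ hτ hn h h₃ ?_,
    arLt_of_ahead hξ hτ hn h₄ h ?_, arLt_of_ahead hξ hτ hn h₂ h₄ ?_⟩
  · rw [smul_add, eα, eβ, hγ, epsVec_add hn, epsVec_sub hn]; abel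
  · rw [smul_add, eα', eβ', hγ]; abel
  all_goals constructor <;> omega

/-- The decompositions of a multiplicity free root are not nested. -/
theorem not_nested_of_isMultiplicityFree (hξ : Q.IsHeightFunction ξ) (hτ : Q.IsCoxeterElement τ)
    (hn : 4 ≤ n) {α β α' β' γ : PosRoot n} (hγ : IsMultiplicityFree γ) (hs : α.1 + β.1 = γ.1)
    (hs' : α'.1 + β'.1 = γ.1) (l₁ : Q.ARLt ξ τ α α') (l₂ : Q.ARLt ξ τ α' γ)
    (l₃ : Q.ARLt ξ τ γ β') (l₄ : Q.ARLt ξ τ β' β) : False := by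
  obtain ⟨i, p, h⟩ := hξ.exists_at hn γ
  obtain ⟨i₁, p₁, h₁⟩ := hξ.exists_at hn α
  obtain ⟨i₂, p₂, h₂⟩ := hξ.exists_at hn β
  obtain ⟨i₃, p₃, h₃⟩ := hξ.exists_at hn α'
  obtain ⟨i₄, p₄, h₄⟩ := hξ.exists_at hn β'
  obtain ⟨ti, l, r⟩ := h.straddle_of_nested hξ hτ hn h₁ h₂ hs h₃ h₄ hs'
    (ahead_of_arLt hξ hτ hn l₁ h₃ h₁) (ahead_of_arLt hξ hτ hn l₂ h h₃)
    (ahead_of_arLt hξ hτ hn l₃ h₄ h) (ahead_of_arLt hξ hτ hn l₄ h₂ h₄)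
  have h1 := h.apply_branch_of_straddle hξ hn ti l r
  have h2 := hγ ⟨n - 3, by omega⟩
  omega

end DynkinQuiver

/-! ### Linear extensions -/

/-- A strict order has a linear extension in which only those elements lie between `a` and `b`
that lie between them already. -/
theorem exists_linear_extension_between {ι : Type*} (R : ι → ι → Prop)
    (htrans : ∀ {x y z}, R x y → R y z → R x z) (hasymm : ∀ {x y}, R x y → ¬ R y x) {a b : ι}
    (hab : R a b) :
    ∃ lt : ι → ι → Prop, IsStrictTotalOrder ι lt ∧ (∀ x y, R x y → lt x y) ∧
      ∀ x, lt a x → lt x b → R a x ∧ R x b := by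
  classical
  -- First come the elements not above `a`, then those between `a` and `b`, then the others.
  let level : ι → ℕ := fun x =>
    if a = x ∨ R a x then (if x = b ∨ R x b then 1 else 2) else 0
  have mono : ∀ {x y}, R x y → level x ≤ level y := by
    intro x y h
    have h1 : (a = x ∨ R a x) → (a = y ∨ R a y) := by
      rintro (rfl | h')
      exacts [Or.inr h, Or.inr (htrans h' h)]
    have h2 : (y = b ∨ R y b) → (x = b ∨ R x b) := by
      rintro (rfl | h')
      exacts [Or.inr h, Or.inr (htrans h h')]
    simp only [level]
    by_cases c1 : a = x ∨ R a x
    · rw [if_pos c1, if_pos (h1 c1)]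
      by_cases c2 : y = b ∨ R y b
      · rw [if_pos c2, if_pos (h2 c2)]
      · rw [if_neg c2]; split_ifs <;> omega
    · rw [if_neg c1]; omega
  have la : level a = 1 := by simp [level, hab]
  have lb : level b = 1 := by simp [level, hab]
  let r : ι → ι → Prop := fun x y => level x < level y ∨ (level x = level y ∧ (x = y ∨ R x y))
  have hr : IsPartialOrder ι r :=
    { refl := fun x => Or.inr ⟨rfl, Or.inl rfl⟩
      trans := by
        rintro x y z (h1 | ⟨h1, h1'⟩) (h2 | ⟨h2, h2'⟩)
        · exact Or.inl (h1.trans h2)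
        · exact Or.inl (by omega)
        · exact Or.inl (by omega)
        · refine Or.inr ⟨h1.trans h2, ?_⟩
          rcases h1' with rfl | h1'
          · exact h2'
          · rcases h2' with rfl | h2'
            exacts [Or.inr h1', Or.inr (htrans h1' h2')]
      antisymm := by
        rintro x y (h1 | ⟨h1, h1'⟩) (h2 | ⟨h2, h2'⟩)
        · omega
        · omega
        · omega
        · rcases h1' with h1' | h1'
          · exact h1'
          · rcases h2' with h2' | h2'
            exacts [h2'.symm, absurd h2' (hasymm h1')] }
  obtain ⟨s, hs, hrs⟩ := extend_partialOrder r
  have level_le : ∀ {x y}, s x y → level x ≤ level y := by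
    intro x y h
    by_contra hlt
    have h1 : s y x := hrs _ _ (Or.inl (not_le.1 hlt))
    have := antisymm_of s h h1
    subst this
    exact hlt le_rfl
  refine ⟨fun x y => s x y ∧ x ≠ y, ?_, ?_, ?_⟩
  · exact
      { trichotomous := fun x y h1 h2 => by
          by_contra hne
          rcases total_of s x y with h | h
          · exact h1 ⟨h, hne⟩
          · exact h2 ⟨h, Ne.symm hne⟩
        irrefl := fun x h => h.2 rfl
        trans := fun x y z h1 h2 => by
          refine ⟨trans_of s h1.1 h2.1, ?_⟩
          rintro rfl
          exact h1.2 (antisymm_of s h1.1 h2.1) }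
  · intro x y h
    refine ⟨hrs _ _ ?_, ?_⟩
    · rcases (mono h).lt_or_eq with h' | h'
      exacts [Or.inl h', Or.inr ⟨h', Or.inr h⟩]
    · rintro rfl
      exact hasymm h h
  · rintro x ⟨h1, h1'⟩ ⟨h2, h2'⟩
    have e1 := level_le h1
    have e2 := level_le h2
    have e : level x = 1 := by omega
    simp only [level] at e
    split_ifs at e with c1 c2
    · exact ⟨c1.resolve_left h1', c2.resolve_left h2'⟩
    · omega

namespace DynkinQuiver

variable {Q : DynkinQuiver n} {ξ : Fin n → ℤ} {τ : RootLattice n ≃ₗ[ℤ] RootLattice n}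

theorem isConvexOrder_of_compatible (hξ : Q.IsHeightFunction ξ) (hτ : Q.IsCoxeterElement τ)
    (hn : 4 ≤ n) {lt : PosRoot n → PosRoot n → Prop} (h : ∀ α β, Q.ARLt ξ τ α β → lt α β) :
    IsConvexOrder lt := fun _ _ _ hs =>
  (arLt_or_of_add_eq hξ hτ hn hs).imp (And.imp (h _ _) (h _ _)) (And.imp (h _ _) (h _ _))

theorem exists_isMinimalPair (hξ : Q.IsHeightFunction ξ) (hτ : Q.IsCoxeterElement τ)
    (hn : 4 ≤ n) {α β γ : PosRoot n} (hγ : IsMultiplicityFree γ) (hs : α.1 + β.1 = γ.1)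
    (h₁ : Q.ARLt ξ τ α γ) (h₂ : Q.ARLt ξ τ γ β) :
    ∃ lt, IsCompatibleOrder Q ξ τ lt ∧ IsMinimalPair lt α β γ := by
  have htrans : ∀ {x y z}, Q.ARLt ξ τ x y → Q.ARLt ξ τ y z → Q.ARLt ξ τ x z :=
    fun h h' => Relation.TransGen.trans h' h
  obtain ⟨lt, htot, hcomp, hbtw⟩ := exists_linear_extension_between (Q.ARLt ξ τ) htrans
    (fun h => ARLt.asymm hξ hτ hn h) (htrans h₁ h₂)
  refine ⟨lt, ⟨htot, isConvexOrder_of_compatible hξ hτ hn hcomp, hcomp⟩,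
    hcomp _ _ (htrans h₁ h₂), hs, ?_⟩
  rintro ⟨α', β', hs', l₁, l₂, l₃, l₄⟩
  have k₁ := hbtw α' l₁ (htot.trans _ _ _ l₂ (htot.trans _ _ _ l₃ l₄))
  have k₂ := hbtw β' (htot.trans _ _ _ l₁ (htot.trans _ _ _ l₂ l₃)) l₄
  rcases arLt_or_of_add_eq hξ hτ hn hs' with ⟨h, h'⟩ | ⟨h, h'⟩
  · exact not_nested_of_isMultiplicityFree hξ hτ hn hγ hs hs' k₁.1 h h' k₂.2
  · exact htot.irrefl _ (htot.trans _ _ _ l₂ (hcomp _ _ h'))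

end DynkinQuiver

end TypeD

theorem mainTheorem1 (n : ℕ) (hn : 4 ≤ n) (Q : TypeD.DynkinQuiver n)
    (ξ : Fin n → ℤ) (hξ : Q.IsHeightFunction ξ)
    (τ : TypeD.RootLattice n ≃ₗ[ℤ] TypeD.RootLattice n) (hτ : Q.IsCoxeterElement τ)
    (γ : TypeD.PosRoot n) (hγ : ¬ TypeD.IsSimple γ) :
    (∀ α β : TypeD.PosRoot n, α.1 + β.1 = γ.1 →
      ∃ lt : TypeD.PosRoot n → TypeD.PosRoot n → Prop, TypeD.IsCompatibleOrder Q ξ τ lt ∧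
        (TypeD.IsMinimalPair lt α β γ ∨ TypeD.IsMinimalPair lt β α γ)) ↔
      TypeD.IsMultiplicityFree γ := by
  constructor
  · intro H
    by_contra hmf
    obtain ⟨j, hj⟩ : ∃ j, 1 < γ.1 j := by
      simpa only [TypeD.IsMultiplicityFree, not_forall, not_le] using hmf
    obtain ⟨α, β, α', β', hs, hs', l₁, l₂, l₃, l₄⟩ :=
      TypeD.DynkinQuiver.exists_nested_of_two_le hξ hτ hn (j := j) hj
    obtain ⟨lt, ⟨htot, -, hcomp⟩, hmin | hmin⟩ := H α β hs
    · exact hmin.2.2 ⟨α', β', hs', hcomp _ _ l₁, hcomp _ _ l₂, hcomp _ _ l₃, hcomp _ _ l₄⟩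
    · have h : lt α β := htot.trans _ _ _ (hcomp _ _ l₁) (htot.trans _ _ _ (hcomp _ _ l₂)
        (htot.trans _ _ _ (hcomp _ _ l₃) (hcomp _ _ l₄)))
      exact htot.irrefl _ (htot.trans _ _ _ h hmin.1)
  · intro hmf α β hs
    rcases TypeD.DynkinQuiver.arLt_or_of_add_eq hξ hτ hn hs with ⟨h₁, h₂⟩ | ⟨h₁, h₂⟩
    · obtain ⟨lt, hlt, hmin⟩ := TypeD.DynkinQuiver.exists_isMinimalPair hξ hτ hn hmf hs h₁ h₂
      exact ⟨lt, hlt, Or.inl hmin⟩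
    · obtain ⟨lt, hlt, hmin⟩ := TypeD.DynkinQuiver.exists_isMinimalPair hξ hτ hn hmf
        ((add_comm _ _).trans hs) h₁ h₂
      exact ⟨lt, hlt, Or.inr hmin⟩
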